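/- **Setting.** All alphabets are finite, entropies are in bits, and $[x]_+=\max\{0,x\}$. A 2DMBC is a pair of independent discrete memoryless broadcast channels: a forward channel $X_f\to(Y_f,Z_f)$ from Alice to Bob and Eve, specified by $P_{Y_f,Z_f|X_f}$, and a backward channel $X_b\to(Y_b,Z_b)$ from Bob to Alice and Eve, specified by $P_{Y_b,Z_b|X_b}$. In a protocol Alice and Bob alternately send blocks in rounds, each block being a function of the sender's private randomness and of the blocks received so far. At the end one party computes a key $S$ in a finite set $\mathcal S$, and the other an estimate $\hat S\in\mathcal S$, each from the private randomness and received blocks of that party. If the protocol uses the forward channel $n_f$ and the backward channel $n_b$ times, $n_f+n_b\ge 1$, it is $(R,\delta)$-secure if $$\frac{H(S)}{n_f+n_b}>R-\delta,\qquad \frac{H(S)}{n_f+n_b}>\frac{\log_2|\mathcal S|}{n_f+n_b}-\delta,\qquad \Pr(\hat S\ne S)<\delta,\qquad \frac{H(S\mid View_E)}{H(S)}>1-\delta,$$ where $View_E$ consists of all blocks received by Eve. The secret-key capacity $C_{sk}^{2DMBC}$ is the supremum of the $R\ge 0$ such that for every $0<\delta\le 1$ there is an $(R,\delta)$-secure protocol.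 **Theorem.** For every 2DMBC, $$C_{sk}^{2DMBC}\ \ge\ \max\{L_A,L_B\},$$ where $$L_A=\sup\ \frac{n_f R^A_{s1}+n_b[R^A_{s2}]_+}{n_f+n_b}\quad\text{subject to}\quad n_f\, I(V_f;Y_f|X_f)<n_b\, I(W_{1,b};Y_b),$$ $$R^A_{s1}=I(V_f;X_f)-I(V_f;Z_f),\qquad R^A_{s2}=I(W_{1,b};Y_b|W_{2,b})-I(W_{1,b};Z_b|W_{2,b}),$$ the supremum being over all integers $n_f,n_b\ge 0$ and all finite-valued random variables such that $(X_f,Y_f,Z_f)$ and $(X_b,Y_b,Z_b)$ are consistent with the two channels and $V_f\leftrightarrow Y_f\leftrightarrow(X_f,Z_f)$ and $W_{2,b}\leftrightarrow W_{1,b}\leftrightarrow X_b\leftrightarrow(Y_b,Z_b)$ are Markov chains; and $L_B$ is obtained from $L_A$ by exchanging the roles of $f$ and $b$, i.e. it is the supremum of $$\frac{n_b R^B_{s1}+n_f[R^B_{s2}]_+}{n_f+n_b}\quad\text{subject to}\quad n_b\, I(V_b;Y_b|X_b)<n_f\, I(W_{1,f};Y_f),$$ with $R^B_{s1}=I(V_b;X_b)-I(V_b;Z_b)$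 and $R^B_{s2}=I(W_{1,f};Y_f|W_{2,f})-I(W_{1,f};Z_f|W_{2,f})$ (a supremum over an empty set is $-\infty$). Moreover, the bound is achieved by two-round protocols: for every $R\ge 0$ with $R\le L_A$ (respectively $R\le L_B$) and every $0<\delta\le 1$, there is an $(R,\delta)$-secure protocol with exactly two rounds initiated by Alice (respectively by Bob). -/

import Mathlib

open scoped BigOperators

/-! ### Entropies of random variables on a finite sample space -/

section Entropy

open Classical in
/-- The probability of the event `E`, for the probability mass function `P` on the finite sample
space `Ω`. -/
noncomputable def prob {Ω : Type*} [Fintype Ω] (P : Ω → ℝ) (E : Ω → Prop) : ℝ :=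
  ∑ ω, if E ω then P ω else 0

/-- The distribution `a ↦ Pr(U = a)` of the random variable `U`. -/
noncomputable def distr {Ω α : Type*} [Fintype Ω] (P : Ω → ℝ) (U : Ω → α) (a : α) : ℝ :=
  prob P (fun ω => U ω = a)

/-- Shannon entropy `H(U)` in bits. -/
noncomputable def entropy {Ω α : Type*} [Fintype Ω] [Fintype α] (P : Ω → ℝ) (U : Ω → α) : ℝ :=
  ∑ a, Real.negMulLog (distr P U a) / Real.log 2

/-- Conditional entropy `H(U | V) = H(U, V) - H(V)`. -/
noncomputable def condEntropy {Ω α β : Type*} [Fintype Ω] [Fintype α] [Fintype β]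
    (P : Ω → ℝ) (U : Ω → α) (V : Ω → β) : ℝ :=
  entropy P (fun ω => (U ω, V ω)) - entropy P V

/-- Mutual information `I(U; V) = H(U) - H(U | V)`. -/
noncomputable def mutualInfo {Ω α β : Type*} [Fintype Ω] [Fintype α] [Fintype β]
    (P : Ω → ℝ) (U : Ω → α) (V : Ω → β) : ℝ :=
  entropy P U - condEntropy P U V

/-- Conditional mutual information `I(U; V | T) = H(U | T) - H(U | V, T)`. -/
noncomputable def condMutualInfo {Ω α β γ : Type*} [Fintype Ω] [Fintype α] [Fintype β] [Fintype γ]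
    (P : Ω → ℝ) (U : Ω → α) (V : Ω → β) (T : Ω → γ) : ℝ :=
  condEntropy P U T - condEntropy P U (fun ω => (V ω, T ω))

/-- `U ↔ V ↔ T` is a Markov chain: `P(u,v,t) P(v) = P(u,v) P(v,t)` for all `u, v, t`. -/
def IsMarkov {Ω α β γ : Type*} [Fintype Ω]
    (P : Ω → ℝ) (U : Ω → α) (V : Ω → β) (T : Ω → γ) : Prop :=
  ∀ u v t, distr P (fun ω => (U ω, V ω, T ω)) (u, v, t) * distr P V v =
    distr P (fun ω => (U ω, V ω)) (u, v) * distr P (fun ω => (V ω, T ω)) (v, t)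

/-- The random variables `(X, Y, Z)` are consistent with the conditional distribution
`W x (y, z) = P(y, z | x)`. -/
def IsConsistent {Ω 𝒳 𝒴 𝒵 : Type*} [Fintype Ω] [Fintype 𝒴] [Fintype 𝒵]
    (P : Ω → ℝ) (X : Ω → 𝒳) (Y : Ω → 𝒴) (Z : Ω → 𝒵) (W : 𝒳 → stdSimplex ℝ (𝒴 × 𝒵)) : Prop :=
  ∀ x y z, distr P (fun ω => (X ω, Y ω, Z ω)) (x, y, z) = distr P X x * W x (y, z)

end Entropy

/-! ### The two legitimate parties -/

/-- The two legitimate parties. A 2DMBC is a family of two broadcast channels indexed by the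
*sender*: the channel of index `alice` is the forward channel `X_f → (Y_f, Z_f)` from Alice to Bob
and Eve, the one of index `bob` is the backward channel `X_b → (Y_b, Z_b)`. -/
inductive Party
  | alice
  | bob
deriving DecidableEq

instance : Fintype Party := ⟨{Party.alice, Party.bob}, fun p => by cases p <;> decide⟩

/-- The other legitimate party. -/
def Party.other : Party → Party
  | alice => bob
  | bob => alice

/-- The party sending in round `r` (rounds are numbered `0, 1, 2, …`) if `first` initiates the
protocol: the two parties alternate. -/
def sender (first : Party) (r : ℕ) : Party :=
  if r % 2 = 0 then first else first.other

/-! ### Secret-key establishment protocols -/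

/-- A multi-round secret-key establishment protocol for a 2DMBC in which party `p` sends symbols of
`X p` and the other party receives symbols of `Y p`. Each party `p` has a private random variable on
a finite set, with an arbitrary law; the two are independent. The block sent in a round is a
function of the private randomness of the sender and of the blocks that he received in the earlier
rounds (what he sent himself is determined by these). At the end, each party computes a value of
the key alphabet from his private randomness and all the blocks that he received. The value computed
by `keyParty` is the key `S`, the one computed by the other party is the estimate of the key. -/
structure Protocol (X Y : Party → Type*) where
  /-- The party sending in the first round. -/
  initiator : Party
  /-- The number of rounds. -/
  rounds : ℕ
  /-- The length of the block sent in each round. -/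
  len : Fin rounds → ℕ
  /-- The size of the range of the private randomness of each party. -/
  randSize : Party → ℕ
  /-- The law of the private randomness of each party. -/
  rand : ∀ p, stdSimplex ℝ (Fin (randSize p))
  /-- The block sent in round `r`. -/
  encode : ∀ r : Fin rounds, Fin (randSize (sender initiator r)) →
    (∀ s : Fin rounds, s < r → sender initiator s ≠ sender initiator r →
      Fin (len s) → Y (sender initiator s)) →
    Fin (len r) → X (sender initiator r)
  /-- The size of the key alphabet. -/
  keySize : ℕ
  /-- The party who computes the key (the other one estimates it). -/
  keyParty : Party
  /-- The key, respectively its estimate, computed by party `p`. -/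
  key : ∀ p, Fin (randSize p) →
    (∀ s : Fin rounds, sender initiator s ≠ p → Fin (len s) → Y (sender initiator s)) →
    Fin keySize

/-- The law of total probability along a sequence of causally generated symbols. -/
theorem sum_causal : ∀ (T : ℕ) (O : Fin T → Type*) [∀ r, Fintype (O r)]
    (K : ∀ r : Fin T, (∀ s, s < r → O s) → O r → ℝ) (_ : ∀ r o, ∑ a, K r o a = 1),
    (∑ o : ∀ r, O r, ∏ r, K r (fun s _ => o s) (o r)) = 1 := by
  intro T
  induction T with
  | zero => intro O _ K _; simp
  | succ T ih =>
    intro O _ K h1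
    rw [← (Fin.consEquiv O).sum_comp, Fintype.sum_prod_type]
    have h0 : ∀ o : ∀ s, s < (0 : Fin (T + 1)) → O s,
        o = fun s hs => absurd hs (Fin.not_lt_zero s) := by
      intro o; funext s hs; exact absurd hs (Fin.not_lt_zero s)
    rw [← h1 0 (fun s hs => absurd hs (Fin.not_lt_zero s))]
    refine Finset.sum_congr rfl fun a _ => ?_
    have := ih (fun r => O r.succ)
      (fun r o => K r.succ (fun s => Fin.cases (motive := fun s => s < r.succ → O s)
        (fun _ => a) (fun i hi => o i (Fin.succ_lt_succ_iff.mp hi)) s))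
      (fun r o => h1 _ _)
    rw [← mul_one (K 0 _ a), ← this, Finset.mul_sum]
    refine Finset.sum_congr rfl fun o _ => ?_
    rw [Fin.prod_univ_succ]
    congr 1
    · rw [h0 (fun s _ => _)]; rfl
    · refine Finset.prod_congr rfl fun r _ => ?_
      simp only [Fin.consEquiv, Equiv.coe_fn_mk, Fin.cons_succ]
      congr 1
      funext s hs
      refine Fin.cases (motive := fun s => ∀ hs : s < r.succ,
        (Fin.cons a o : ∀ i, O i) s = Fin.cases (motive := fun s => s < r.succ → O s)
        (fun _ => a) (fun i hi => o i) s hs) ?_ ?_ s hs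
      · intro _; rfl
      · intro i _; rfl

namespace Protocol

variable {X Y Z : Party → Type*}

/-- The sender in round `r`. -/
abbrev snd (𝔭 : Protocol X Y) (r : Fin 𝔭.rounds) : Party := sender 𝔭.initiator r

/-- The sample space: the private randomness of both parties, and the outputs of all uses of the
channels (one pair of outputs, for the legitimate receiver and for Eve, at each position of each
round). -/
abbrev Outcome (𝔭 : Protocol X Y) (Z : Party → Type*) : Type _ :=
  (∀ p, Fin (𝔭.randSize p)) × (∀ r, Fin (𝔭.len r) → Y (𝔭.snd r) × Z (𝔭.snd r))

/-- The channel inputs in round `r`. -/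
def input (𝔭 : Protocol X Y) (ω : 𝔭.Outcome Z) (r : Fin 𝔭.rounds) : Fin (𝔭.len r) → X (𝔭.snd r) :=
  𝔭.encode r (ω.1 (𝔭.snd r)) (fun s _ _ i => (ω.2 s i).1)

/-- The value of the key alphabet computed by party `p`. -/
def value (𝔭 : Protocol X Y) (p : Party) (ω : 𝔭.Outcome Z) : Fin 𝔭.keySize :=
  𝔭.key p (ω.1 p) (fun s _ i => (ω.2 s i).1)

/-- The key `S`. -/
def S (𝔭 : Protocol X Y) (ω : 𝔭.Outcome Z) : Fin 𝔭.keySize := 𝔭.value 𝔭.keyParty ω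

/-- The estimate of the key `S`. -/
def Sest (𝔭 : Protocol X Y) (ω : 𝔭.Outcome Z) : Fin 𝔭.keySize := 𝔭.value 𝔭.keyParty.other ω

/-- The view of Eve: all the sequences that she receives. -/
def viewE (𝔭 : Protocol X Y) (ω : 𝔭.Outcome Z) : ∀ r, Fin (𝔭.len r) → Z (𝔭.snd r) :=
  fun r i => (ω.2 r i).2

/-- The total number `n_f + n_b` of channel uses. -/
def uses (𝔭 : Protocol X Y) : ℕ := ∑ r, 𝔭.len r

variable [∀ p, Fintype (Y p)] [∀ p, Fintype (Z p)]

/-- The probability of an outcome: the probability of the private random values, times the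
transition probabilities of all the memoryless channel uses. -/
noncomputable def mass (𝔭 : Protocol X Y) (W : ∀ p, X p → stdSimplex ℝ (Y p × Z p))
    (ω : 𝔭.Outcome Z) : ℝ :=
  (∏ p, 𝔭.rand p (ω.1 p)) * ∏ r, ∏ i, W (𝔭.snd r) (𝔭.input ω r i) (ω.2 r i)

theorem mass_mem (𝔭 : Protocol X Y) (W : ∀ p, X p → stdSimplex ℝ (Y p × Z p)) :
    𝔭.mass W ∈ stdSimplex ℝ (𝔭.Outcome Z) := by
  refine ⟨fun ω => mul_nonneg (Finset.prod_nonneg fun p _ => (𝔭.rand p).2.1 _)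
    (Finset.prod_nonneg fun r _ => Finset.prod_nonneg fun i _ => (W _ _).2.1 _), ?_⟩
  rw [Fintype.sum_prod_type]
  have hin : ∀ ρ : (∀ p, Fin (𝔭.randSize p)),
      ∑ o : (∀ r, Fin (𝔭.len r) → Y (𝔭.snd r) × Z (𝔭.snd r)), 𝔭.mass W (ρ, o) =
        ∏ p, 𝔭.rand p (ρ p) := by
    intro ρ
    simp only [mass]
    rw [← Finset.mul_sum]
    have := sum_causal 𝔭.rounds (fun r => Fin (𝔭.len r) → Y (𝔭.snd r) × Z (𝔭.snd r))
      (fun r h o => ∏ i, W (𝔭.snd r)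
        (𝔭.encode r (ρ (𝔭.snd r)) (fun s hs _ i => (h s hs i).1) i) (o i))
      (fun r h => by
        rw [← Fintype.prod_sum (fun i a => W (𝔭.snd r)
          (𝔭.encode r (ρ (𝔭.snd r)) (fun s hs _ i => (h s hs i).1) i) a)]
        exact Finset.prod_eq_one fun i _ => (W _ _).2.2)
    simp only [input]
    rw [this, mul_one]
  rw [Finset.sum_congr rfl fun ρ _ => hin ρ, ← Fintype.prod_sum (fun p a => 𝔭.rand p a)]
  exact Finset.prod_eq_one fun p _ => (𝔭.rand p).2.2

/-- The joint law of the private randomness and of all the channel outputs when the protocol is run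
over the 2DMBC `W`. -/
noncomputable def law (𝔭 : Protocol X Y) (W : ∀ p, X p → stdSimplex ℝ (Y p × Z p)) :
    stdSimplex ℝ (𝔭.Outcome Z) :=
  ⟨𝔭.mass W, 𝔭.mass_mem W⟩

/-- The protocol is `(R, δ)`-secure over the 2DMBC `W`: the key has rate more than `R - δ`, it is
nearly uniform on its alphabet, it is reliable and it is secret. -/
structure IsSecure (𝔭 : Protocol X Y)
    (W : ∀ p, X p → stdSimplex ℝ (Y p × Z p)) (R δ : ℝ) : Prop where
  uses_pos : 0 < 𝔭.uses
  rate : R - δ < entropy (𝔭.law W) 𝔭.S / 𝔭.uses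
  uniform : Real.logb 2 𝔭.keySize / 𝔭.uses - δ < entropy (𝔭.law W) 𝔭.S / 𝔭.uses
  reliable : prob (𝔭.law W) (fun ω => 𝔭.Sest ω ≠ 𝔭.S ω) < δ
  secret : 1 - δ < condEntropy (𝔭.law W) 𝔭.S 𝔭.viewE / entropy (𝔭.law W) 𝔭.S

end Protocol

/-- The secret-key capacity of the 2DMBC `W`: the largest `R ≥ 0` such that for every small `δ > 0`
there is an `(R, δ)`-secure protocol. The supremum is taken in the extended real numbers, so that
it never is a junk value. -/
noncomputable def secretKeyCapacity {X Y Z : Party → Type*}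
    [∀ p, Fintype (Y p)] [∀ p, Fintype (Z p)]
    (W : ∀ p, X p → stdSimplex ℝ (Y p × Z p)) : EReal :=
  sSup {c : EReal | ∃ R : ℝ, c = R ∧ 0 ≤ R ∧
    ∀ δ : ℝ, 0 < δ → δ ≤ 1 → ∃ 𝔭 : Protocol X Y, 𝔭.IsSecure W R δ}

/-! ### The lower bound -/

/-- Random variables `V ↔ Y ↔ (X, Z)` with `(X, Y, Z)` consistent with the broadcast channel `W`. -/
structure OutputVars {𝒳 𝒴 𝒵 : Type*} [Fintype 𝒳] [Fintype 𝒴] [Fintype 𝒵]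
    (W : 𝒳 → stdSimplex ℝ (𝒴 × 𝒵)) where
  /-- The size of the alphabet of `V`. -/
  sizeV : ℕ
  /-- The joint law of `(V, X, Y, Z)`. -/
  P : stdSimplex ℝ (Fin sizeV × 𝒳 × 𝒴 × 𝒵)
  consistent : IsConsistent P (fun ω => ω.2.1) (fun ω => ω.2.2.1) (fun ω => ω.2.2.2) W
  markov : IsMarkov P (fun ω => ω.1) (fun ω => ω.2.2.1) (fun ω => (ω.2.1, ω.2.2.2))

namespace OutputVars

variable {𝒳 𝒴 𝒵 : Type*} [Fintype 𝒳] [Fintype 𝒴] [Fintype 𝒵] {W : 𝒳 → stdSimplex ℝ (𝒴 × 𝒵)}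

/-- `R_{s1} = I(V; X) - I(V; Z)`. -/
noncomputable def Rs1 (A : OutputVars W) : ℝ :=
  mutualInfo A.P (fun ω => ω.1) (fun ω => ω.2.1) -
    mutualInfo A.P (fun ω => ω.1) (fun ω => ω.2.2.2)

/-- `I(V; Y | X)`. -/
noncomputable def cost (A : OutputVars W) : ℝ :=
  condMutualInfo A.P (fun ω => ω.1) (fun ω => ω.2.2.1) (fun ω => ω.2.1)

end OutputVars

/-- Random variables `W₂ ↔ W₁ ↔ X ↔ (Y, Z)` with `(X, Y, Z)` consistent with the broadcast
channel `W`. -/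
structure InputVars {𝒳 𝒴 𝒵 : Type*} [Fintype 𝒳] [Fintype 𝒴] [Fintype 𝒵]
    (W : 𝒳 → stdSimplex ℝ (𝒴 × 𝒵)) where
  /-- The size of the alphabet of `W₂`. -/
  sizeW₂ : ℕ
  /-- The size of the alphabet of `W₁`. -/
  sizeW₁ : ℕ
  /-- The joint law of `(W₂, W₁, X, Y, Z)`. -/
  P : stdSimplex ℝ (Fin sizeW₂ × Fin sizeW₁ × 𝒳 × 𝒴 × 𝒵)
  consistent :
    IsConsistent P (fun ω => ω.2.2.1) (fun ω => ω.2.2.2.1) (fun ω => ω.2.2.2.2) W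
  /-- `W₂ ↔ W₁ ↔ X`. -/
  markov₁ : IsMarkov P (fun ω => ω.1) (fun ω => ω.2.1) (fun ω => ω.2.2.1)
  /-- `(W₂, W₁) ↔ X ↔ (Y, Z)`. -/
  markov₂ : IsMarkov P (fun ω => (ω.1, ω.2.1)) (fun ω => ω.2.2.1) (fun ω => ω.2.2.2)

namespace InputVars

variable {𝒳 𝒴 𝒵 : Type*} [Fintype 𝒳] [Fintype 𝒴] [Fintype 𝒵] {W : 𝒳 → stdSimplex ℝ (𝒴 × 𝒵)}

/-- `R_{s2} = I(W₁; Y | W₂) - I(W₁; Z | W₂)`. -/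
noncomputable def Rs2 (B : InputVars W) : ℝ :=
  condMutualInfo B.P (fun ω => ω.2.1) (fun ω => ω.2.2.2.1) (fun ω => ω.1) -
    condMutualInfo B.P (fun ω => ω.2.1) (fun ω => ω.2.2.2.2) (fun ω => ω.1)

/-- `I(W₁; Y)`. -/
noncomputable def info (B : InputVars W) : ℝ :=
  mutualInfo B.P (fun ω => ω.2.1) (fun ω => ω.2.2.2.1)

end InputVars

/-- The bound `L_A` for `p = alice` and `L_B` for `p = bob`, where `p` is the initiator: the supremum
of `(n R_{s1} + m [R_{s2}]_+) / (n + m)` over the numbers `n` of uses of the channel from `p` and `m`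
of uses of the channel to `p`, over the variables `A` on the channel from `p` and `B` on the channel
to `p`, subject to `n I(V; Y | X) < m I(W₁; Y)`. -/
noncomputable def initiatorBound {X Y Z : Party → Type*}
    [∀ p, Fintype (X p)] [∀ p, Fintype (Y p)] [∀ p, Fintype (Z p)]
    (W : ∀ p, X p → stdSimplex ℝ (Y p × Z p)) (p : Party) : EReal :=
  sSup {c : EReal | ∃ (n m : ℕ) (A : OutputVars (W p)) (B : InputVars (W p.other)),
    n * A.cost < m * B.info ∧
    c = ((n * A.Rs1 + m * max 0 B.Rs2) / ((n : ℝ) + m) : ℝ)}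

/-! ### Finite probability calculus and the distance from perfect secrecy -/

section Calculus

/-! The initiator sends an i.i.d. block X, so that his channel becomes a correlated source: he holds
X, the other party Y, Eve Z. From Y the other party simulates V, which is hashed at random into
three pieces (F, G, K). By the leftover hash lemma, F at a rate just below H(V|Y,X) is nearly
independent of Y, and (F, G, K) at a rate just below H(V|Z) is nearly uniform and independent of Z.
By random binning, (F, G) at a rate just above H(V|X) determines V for the holder of X. Being nearly
independent of Y, the index F can be frozen at a good value f known to all: V is then drawn given Y
and F = f. What remains is a message G of rate H(V|X) - H(V|Y,X) = I(V;Y|X) and a key K of rate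
H(V|Z) - H(V|X) = I(V;X) - I(V;Z).

The message G goes back through the other channel. The wiretap code used there comes from the same
hashing run in reverse. The cloud center U = W₂ and the satellite V = W₁ are hashed into a message
and an index that are jointly nearly uniform; the index is frozen, and the codeword is drawn from
the conditional law given the message. The total rate is I(W₂;Y) + I(W₁;Y|W₂), which is at least
I(W₁;Y), and a part of rate [R_{s2}]_+ stays secret. The constraint n I(V;Y|X) < m I(W₁;Y) is what
lets G fit into the message, whose remaining bits are uniform padding. The key of the protocol is K
together with the secret part of the message.

The two codes compose because (G, K) is close in L¹ to uniform and independent of Z. Up to that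
error the channel code runs on a uniform message independent of (K, Z), so the secrecy and error
bounds of both rounds add up. Secrecy is measured by `secDist` throughout and is turned into
entropies only at the end.

The proof rests on `leftover_hash`, `exists_binning_decoder` and `exists_fixed_index`. These give
the two codes `exists_source_code` and `exists_channel_code`, which `secDist_composedLaw` and
`exists_twoRound_of_codes` assemble into a protocol; `le_condEntropy` and `twoRound_isSecure` then
check its security. Rate zero needs its own protocol, since the secrecy condition divides by H(S):
there a biased coin serves as the key. -/

open scoped Classical in
theorem sum_distr_mul {Ω α : Type*} [Fintype Ω] [Fintype α] (P : Ω → ℝ) (U : Ω → α) (h : α → ℝ) :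
    ∑ a, distr P U a * h a = ∑ ω, P ω * h (U ω) := by
  simp only [distr, prob, Finset.sum_mul]
  rw [Finset.sum_comm]
  refine Finset.sum_congr rfl fun ω _ => ?_
  simp [ite_mul]

open scoped Classical in
theorem prob_eq_sum {Ω : Type*} [Fintype Ω] (P : Ω → ℝ) (E : Ω → Prop) :
    prob P E = ∑ ω, P ω * (if E ω then 1 else 0) := by
  simp [prob]

theorem sum_distr {Ω α : Type*} [Fintype Ω] [Fintype α] (P : Ω → ℝ) (U : Ω → α) :
    ∑ a, distr P U a = ∑ ω, P ω := by
  simpa using sum_distr_mul P U (fun _ => 1)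

theorem prob_distr {Ω α : Type*} [Fintype Ω] [Fintype α] (P : Ω → ℝ) (U : Ω → α) (E : α → Prop) :
    prob (distr P U) E = prob P (fun ω => E (U ω)) := by
  classical
  rw [prob_eq_sum, prob_eq_sum, sum_distr_mul]

theorem distr_distr {Ω α β : Type*} [Fintype Ω] [Fintype α] (P : Ω → ℝ) (U : Ω → α) (f : α → β) :
    distr (distr P U) f = distr P (fun ω => f (U ω)) := by
  funext b; exact prob_distr P U _

theorem distr_congr {Ω α β : Type*} [Fintype Ω] (P : Ω → ℝ) {U : Ω → α} {V : Ω → β} {a : α} {b : β}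
    (h : ∀ ω, U ω = a ↔ V ω = b) : distr P U a = distr P V b := by
  unfold distr
  congr 1
  funext ω
  exact propext (h ω)

theorem prob_nonneg {Ω : Type*} [Fintype Ω] {P : Ω → ℝ} (hP : ∀ ω, 0 ≤ P ω) (E : Ω → Prop) :
    0 ≤ prob P E := by
  refine Finset.sum_nonneg fun ω _ => ?_
  split_ifs <;> simp [hP]

theorem distr_nonneg {Ω α : Type*} [Fintype Ω] {P : Ω → ℝ} (hP : ∀ ω, 0 ≤ P ω) (U : Ω → α) (a : α) :
    0 ≤ distr P U a := prob_nonneg hP _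

theorem prob_mono {Ω : Type*} [Fintype Ω] {P : Ω → ℝ} (hP : ∀ ω, 0 ≤ P ω) {E F : Ω → Prop}
    (h : ∀ ω, P ω ≠ 0 → E ω → F ω) : prob P E ≤ prob P F := by
  refine Finset.sum_le_sum fun ω _ => ?_
  by_cases h0 : P ω = 0
  · simp [h0]
  have := h ω h0
  split_ifs <;> simp_all

theorem prob_or_le {Ω : Type*} [Fintype Ω] {P : Ω → ℝ} (hP : ∀ ω, 0 ≤ P ω) (E F : Ω → Prop) :
    prob P (fun ω => E ω ∨ F ω) ≤ prob P E + prob P F := by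
  classical
  simp only [prob]
  rw [← Finset.sum_add_distrib]
  refine Finset.sum_le_sum fun ω _ => ?_
  have := hP ω
  by_cases h1 : E ω <;> by_cases h2 : F ω <;> simp [h1, h2, this]

theorem distr_mem {Ω α : Type*} [Fintype Ω] [Fintype α] {P : Ω → ℝ} (hP : P ∈ stdSimplex ℝ Ω)
    (U : Ω → α) : distr P U ∈ stdSimplex ℝ α :=
  ⟨fun a => distr_nonneg hP.1 U a, (sum_distr P U).trans hP.2⟩

theorem sum_distr_fst {Ω α β : Type*} [Fintype Ω] [Fintype α] (P : Ω → ℝ) (U : Ω → α)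
    (V : Ω → β) (b : β) : ∑ a, distr P (fun ω => (U ω, V ω)) (a, b) = distr P V b := by
  classical
  simp only [distr, prob]
  rw [Finset.sum_comm]
  refine Finset.sum_congr rfl fun ω _ => ?_
  by_cases h : V ω = b <;> simp [h]

theorem sum_distr_snd {Ω α β : Type*} [Fintype Ω] [Fintype β] (P : Ω → ℝ) (U : Ω → α)
    (V : Ω → β) (a : α) : ∑ b, distr P (fun ω => (U ω, V ω)) (a, b) = distr P U a := by
  rw [← sum_distr_fst P V U a]
  exact Finset.sum_congr rfl fun b _ => distr_congr P (by simp [and_comm])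

theorem distr_pair_le_right {Ω α β : Type*} [Fintype Ω] [Fintype α] {P : Ω → ℝ}
    (hP : ∀ ω, 0 ≤ P ω) (U : Ω → α) (V : Ω → β) (a : α) (b : β) :
    distr P (fun ω => (U ω, V ω)) (a, b) ≤ distr P V b := by
  rw [← sum_distr_fst P U V b]
  exact Finset.single_le_sum (f := fun a => distr P (fun ω => (U ω, V ω)) (a, b))
    (fun _ _ => distr_nonneg hP _ _) (Finset.mem_univ a)

theorem distr_pair_le_left {Ω α β : Type*} [Fintype Ω] [Fintype β] {P : Ω → ℝ}
    (hP : ∀ ω, 0 ≤ P ω) (U : Ω → α) (V : Ω → β) (a : α) (b : β) :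
    distr P (fun ω => (U ω, V ω)) (a, b) ≤ distr P U a := by
  rw [← sum_distr_snd P U V a]
  exact Finset.single_le_sum (f := fun b => distr P (fun ω => (U ω, V ω)) (a, b))
    (fun _ _ => distr_nonneg hP _ _) (Finset.mem_univ b)

theorem le_distr {Ω α : Type*} [Fintype Ω] {P : Ω → ℝ} (hP : ∀ ω, 0 ≤ P ω) (U : Ω → α) (ω : Ω) :
    P ω ≤ distr P U (U ω) := by
  classical
  have := Finset.single_le_sum (f := fun ω' => if U ω' = U ω then P ω' else 0)
    (fun ω' _ => by split_ifs <;> simp [hP]) (Finset.mem_univ ω)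
  simpa [distr, prob] using this

open scoped Classical in
theorem distr_comp {Ω α β : Type*} [Fintype Ω] [Fintype α] (P : Ω → ℝ) (U : Ω → α) (f : α → β)
    (b : β) : distr P (fun ω => f (U ω)) b = ∑ a, if f a = b then distr P U a else 0 := by
  rw [← distr_distr]; rfl

theorem distr_sub {Ω α : Type*} [Fintype Ω] (P Q : Ω → ℝ) (U : Ω → α) (a : α) :
    distr (fun ω => P ω - Q ω) U a = distr P U a - distr Q U a := by
  classical
  simp only [distr, prob]
  rw [← Finset.sum_sub_distrib]
  exact Finset.sum_congr rfl fun ω _ => by split_ifs <;> simp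

theorem prob_mul {Ω : Type*} [Fintype Ω] (c : ℝ) (P : Ω → ℝ) (E : Ω → Prop) :
    prob (fun ω => c * P ω) E = c * prob P E := by
  simp only [prob, Finset.mul_sum, mul_ite, mul_zero]

theorem sum_abs_distr_le {Ω α : Type*} [Fintype Ω] [Fintype α] (P : Ω → ℝ) (U : Ω → α) :
    ∑ a, |distr P U a| ≤ ∑ ω, |P ω| := by
  classical
  rw [← sum_distr (fun ω => |P ω|) U]
  refine Finset.sum_le_sum fun a _ => ?_
  simp only [distr, prob]
  refine (Finset.abs_sum_le_sum_abs _ _).trans (Finset.sum_le_sum fun ω _ => ?_)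
  split_ifs <;> simp

theorem prob_le_add {Ω : Type*} [Fintype Ω] (P Q : Ω → ℝ) (E : Ω → Prop) :
    prob P E ≤ prob Q E + ∑ ω, |P ω - Q ω| := by
  classical
  simp only [prob]
  rw [← Finset.sum_add_distrib]
  refine Finset.sum_le_sum fun ω _ => ?_
  split_ifs
  · linarith [le_abs_self (P ω - Q ω)]
  · simp

/-- The `L¹` distance between the joint law of `(U, E)` and the product of the uniform law on the
alphabet of `U` with the law of `E`. -/
noncomputable def secDist {Ω υ ε : Type*} [Fintype Ω] [Fintype υ] [Fintype ε]
    (P : Ω → ℝ) (U : Ω → υ) (E : Ω → ε) : ℝ :=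
  ∑ e, ∑ u, |distr P (fun ω => (U ω, E ω)) (u, e) - distr P E e / Fintype.card υ|

variable {Ω Λ υ υ' ε ε' φ : Type*} [Fintype Ω] [Fintype Λ] [Fintype υ] [Fintype υ'] [Fintype ε]
  [Fintype ε'] [Fintype φ]

theorem secDist_nonneg (P : Ω → ℝ) (U : Ω → υ) (E : Ω → ε) : 0 ≤ secDist P U E :=
  Finset.sum_nonneg fun _ _ => Finset.sum_nonneg fun _ _ => abs_nonneg _

theorem secDist_distr (P : Ω → ℝ) (T : Ω → Λ) (U : Λ → υ) (E : Λ → ε) :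
    secDist (distr P T) U E = secDist P (fun ω => U (T ω)) (fun ω => E (T ω)) := by
  simp only [secDist, distr_distr]

/-- Data processing for Eve: the triangle inequality on each fibre of `f`. -/
theorem secDist_comp_le (P : Ω → ℝ) (U : Ω → υ) (E : Ω → ε) (f : ε → ε') :
    secDist P U (fun ω => f (E ω)) ≤ secDist P U E := by
  classical
  have h1 : ∀ e' u, |distr P (fun ω => (U ω, f (E ω))) (u, e')
      - distr P (fun ω => f (E ω)) e' / Fintype.card υ| ≤
      ∑ e, if f e = e' then |distr P (fun ω => (U ω, E ω)) (u, e)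
        - distr P E e / Fintype.card υ| else 0 := by
    intro e' u
    have h2 : distr P (fun ω => (U ω, f (E ω))) (u, e') =
        ∑ e, if f e = e' then distr P (fun ω => (U ω, E ω)) (u, e) else 0 := by
      rw [distr_comp P (fun ω => (U ω, E ω)) (fun x => (x.1, f x.2)), Fintype.sum_prod_type]
      rw [Finset.sum_eq_single u]
      · refine Finset.sum_congr rfl fun e _ => by simp
      · intro v _ hv; simp [hv]
      · simp
    rw [h2, distr_comp P E f, Finset.sum_div, ← Finset.sum_sub_distrib]
    refine (Finset.abs_sum_le_sum_abs _ _).trans (Finset.sum_le_sum fun e _ => ?_)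
    split_ifs <;> simp
  refine (Finset.sum_le_sum fun e' _ => Finset.sum_le_sum fun u _ => h1 e' u).trans (le_of_eq ?_)
  simp only [secDist]
  rw [Finset.sum_congr rfl fun e' _ => Finset.sum_comm]
  rw [Finset.sum_comm]
  refine Finset.sum_congr rfl fun e _ => ?_
  rw [Finset.sum_comm]
  simp

theorem secDist_of_card_eq_one (P : Ω → ℝ) (U : Ω → υ) (E : Ω → ε) (h : Fintype.card υ = 1) :
    secDist P U E = 0 := by
  obtain ⟨u₀, hu⟩ := Fintype.card_eq_one_iff.mp h
  refine Finset.sum_eq_zero fun e _ => Finset.sum_eq_zero fun u _ => ?_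
  rw [h, Nat.cast_one, div_one, abs_eq_zero, sub_eq_zero]
  exact distr_congr P fun ω => by simp [hu (U ω), hu u]

theorem sum_abs_mul_card [Nonempty υ] (x : ℝ) :
    ∑ _u : υ, |x / Fintype.card υ| = |x| := by
  have : (Fintype.card υ : ℝ) ≠ 0 := by exact_mod_cast Fintype.card_ne_zero
  rw [Finset.sum_const, Finset.card_univ, nsmul_eq_mul, abs_div, Nat.abs_cast]
  field_simp

/-- Triangle inequality through the law in which `U` is uniform and independent of `(V, E)`. -/
theorem secDist_pair_le (P : Ω → ℝ) (U : Ω → υ) (V : Ω → υ') (E : Ω → ε) :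
    secDist P (fun ω => (U ω, V ω)) E ≤
      secDist P U (fun ω => (V ω, E ω)) + secDist P V E := by
  cases isEmpty_or_nonempty υ with
  | inl h =>
    have : secDist P (fun ω => (U ω, V ω)) E = 0 := by simp [secDist]
    rw [this]; exact add_nonneg (secDist_nonneg _ _ _) (secDist_nonneg _ _ _)
  | inr h =>
  have key : ∀ e u v, |distr P (fun ω => ((U ω, V ω), E ω)) ((u, v), e)
      - distr P E e / Fintype.card (υ × υ')| ≤
      |distr P (fun ω => (U ω, V ω, E ω)) (u, v, e)
        - distr P (fun ω => (V ω, E ω)) (v, e) / Fintype.card υ| +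
      |(distr P (fun ω => (V ω, E ω)) (v, e) - distr P E e / Fintype.card υ') /
        Fintype.card υ| := by
    intro e u v
    refine le_trans (le_of_eq ?_) (abs_add_le _ _)
    rw [distr_congr P (V := fun ω => (U ω, V ω, E ω)) (b := (u, v, e)) (by simp [and_assoc])]
    congr 1
    rw [Fintype.card_prod]; push_cast
    rw [sub_div, div_div, mul_comm (Fintype.card υ' : ℝ)]
    ring
  simp only [secDist]
  simp only [Fintype.sum_prod_type]
  refine (Finset.sum_le_sum fun e _ => Finset.sum_le_sum fun u _ => Finset.sum_le_sum fun v _ =>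
    key e u v).trans (le_of_eq ?_)
  simp only [Finset.sum_add_distrib]
  congr 1
  · symm
    rw [Finset.sum_comm]
    exact Finset.sum_congr rfl fun e _ => Finset.sum_comm
  · refine Finset.sum_congr rfl fun e _ => ?_
    rw [Finset.sum_comm]
    exact Finset.sum_congr rfl fun v _ => sum_abs_mul_card _

theorem secDist_le_pair_right (P : Ω → ℝ) (U : Ω → υ) (V : Ω → υ') (E : Ω → ε) [Nonempty υ] :
    secDist P V E ≤ secDist P (fun ω => (U ω, V ω)) E := by
  refine Finset.sum_le_sum fun e _ => ?_
  rw [Fintype.sum_prod_type, Finset.sum_comm]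
  refine Finset.sum_le_sum fun v _ => ?_
  refine le_trans (le_of_eq ?_) (Finset.abs_sum_le_sum_abs _ _)
  rw [Finset.sum_sub_distrib]
  congr 1
  have : (Fintype.card υ : ℝ) ≠ 0 := by exact_mod_cast Fintype.card_ne_zero
  congr 1
  · rw [← sum_distr_fst P U (fun ω => (V ω, E ω)) (v, e)]
    exact Finset.sum_congr rfl fun u _ => distr_congr P (by simp [and_assoc])
  · rw [Finset.sum_const, Finset.card_univ, nsmul_eq_mul, Fintype.card_prod]; push_cast
    field_simp

theorem secDist_equiv (P : Ω → ℝ) (U : Ω → υ) (E : Ω → ε) (g : υ ≃ υ') :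
    secDist P (fun ω => g (U ω)) E = secDist P U E := by
  refine Finset.sum_congr rfl fun e _ => ?_
  rw [← g.sum_comp]
  refine Finset.sum_congr rfl fun u _ => ?_
  rw [Fintype.card_congr g]
  congr 2
  exact distr_congr P (by simp)

theorem secDist_le_pair_left (P : Ω → ℝ) (U : Ω → υ) (V : Ω → υ') (E : Ω → ε) [Nonempty υ'] :
    secDist P U E ≤ secDist P (fun ω => (U ω, V ω)) E := by
  rw [← secDist_equiv P (fun ω => (U ω, V ω)) E (Equiv.prodComm υ υ')]
  exact secDist_le_pair_right P V U E

/-- A piece of a nearly uniform variable may be published without spoiling the rest. The factor 2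
pays for two comparisons: the pair with its ideal law, and the published piece alone with the
uniform law. -/
theorem secDist_chain (P : Ω → ℝ) (U : Ω → υ) (F : Ω → φ) (E : Ω → ε) :
    secDist P U (fun ω => (F ω, E ω)) ≤ 2 * secDist P (fun ω => (F ω, U ω)) E := by
  cases isEmpty_or_nonempty υ with
  | inl h =>
    have : secDist P U (fun ω => (F ω, E ω)) = 0 := by simp [secDist]
    rw [this]; exact mul_nonneg (by norm_num) (secDist_nonneg _ _ _)
  | inr h =>
  have key : ∀ e f u, |distr P (fun ω => (U ω, F ω, E ω)) (u, f, e)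
      - distr P (fun ω => (F ω, E ω)) (f, e) / Fintype.card υ| ≤
      |distr P (fun ω => ((F ω, U ω), E ω)) ((f, u), e) - distr P E e / Fintype.card (φ × υ)| +
      |(distr P (fun ω => (F ω, E ω)) (f, e) - distr P E e / Fintype.card φ) /
        Fintype.card υ| := by
    intro e f u
    refine le_trans (le_of_eq ?_) (abs_sub _ _)
    rw [distr_congr P (U := fun ω => (U ω, F ω, E ω)) (V := fun ω => ((F ω, U ω), E ω))
      (a := (u, f, e)) (b := ((f, u), e)) (by simp; tauto)]
    congr 1
    rw [Fintype.card_prod]; push_cast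
    rw [sub_div, div_div]
    ring
  have h1 : secDist P U (fun ω => (F ω, E ω)) ≤ secDist P (fun ω => (F ω, U ω)) E +
      secDist P F E := by
    simp only [secDist]
    rw [Fintype.sum_prod_type, Finset.sum_comm]
    refine (Finset.sum_le_sum fun e _ => Finset.sum_le_sum fun f _ => Finset.sum_le_sum fun u _ =>
      key e f u).trans (le_of_eq ?_)
    simp only [Finset.sum_add_distrib, Fintype.sum_prod_type]
    congr 1
    exact Finset.sum_congr rfl fun e _ => Finset.sum_congr rfl fun v _ => sum_abs_mul_card _
  linarith [secDist_le_pair_left P F U E]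

/-- The change of law is felt twice, in the joint law of `(U, E)` and in the marginal of `E`.
Neither weight has to be normalised, so the bound also applies to the restriction of a law to an
event. -/
theorem secDist_le_add (P Q : Ω → ℝ) (U : Ω → υ) (E : Ω → ε) :
    secDist P U E ≤ secDist Q U E + 2 * ∑ ω, |P ω - Q ω| := by
  cases isEmpty_or_nonempty υ with
  | inl h =>
    have : secDist P U E = 0 := by simp [secDist]
    rw [this]; exact add_nonneg (secDist_nonneg _ _ _)
      (mul_nonneg (by norm_num) (Finset.sum_nonneg fun _ _ => abs_nonneg _))
  | inr h =>
  have key : ∀ e u, |distr P (fun ω => (U ω, E ω)) (u, e) - distr P E e / Fintype.card υ| ≤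
      |distr Q (fun ω => (U ω, E ω)) (u, e) - distr Q E e / Fintype.card υ| +
      (|distr (fun ω => P ω - Q ω) (fun ω => (U ω, E ω)) (u, e)| +
      |distr (fun ω => P ω - Q ω) E e / Fintype.card υ|) := by
    intro e u
    rw [distr_sub, distr_sub]
    refine le_trans (le_of_eq ?_) ((abs_add_le _ _).trans (add_le_add_right (abs_sub _ _) _))
    congr 1; ring
  refine (Finset.sum_le_sum fun e _ => Finset.sum_le_sum fun u _ => key e u).trans ?_
  simp only [Finset.sum_add_distrib]
  rw [two_mul]
  refine add_le_add le_rfl (add_le_add ?_ ?_)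
  · rw [Finset.sum_comm, ← Fintype.sum_prod_type']
    exact sum_abs_distr_le _ _
  · refine le_trans (le_of_eq ?_) (sum_abs_distr_le _ E)
    exact Finset.sum_congr rfl fun e _ => sum_abs_mul_card _

theorem secDist_mul {c : ℝ} (hc : 0 ≤ c) (P : Ω → ℝ) (U : Ω → υ) (E : Ω → ε) :
    secDist (fun ω => c * P ω) U E = c * secDist P U E := by
  simp only [secDist, distr, prob_mul, Finset.mul_sum]
  refine Finset.sum_congr rfl fun e _ => Finset.sum_congr rfl fun u _ => ?_
  rw [mul_div_assoc, ← mul_sub, abs_mul, abs_of_nonneg hc]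

-- Publishing `F` amounts to splitting the law into its unnormalised restrictions to the values of
-- `F`. This is what allows averaging over a random index in `exists_fixed_index`.
open scoped Classical in
theorem sum_secDist_restrict (P : Ω → ℝ) (U : Ω → υ) (F : Ω → φ) (E : Ω → ε) :
    ∑ f, secDist (fun ω => if F ω = f then P ω else 0) U E =
      secDist P U (fun ω => (F ω, E ω)) := by
  simp only [secDist, Fintype.sum_prod_type]
  refine Finset.sum_congr rfl fun f _ => Finset.sum_congr rfl fun e _ =>
    Finset.sum_congr rfl fun u _ => ?_
  congr 2
  · simp only [distr, prob]
    refine Finset.sum_congr rfl fun ω _ => ?_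
    by_cases h1 : F ω = f <;> by_cases h2 : U ω = u <;> by_cases h3 : E ω = e <;> simp [h1, h2, h3]
  · congr 1
    simp only [distr, prob]
    refine Finset.sum_congr rfl fun ω _ => ?_
    by_cases h1 : F ω = f <;> by_cases h3 : E ω = e <;> simp [h1, h3]

/-- Regular conditional probabilities on finite sets. -/
theorem exists_condKernel {α β : Type*} [Fintype β] [Nonempty β] (p : α → β → ℝ)
    (hp : ∀ a b, 0 ≤ p a b) :
    ∃ k : α → β → ℝ, (∀ a, k a ∈ stdSimplex ℝ β) ∧ ∀ a b, (∑ b', p a b') * k a b = p a b := by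
  classical
  obtain ⟨b₀⟩ := ‹Nonempty β›
  -- A row of total mass zero receives a point mass, so that every row is a probability.
  refine ⟨fun a b => if ∑ b', p a b' = 0 then (if b = b₀ then 1 else 0) else
    p a b / ∑ b', p a b', fun a => ⟨fun b => ?_, ?_⟩, fun a b => ?_⟩
  · dsimp only
    split_ifs
    · exact zero_le_one
    · exact le_rfl
    · exact div_nonneg (hp _ _) (Finset.sum_nonneg fun _ _ => hp _ _)
  · dsimp only
    split_ifs with h
    · simp
    · rw [← Finset.sum_div, div_self h]
  · dsimp only
    split_ifs with h h'
    · rw [h, zero_mul, (Finset.sum_eq_zero_iff_of_nonneg fun b _ => hp a b).mp h b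
        (Finset.mem_univ b)]
    · rw [h, zero_mul, (Finset.sum_eq_zero_iff_of_nonneg fun b _ => hp a b).mp h b
        (Finset.mem_univ b)]
    · rw [mul_div_cancel₀ _ h]

/-- The probabilistic method: bounds on averages over hash functions or indices become bounds for
one of them. Several requirements are met at once by adding them before averaging. -/
theorem exists_le_of_weighted_sum_le {α : Type*} [Fintype α] {w : α → ℝ} (hw : w ∈ stdSimplex ℝ α)
    {g : α → ℝ} {c : ℝ} (h : ∑ a, w a * g a ≤ c) : ∃ a, g a ≤ c := by
  by_contra! hn
  have h1 : ∑ a, w a * (g a - c) ≤ 0 := by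
    simp only [mul_sub, Finset.sum_sub_distrib, ← Finset.sum_mul, hw.2]; linarith
  have h2 : ∀ a ∈ Finset.univ, 0 ≤ w a * (g a - c) := fun a _ =>
    mul_nonneg (hw.1 a) (by linarith [hn a])
  have h3 := (Finset.sum_eq_zero_iff_of_nonneg h2).mp (le_antisymm h1 (Finset.sum_nonneg h2))
  have h4 : ∑ a, w a = 0 := Finset.sum_eq_zero fun a ha => by
    rcases mul_eq_zero.mp (h3 a ha) with h | h
    · exact h
    · linarith [hn a]
  linarith [hw.2]

/-- A random index `F`, computed from `V`, which is nearly independent of `I`, can be fixed: there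
is a value `f` such that replacing `V` by a variable generated from `I` according to the
conditional law of `V` given `I` and `F = f` nearly preserves the reliability and the secrecy. -/
theorem exists_fixed_index {ι ν ρ : Type*} [Fintype ι] [Fintype ν] [Fintype ρ]
    (p : ι × ν × ρ → ℝ) (hp : p ∈ stdSimplex ℝ (ι × ν × ρ)) (F : ν → φ)
    (Q : ι → ℝ) (hQ : Q ∈ stdSimplex ℝ ι) (c : ι → ν → ρ → ℝ) (hc : ∀ i v, c i v ∈ stdSimplex ℝ ρ)
    (hfac : ∀ i v r, p (i, v, r) = distr p (fun ω => (ω.1, ω.2.1)) (i, v) * c i v r)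
    (err : φ → ι × ν × ρ → Prop) (U : ι × ν × ρ → υ) (E : ι × ν × ρ → ε) {α β γ : ℝ}
    (hD : ∑ f, ∑ i, |distr p (fun ω => F ω.2.1) f * Q i -
      distr p (fun ω => (F ω.2.1, ω.1)) (f, i)| ≤ γ)
    (herr : prob p (fun ω => err (F ω.2.1) ω) ≤ α)
    (hsec : secDist p U (fun ω => (F ω.2.1, E ω)) ≤ β) :
    ∃ (f : φ) (κ : ι → ν → ℝ), (∀ i, κ i ∈ stdSimplex ℝ ν) ∧
      prob (fun ω => Q ω.1 * κ ω.1 ω.2.1 * c ω.1 ω.2.1 ω.2.2) (err f) ≤ α + β + 3 * γ ∧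
      secDist (fun ω => Q ω.1 * κ ω.1 ω.2.1 * c ω.1 ω.2.1 ω.2.2) U E ≤ α + β + 3 * γ := by
  classical
  have hne : Nonempty ν := by
    by_contra hn
    rw [not_nonempty_iff] at hn
    have := hp.2
    simp at this
  set J := distr p (fun ω => (ω.1, ω.2.1)) with hJ
  have hJ0 : ∀ i v, 0 ≤ J (i, v) := fun i v => distr_nonneg hp.1 _ _
  -- The conditional law of `V` given `F = f` and `I = i`; the kernel sought is its section at the
  -- value of `f` to be chosen.
  obtain ⟨k, hk1, hk2⟩ := exists_condKernel (fun (x : φ × ι) v => if F v = x.1 then J (x.2, v) else 0)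
    (fun x v => by split_ifs <;> simp [hJ0])
  have hJf : ∀ f i, distr p (fun ω => (F ω.2.1, ω.1)) (f, i) =
      ∑ v, if F v = f then J (i, v) else 0 := by
    intro f i
    rw [distr_comp p (fun ω => (ω.1, ω.2.1)) (fun x => (F x.2, x.1)), Fintype.sum_prod_type,
      Finset.sum_eq_single i]
    · refine Finset.sum_congr rfl fun v _ => by simp [hJ]
    · intro j _ hj; simp [hj]
    · simp
  set pF := distr p (fun ω => F ω.2.1) with hpF
  have hpFm : pF ∈ stdSimplex ℝ φ := distr_mem hp _
  set t : φ → ι × ν × ρ → ℝ := fun f ω => Q ω.1 * k (f, ω.1) ω.2.1 * c ω.1 ω.2.1 ω.2.2 with ht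
  have ht0 : ∀ f ω, 0 ≤ t f ω := fun f ω =>
    mul_nonneg (mul_nonneg (hQ.1 _) ((hk1 _).1 _)) ((hc _ _).1 _)
  set pf : φ → ι × ν × ρ → ℝ := fun f ω => if F ω.2.1 = f then p ω else 0 with hpf
  -- Both weights carry the same kernels `k` and `c`, which sum out. Only the joint law of `(F, I)`
  -- against the product remains, and that is `hD`.
  have hL1 : ∑ f, ∑ ω, |pF f * t f ω - pf f ω| ≤ γ := by
    refine le_trans (le_of_eq ?_) hD
    refine Finset.sum_congr rfl fun f _ => ?_
    rw [Fintype.sum_prod_type]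
    refine Finset.sum_congr rfl fun i _ => ?_
    have h1 : ∀ v r, |pF f * t f (i, v, r) - pf f (i, v, r)| =
        |pF f * Q i - distr p (fun ω => (F ω.2.1, ω.1)) (f, i)| * k (f, i) v * c i v r := by
      intro v r
      have h2 : pf f (i, v, r) = distr p (fun ω => (F ω.2.1, ω.1)) (f, i) * k (f, i) v * c i v r := by
        rw [hJf, hk2 (f, i) v]
        simp only [hpf]
        rw [hfac, ite_mul, zero_mul]
      rw [h2]
      have : pF f * t f (i, v, r) - distr p (fun ω => (F ω.2.1, ω.1)) (f, i) * k (f, i) v * c i v r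
        = (pF f * Q i - distr p (fun ω => (F ω.2.1, ω.1)) (f, i)) * k (f, i) v * c i v r := by
        simp only [ht]; ring
      rw [this, abs_mul, abs_mul, abs_of_nonneg ((hc i v).1 r), abs_of_nonneg ((hk1 (f, i)).1 v)]
    rw [Fintype.sum_prod_type]
    simp only [h1, ← Finset.mul_sum, (hc _ _).2, (hk1 _).2, mul_one]
  -- Error and secrecy are added so that one `f` serves both. In `3 * γ`, the change of law costs
  -- `γ` for the probability and `2 * γ` for `secDist`.
  have htot : ∑ f, pF f * (prob (t f) (err f) + secDist (t f) U E) ≤ α + β + 3 * γ := by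
    have h1 : ∀ f, pF f * (prob (t f) (err f) + secDist (t f) U E) ≤
        prob (pf f) (err f) + secDist (pf f) U E + 3 * ∑ ω, |pF f * t f ω - pf f ω| := by
      intro f
      rw [mul_add, ← prob_mul, ← secDist_mul (hpFm.1 f)]
      have := prob_le_add (fun ω => pF f * t f ω) (pf f) (err f)
      have := secDist_le_add (fun ω => pF f * t f ω) (pf f) U E
      linarith
    refine (Finset.sum_le_sum fun f _ => h1 f).trans ?_
    rw [Finset.sum_add_distrib, Finset.sum_add_distrib, ← Finset.mul_sum]
    have h2 : ∑ f, prob (pf f) (err f) = prob p (fun ω => err (F ω.2.1) ω) := by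
      simp only [prob]
      rw [Finset.sum_comm]
      refine Finset.sum_congr rfl fun ω _ => ?_
      rw [Finset.sum_eq_single (F ω.2.1)]
      · simp [hpf]
      · intro f _ hf; simp [hpf, hf.symm]
      · simp
    have h3 : ∑ f, secDist (pf f) U E = secDist p U (fun ω => (F ω.2.1, E ω)) :=
      sum_secDist_restrict p U (fun ω => F ω.2.1) E
    rw [h2, h3]
    linarith
  obtain ⟨f, hf⟩ := exists_le_of_weighted_sum_le hpFm htot
  refine ⟨f, fun i => k (f, i), fun i => hk1 _, ?_, ?_⟩
  · exact le_trans (le_add_of_nonneg_right (secDist_nonneg _ _ _)) hf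
  · exact le_trans (le_add_of_nonneg_left (prob_nonneg (ht0 f) _)) hf

end Calculus

/-! ### Entropy inequalities, and entropy from near uniformity -/

section EntropyLemmas

variable {Ω α β γ : Type*} [Fintype Ω] [Fintype α] [Fintype β] [Fintype γ]

theorem entropy_eq_sum (P : Ω → ℝ) (U : Ω → α) :
    entropy P U = ∑ ω, P ω * (-Real.logb 2 (distr P U (U ω))) := by
  rw [← sum_distr_mul P U (fun a => -Real.logb 2 (distr P U a))]
  refine Finset.sum_congr rfl fun a _ => ?_
  rw [Real.negMulLog, Real.logb]; ring

theorem entropy_mul_log (P : Ω → ℝ) (U : Ω → α) :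
    entropy P U * Real.log 2 = ∑ ω, P ω * (-Real.log (distr P U (U ω))) := by
  have h2 : Real.log 2 ≠ 0 := (Real.log_pos one_lt_two).ne'
  rw [entropy_eq_sum, Finset.sum_mul]
  refine Finset.sum_congr rfl fun a _ => ?_
  rw [Real.logb]; field_simp

theorem entropy_comp_equiv (P : Ω → ℝ) (U : Ω → α) (e : α ≃ β) :
    entropy P (fun ω => e (U ω)) = entropy P U := by
  rw [entropy, ← e.sum_comp]
  refine Finset.sum_congr rfl fun a _ => ?_
  rw [distr_congr P (V := U) (b := a) (by simp)]

theorem condEntropy_comp_equiv (P : Ω → ℝ) (U : Ω → α) (V : Ω → β) (e : β ≃ γ) :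
    condEntropy P U (fun ω => e (V ω)) = condEntropy P U V := by
  have := entropy_comp_equiv P (fun ω => (U ω, V ω)) ((Equiv.refl α).prodCongr e)
  simp only [Equiv.prodCongr_apply, Prod.map, Equiv.refl_apply] at this
  rw [condEntropy, entropy_comp_equiv P V e, this, condEntropy]

/-- By log x ≤ x - 1 applied to x = p(v,t) p(u,t) / (p(t) p(u,v,t)), whose expectation is at most 1.
-/
theorem condEntropy_pair_le {P : Ω → ℝ} (hP : P ∈ stdSimplex ℝ Ω) (U : Ω → α) (V : Ω → β)
    (T : Ω → γ) : condEntropy P U (fun ω => (V ω, T ω)) ≤ condEntropy P U T := by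
  have h2 : 0 < Real.log 2 := Real.log_pos one_lt_two
  rw [← sub_nonpos]
  refine nonpos_of_mul_nonpos_left ?_ h2
  simp only [condEntropy, sub_mul, entropy_mul_log]
  rw [← Finset.sum_sub_distrib, ← Finset.sum_sub_distrib, ← Finset.sum_sub_distrib]
  have key : ∀ ω, P ω * (-Real.log (distr P (fun ω => (U ω, V ω, T ω)) (U ω, V ω, T ω))) -
      P ω * (-Real.log (distr P (fun ω => (V ω, T ω)) (V ω, T ω))) -
      (P ω * (-Real.log (distr P (fun ω => (U ω, T ω)) (U ω, T ω))) -
        P ω * (-Real.log (distr P T (T ω)))) ≤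
      P ω * ((distr P (fun ω => (V ω, T ω)) (V ω, T ω) * distr P (fun ω => (U ω, T ω)) (U ω, T ω)) /
        (distr P T (T ω) * distr P (fun ω => (U ω, V ω, T ω)) (U ω, V ω, T ω))) - P ω := by
    intro ω
    rcases (hP.1 ω).eq_or_lt with h0 | h0
    · simp [← h0]
    have p1 := h0.trans_le (le_distr hP.1 (fun ω => (V ω, T ω)) ω)
    have p2 := h0.trans_le (le_distr hP.1 (fun ω => (U ω, T ω)) ω)
    have p3 := h0.trans_le (le_distr hP.1 T ω)
    have p4 := h0.trans_le (le_distr hP.1 (fun ω => (U ω, V ω, T ω)) ω)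
    have := Real.log_le_sub_one_of_pos (div_pos (mul_pos p1 p2) (mul_pos p3 p4))
    rw [Real.log_div (mul_pos p1 p2).ne' (mul_pos p3 p4).ne', Real.log_mul p1.ne' p2.ne',
      Real.log_mul p3.ne' p4.ne'] at this
    have := mul_le_mul_of_nonneg_left this h0.le
    linarith
  refine (Finset.sum_le_sum fun ω _ => key ω).trans ?_
  rw [Finset.sum_sub_distrib, hP.2, sub_nonpos,
    ← sum_distr_mul P (fun ω => (U ω, V ω, T ω)) (fun x =>
      (distr P (fun ω => (V ω, T ω)) (x.2.1, x.2.2) * distr P (fun ω => (U ω, T ω)) (x.1, x.2.2)) /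
        (distr P T x.2.2 * distr P (fun ω => (U ω, V ω, T ω)) (x.1, x.2.1, x.2.2)))]
  -- Only an inequality, because triples of probability zero contribute nothing on the left but may
  -- contribute on the right.
  have h1 : ∀ x : α × β × γ, distr P (fun ω => (U ω, V ω, T ω)) x *
      ((distr P (fun ω => (V ω, T ω)) (x.2.1, x.2.2) * distr P (fun ω => (U ω, T ω)) (x.1, x.2.2)) /
        (distr P T x.2.2 * distr P (fun ω => (U ω, V ω, T ω)) (x.1, x.2.1, x.2.2))) ≤
      distr P (fun ω => (U ω, T ω)) (x.1, x.2.2) *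
        (distr P (fun ω => (V ω, T ω)) (x.2.1, x.2.2) / distr P T x.2.2) := by
    rintro ⟨u, v, t⟩
    have n1 := distr_nonneg hP.1 (fun ω => (V ω, T ω)) (v, t)
    have n2 := distr_nonneg hP.1 (fun ω => (U ω, T ω)) (u, t)
    have n3 := distr_nonneg hP.1 T t
    by_cases h : distr P (fun ω => (U ω, V ω, T ω)) (u, v, t) = 0
    · simp only [h, zero_mul]; exact mul_nonneg n2 (div_nonneg n1 n3)
    · refine le_of_eq ?_
      by_cases h' : distr P T t = 0
      · simp [h']
      · field_simp
  refine (Finset.sum_le_sum fun x _ => h1 x).trans ?_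
  rw [Fintype.sum_prod_type]
  have h3 : ∀ u, ∑ x : β × γ, distr P (fun ω => (U ω, T ω)) (u, x.2) *
        (distr P (fun ω => (V ω, T ω)) (x.1, x.2) / distr P T x.2) ≤
        ∑ t, distr P (fun ω => (U ω, T ω)) (u, t) := by
    intro u
    rw [Fintype.sum_prod_type, Finset.sum_comm]
    refine Finset.sum_le_sum fun t _ => ?_
    dsimp only
    rw [← Finset.mul_sum, ← Finset.sum_div, sum_distr_fst]
    exact mul_le_of_le_one_right (distr_nonneg hP.1 _ _) (div_self_le_one _)
  refine (Finset.sum_le_sum fun u _ => h3 u).trans (le_of_eq ?_)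
  rw [← Fintype.sum_prod_type (f := fun x => distr P (fun ω => (U ω, T ω)) x), sum_distr, hP.2]

theorem entropy_const {P : Ω → ℝ} (hP : P ∈ stdSimplex ℝ Ω) : entropy P (fun _ => ()) = 0 := by
  rw [entropy_eq_sum]
  have : distr P (fun _ => ()) () = 1 := by simpa [distr, prob] using hP.2
  simp [this]

theorem condEntropy_const {P : Ω → ℝ} (hP : P ∈ stdSimplex ℝ Ω) (U : Ω → α) :
    condEntropy P U (fun _ => ()) = entropy P U := by
  rw [condEntropy, entropy_const hP, sub_zero]
  exact entropy_comp_equiv P U (Equiv.prodPUnit α).symm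

theorem condEntropy_pair_const (P : Ω → ℝ) (U : Ω → α) (V : Ω → β) :
    condEntropy P U (fun ω => (V ω, ())) = condEntropy P U V :=
  condEntropy_comp_equiv P U V (Equiv.prodPUnit β).symm

theorem condEntropy_le_entropy {P : Ω → ℝ} (hP : P ∈ stdSimplex ℝ Ω) (U : Ω → α) (V : Ω → β) :
    condEntropy P U V ≤ entropy P U := by
  rw [← condEntropy_const hP, ← condEntropy_pair_const]
  exact condEntropy_pair_le hP U V _

/-- Again log x ≤ x - 1, now with x = 1 / (p(u) |α|). -/
theorem entropy_le_logb_card {P : Ω → ℝ} (hP : P ∈ stdSimplex ℝ Ω) (U : Ω → α) :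
    entropy P U ≤ Real.logb 2 (Fintype.card α) := by
  have h2 : 0 < Real.log 2 := Real.log_pos one_lt_two
  rw [Real.logb, le_div_iff₀ h2, entropy_mul_log, ← sub_nonpos]
  have hne : Nonempty α := by
    by_contra hn
    rw [not_nonempty_iff] at hn
    have := (distr_mem hP U).2
    simp at this
  have hc : (0 : ℝ) < Fintype.card α := by exact_mod_cast Fintype.card_pos
  have key : ∀ ω, P ω * (-Real.log (distr P U (U ω))) - P ω * Real.log (Fintype.card α) ≤
      P ω * (1 / (distr P U (U ω) * Fintype.card α)) - P ω := by
    intro ω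
    rcases (hP.1 ω).eq_or_lt with h0 | h0
    · simp [← h0]
    have p1 := h0.trans_le (le_distr hP.1 U ω)
    have := Real.log_le_sub_one_of_pos (div_pos one_pos (mul_pos p1 hc))
    rw [one_div, Real.log_inv, Real.log_mul p1.ne' hc.ne'] at this
    have := mul_le_mul_of_nonneg_left this h0.le
    rw [one_div]; linarith
  have h3 : ∑ ω, P ω * Real.log (Fintype.card α) = Real.log (Fintype.card α) := by
    rw [← Finset.sum_mul, hP.2, one_mul]
  rw [← h3, ← Finset.sum_sub_distrib]
  refine (Finset.sum_le_sum fun ω _ => key ω).trans ?_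
  rw [Finset.sum_sub_distrib, hP.2, sub_nonpos,
    ← sum_distr_mul P U (fun a => 1 / (distr P U a * Fintype.card α))]
  have : ∀ a, distr P U a * (1 / (distr P U a * Fintype.card α)) ≤ 1 / Fintype.card α := by
    intro a
    by_cases h : distr P U a = 0
    · simp only [h, zero_mul]; positivity
    · refine le_of_eq ?_; field_simp
  refine (Finset.sum_le_sum fun a _ => this a).trans (le_of_eq ?_)
  simp

/-- If f ≤ 2b/k, monotonicity of the logarithm suffices, at a loss of log 2. Otherwise f is at most
twice its deviation from b/k, so the missing f log k is absorbed by the last term, and f ≤ b gives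
the rest. -/
theorem mul_log_sub_mul_log_le {f b : ℝ} (hf : 0 ≤ f) (hfb : f ≤ b) {k : ℝ} (hk : 1 ≤ k) :
    f * Real.log f - f * Real.log b ≤
      -f * Real.log k + f * Real.log 2 + 2 * |f - b / k| * Real.log k := by
  have hlk := Real.log_nonneg hk
  have hl2 := (Real.log_pos one_lt_two).le
  have hk0 : 0 < k := by linarith
  rcases hf.eq_or_lt with h0 | h0
  · simp only [← h0]; simp; positivity
  have hb : 0 < b := by linarith
  rcases le_or_gt f (2 * b / k) with h | h
  · have := Real.log_le_log h0 h
    rw [Real.log_div (by positivity) hk0.ne', Real.log_mul (by norm_num) hb.ne'] at this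
    have := mul_le_mul_of_nonneg_left this hf
    have : 0 ≤ 2 * |f - b / k| * Real.log k := by positivity
    linarith
  · have h1 := mul_le_mul_of_nonneg_left (Real.log_le_log h0 hfb) hf
    have h2 : f ≤ 2 * |f - b / k| := by
      have := le_abs_self (f - b / k)
      have h3 : 2 * b / k = 2 * (b / k) := by ring
      linarith
    have h3 := mul_le_mul_of_nonneg_right h2 hlk
    have h4 : 0 ≤ f * Real.log 2 := by positivity
    linarith

/-- A nearly uniform and nearly independent variable has nearly maximal conditional entropy. -/
theorem le_condEntropy {P : Ω → ℝ} (hP : P ∈ stdSimplex ℝ Ω) (U : Ω → α) (E : Ω → β) :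
    (1 - 2 * secDist P U E) * Real.logb 2 (Fintype.card α) - 1 ≤ condEntropy P U E := by
  have h2 : 0 < Real.log 2 := Real.log_pos one_lt_two
  have hne : Nonempty α := by
    by_contra hn
    rw [not_nonempty_iff] at hn
    have := (distr_mem hP U).2
    simp at this
  have hc : (1 : ℝ) ≤ Fintype.card α := by exact_mod_cast Fintype.card_pos
  have h1 : condEntropy P U E * Real.log 2 = ∑ e, ∑ u,
      -(distr P (fun ω => (U ω, E ω)) (u, e) * Real.log (distr P (fun ω => (U ω, E ω)) (u, e)) -
        distr P (fun ω => (U ω, E ω)) (u, e) * Real.log (distr P E e)) := by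
    simp only [condEntropy, entropy, ← Finset.sum_div, sub_mul]
    rw [div_mul_cancel₀ _ h2.ne', div_mul_cancel₀ _ h2.ne', Fintype.sum_prod_type, Finset.sum_comm,
      ← Finset.sum_sub_distrib]
    refine Finset.sum_congr rfl fun e _ => ?_
    simp only [neg_sub, Finset.sum_sub_distrib, ← Finset.sum_mul]
    rw [sum_distr_fst]
    simp only [Real.negMulLog, neg_mul, Finset.sum_neg_distrib]
    ring
  -- The pointwise bound, with f the joint probability, b the marginal of `E` and k the size of the
  -- alphabet. Summed over all pairs, the log 2 terms make up the one bit lost.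
  have h3 : ∑ e, ∑ u, (distr P (fun ω => (U ω, E ω)) (u, e) * Real.log (Fintype.card α) -
      distr P (fun ω => (U ω, E ω)) (u, e) * Real.log 2 -
      2 * |distr P (fun ω => (U ω, E ω)) (u, e) - distr P E e / Fintype.card α| *
        Real.log (Fintype.card α)) ≤ condEntropy P U E * Real.log 2 := by
    rw [h1]
    refine Finset.sum_le_sum fun e _ => Finset.sum_le_sum fun u _ => ?_
    have := mul_log_sub_mul_log_le (distr_nonneg hP.1 (fun ω => (U ω, E ω)) (u, e))
      (distr_pair_le_right hP.1 U E u e) hc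
    linarith
  have h4 : ∑ e, ∑ u, distr P (fun ω => (U ω, E ω)) (u, e) = 1 := by
    simp only [sum_distr_fst, sum_distr, hP.2]
  simp only [Finset.sum_sub_distrib, ← Finset.sum_mul, ← Finset.mul_sum, h4] at h3
  rw [Real.logb]
  have h5 : secDist P U E = ∑ e, ∑ u,
    |distr P (fun ω => (U ω, E ω)) (u, e) - distr P E e / Fintype.card α| := rfl
  rw [← h5] at h3
  refine le_of_mul_le_mul_right ?_ h2
  have : ((1 - 2 * secDist P U E) * (Real.log (Fintype.card α) / Real.log 2) - 1) * Real.log 2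
    = 1 * Real.log (Fintype.card α) - 1 * Real.log 2 -
      2 * secDist P U E * Real.log (Fintype.card α) := by
    field_simp
    ring
  rw [this]; exact h3

end EntropyLemmas

/-! ### Random hashing: leftover hash lemma and random binning -/

section Hashing

/-- `h` is a pairwise independent family of hash functions from `α` to `δ`, indexed by `Θ` with the
law `w`. -/
structure IsHashFamily {Θ α δ : Type*} [Fintype Θ] [Fintype δ] (w : Θ → ℝ) (h : Θ → α → δ) :
    Prop where
  mem : w ∈ stdSimplex ℝ Θ
  uniform : ∀ a d, distr w (fun θ => h θ a) d = 1 / Fintype.card δ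
  pairwise : ∀ a a', a ≠ a' → ∀ d d',
    distr w (fun θ => (h θ a, h θ a')) (d, d') = 1 / (Fintype.card δ : ℝ) ^ 2

/-- A uniformly random function has independent uniform values. An event on one or two of them is a
product over the points of `α`, so its probability factors. -/
theorem exists_isHashFamily (α δ : Type*) [Fintype α] [DecidableEq α] [Fintype δ] [Nonempty δ] :
    ∃ w : (α → δ) → ℝ, IsHashFamily w (fun θ a => θ a) := by
  classical
  have hL : (Fintype.card δ : ℝ) ≠ 0 := by exact_mod_cast Fintype.card_ne_zero
  refine ⟨fun θ => ∏ _a : α, (1 / (Fintype.card δ : ℝ)), ⟨fun θ => by positivity, ?_⟩, ?_, ?_⟩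
  · rw [← Fintype.prod_sum (fun (_ : α) (_ : δ) => 1 / (Fintype.card δ : ℝ))]
    simp [hL]
  · intro a d
    have : ∀ θ : α → δ, (if θ a = d then ∏ _a : α, (1 / (Fintype.card δ : ℝ)) else 0) =
        ∏ x, (if x = a then (if θ x = d then 1 / (Fintype.card δ : ℝ) else 0) else
          1 / (Fintype.card δ : ℝ)) := by
      intro θ
      split_ifs with h
      · refine Finset.prod_congr rfl fun x _ => ?_
        split_ifs with h1 h2
        · rfl
        · exact absurd (h1 ▸ h) h2
        · rfl
      · exact (Finset.prod_eq_zero (Finset.mem_univ a) (by simp [h])).symm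
    simp only [distr, prob, this]
    rw [← Fintype.prod_sum (fun (x : α) (c : δ) => if x = a then
      (if c = d then 1 / (Fintype.card δ : ℝ) else 0) else 1 / (Fintype.card δ : ℝ)),
      Finset.prod_eq_single a]
    · simp
    · intro b _ hb; simp [hb, hL]
    · simp
  · intro a a' haa d d'
    have : ∀ θ : α → δ, (if (θ a, θ a') = (d, d') then ∏ _a : α, (1 / (Fintype.card δ : ℝ)) else 0) =
        ∏ x, (if x = a then (if θ x = d then 1 / (Fintype.card δ : ℝ) else 0) else
          if x = a' then (if θ x = d' then 1 / (Fintype.card δ : ℝ) else 0) else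
          1 / (Fintype.card δ : ℝ)) := by
      intro θ
      split_ifs with h
      · obtain ⟨h1, h2⟩ := Prod.mk.inj h
        refine Finset.prod_congr rfl fun x _ => ?_
        by_cases e1 : x = a
        · subst e1; simp [h1]
        · by_cases e2 : x = a'
          · subst e2; simp [e1, h2]
          · simp [e1, e2]
      · by_cases h1 : θ a = d
        · have h2 : θ a' ≠ d' := fun h2 => h (by rw [h1, h2])
          exact (Finset.prod_eq_zero (Finset.mem_univ a') (by simp [h2, haa.symm])).symm
        · exact (Finset.prod_eq_zero (Finset.mem_univ a) (by simp [h1])).symm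
    simp only [distr, prob, this]
    rw [← Fintype.prod_sum (fun (x : α) (c : δ) => if x = a then
      (if c = d then 1 / (Fintype.card δ : ℝ) else 0) else if x = a' then
      (if c = d' then 1 / (Fintype.card δ : ℝ) else 0) else 1 / (Fintype.card δ : ℝ)),
      Finset.prod_eq_mul a a' haa]
    · simp [haa.symm]; ring
    · intro b _ hb; simp [hb.1, hb.2, hL]
    · simp
    · simp

variable {Θ α β δ δ' : Type*} [Fintype Θ] [Fintype δ] [Fintype δ']

/-- One hash function is drawn for all the pieces, and each prefix of pieces is again a hash family.
This lets a single draw serve several requirements of different rates. -/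
theorem IsHashFamily.fst {w : Θ → ℝ} {h : Θ → α → δ × δ'} (H : IsHashFamily w h) [Nonempty δ'] :
    IsHashFamily w (fun θ a => (h θ a).1) := by
  have hL : (Fintype.card δ' : ℝ) ≠ 0 := by exact_mod_cast Fintype.card_ne_zero
  refine ⟨H.mem, fun a d => ?_, fun a a' haa d d' => ?_⟩
  · rw [← sum_distr_snd w (fun θ => (h θ a).1) (fun θ => (h θ a).2)]
    simp only [Prod.mk.eta, H.uniform, Fintype.card_prod]
    simp [hL]
  · rw [← sum_distr_snd w (fun θ => ((h θ a).1, (h θ a').1)) (fun θ => ((h θ a).2, (h θ a').2))]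
    have : ∀ x : δ' × δ', distr w (fun θ => (((h θ a).1, (h θ a').1), (h θ a).2, (h θ a').2))
        ((d, d'), x) = 1 / (Fintype.card (δ × δ') : ℝ) ^ 2 := by
      intro x
      rw [← H.pairwise a a' haa (d, x.1) (d', x.2)]
      refine distr_congr w fun θ => ?_
      simp only [Prod.ext_iff]; tauto
    simp only [this, Fintype.card_prod]
    simp; field_simp

variable [Fintype α] [Fintype β]

open scoped Classical in
/-- Leftover hash lemma. -/
theorem leftover_hash {Ω : Type*} [Fintype Ω] {P : Ω → ℝ} (hP : P ∈ stdSimplex ℝ Ω) (A : Ω → α)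
    (B : Ω → β) {w : Θ → ℝ} {h : Θ → α → δ} (H : IsHashFamily w h) [Nonempty δ] {τ : ℝ} (hτ : 0 ≤ τ) :
    ∑ θ, w θ * secDist P (fun ω => h θ (A ω)) B ≤
      2 * prob P (fun ω => ¬ distr P (fun ω => (A ω, B ω)) (A ω, B ω) ≤ τ * distr P B (B ω)) +
        Real.sqrt (Fintype.card δ * τ) := by
  set L : ℝ := (Fintype.card δ : ℝ) with hLdef
  have hL : 0 < L := by rw [hLdef]; exact_mod_cast Fintype.card_pos
  have hL1 : 1 ≤ L := by rw [hLdef]; exact_mod_cast Fintype.card_pos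
  set p : α → β → ℝ := fun a b => distr P (fun ω => (A ω, B ω)) (a, b) with hp
  set pB := distr P B with hpB
  have hp0 : ∀ a b, 0 ≤ p a b := fun a b => distr_nonneg hP.1 _ _
  have hpB0 : ∀ b, 0 ≤ pB b := fun b => distr_nonneg hP.1 _ _
  have hsum : ∀ b, ∑ a, p a b = pB b := fun b => sum_distr_fst P A B b
  -- Split the joint law into a typical part `q`, with conditional probabilities at most `τ`, to be
  -- treated by second moments, and a rest `n` bounded by its mass.
  set q : α → β → ℝ := fun a b => if p a b ≤ τ * pB b then p a b else 0 with hq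
  set n : α → β → ℝ := fun a b => if p a b ≤ τ * pB b then 0 else p a b with hn
  have hpq : ∀ a b, p a b = q a b + n a b := by
    intro a b; simp only [hq, hn]; split_ifs <;> simp
  have hq0 : ∀ a b, 0 ≤ q a b := by
    intro a b; simp only [hq]; split_ifs <;> simp [hp0]
  have hn0 : ∀ a b, 0 ≤ n a b := by
    intro a b; simp only [hn]; split_ifs <;> simp [hp0]
  set ξ : Θ → α → δ → ℝ := fun θ a d => (if h θ a = d then 1 else 0) - 1 / L with hξ
  have hnprob : ∑ b, ∑ a, n a b =
      prob P (fun ω => ¬ distr P (fun ω => (A ω, B ω)) (A ω, B ω) ≤ τ * distr P B (B ω)) := by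
    rw [← prob_distr P (fun ω => (A ω, B ω)) (fun x => ¬ p x.1 x.2 ≤ τ * pB x.2), prob,
      Fintype.sum_prod_type, Finset.sum_comm]
    refine Finset.sum_congr rfl fun a _ => Finset.sum_congr rfl fun b _ => ?_
    by_cases hh : p a b ≤ τ * pB b
    · simp only [hn, hh, if_true, not_true, if_false]
    · simp only [hn, hh, not_false_eq_true, if_true, if_false]; rfl
  -- pointwise decomposition
  have hdec : ∀ θ b d, |distr P (fun ω => (h θ (A ω), B ω)) (d, b) - pB b / L| ≤
      |∑ a, q a b * ξ θ a d| + ∑ a, n a b * ((if h θ a = d then 1 else 0) + 1 / L) := by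
    intro θ b d
    have h1 : distr P (fun ω => (h θ (A ω), B ω)) (d, b) - pB b / L = ∑ a, p a b * ξ θ a d := by
      rw [distr_comp P (fun ω => (A ω, B ω)) (fun x => (h θ x.1, x.2)), Fintype.sum_prod_type,
        ← hsum, Finset.sum_div, ← Finset.sum_sub_distrib]
      refine Finset.sum_congr rfl fun a _ => ?_
      rw [Finset.sum_eq_single b]
      · simp only [hξ, hp, Prod.mk.injEq, and_true]
        split_ifs <;> ring
      · intro b' _ hb; simp [hb]
      · simp
    rw [h1]
    simp only [hpq, add_mul, Finset.sum_add_distrib]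
    refine (abs_add_le _ _).trans (add_le_add le_rfl ?_)
    refine (Finset.abs_sum_le_sum_abs _ _).trans (Finset.sum_le_sum fun a _ => ?_)
    rw [abs_mul, abs_of_nonneg (hn0 a b)]
    refine mul_le_mul_of_nonneg_left ?_ (hn0 a b)
    simp only [hξ]
    refine (abs_sub _ _).trans (le_of_eq ?_)
    rw [abs_of_nonneg (by positivity : 0 ≤ 1 / L)]
    split_ifs <;> simp
  -- second moments
  have e1 : ∀ a d, ∑ θ, w θ * (if h θ a = d then (1 : ℝ) else 0) = 1 / L := by
    intro a d
    rw [← H.uniform a d, distr, prob_eq_sum]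
  have e2 : ∀ a a', a ≠ a' → ∀ d,
      ∑ θ, w θ * ((if h θ a = d then (1 : ℝ) else 0) * (if h θ a' = d then (1 : ℝ) else 0)) =
        1 / L ^ 2 := by
    intro a a' haa d
    rw [← H.pairwise a a' haa d d, distr, prob_eq_sum]
    refine Finset.sum_congr rfl fun θ _ => ?_
    by_cases h1 : h θ a = d <;> by_cases h2 : h θ a' = d <;> simp [h1, h2]
  have hw1 : ∑ θ, w θ = 1 := H.mem.2
  -- Pairwise independence makes the centred indicators of distinct points uncorrelated.
  have c2 : ∀ a a' d, ∑ θ, w θ * (ξ θ a d * ξ θ a' d) ≤ if a = a' then 1 / L else 0 := by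
    intro a a' d
    have h1 : ∀ θ, w θ * (ξ θ a d * ξ θ a' d) =
        w θ * ((if h θ a = d then (1 : ℝ) else 0) * (if h θ a' = d then (1 : ℝ) else 0)) -
        w θ * (if h θ a = d then (1 : ℝ) else 0) * (1 / L) -
        w θ * (if h θ a' = d then (1 : ℝ) else 0) * (1 / L) + w θ * (1 / L ^ 2) := by
      intro θ; simp only [hξ]; ring
    simp only [h1, Finset.sum_add_distrib, Finset.sum_sub_distrib, ← Finset.sum_mul, hw1, e1]
    split_ifs with haa
    · subst haa
      have : ∀ θ, w θ * ((if h θ a = d then (1 : ℝ) else 0) * (if h θ a = d then (1 : ℝ) else 0)) =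
        w θ * (if h θ a = d then (1 : ℝ) else 0) := by
        intro θ; split_ifs <;> simp
      simp only [this, e1]
      have : 0 ≤ 1 / L ^ 2 := by positivity
      have h3 : 1 / L * (1 / L) = 1 / L ^ 2 := by ring
      rw [h3]; linarith
    · rw [e2 a a' haa]
      refine le_of_eq ?_; ring
  have hvar : ∀ b d, ∑ θ, w θ * (∑ a, q a b * ξ θ a d) ^ 2 ≤ (pB b) ^ 2 * (τ / L) := by
    intro b d
    have h1 : ∑ θ, w θ * (∑ a, q a b * ξ θ a d) ^ 2 =
        ∑ a, ∑ a', q a b * q a' b * ∑ θ, w θ * (ξ θ a d * ξ θ a' d) := by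
      have h0 : ∀ θ, (∑ a, q a b * ξ θ a d) ^ 2 =
          ∑ a, ∑ a', (q a b * ξ θ a d) * (q a' b * ξ θ a' d) := by
        intro θ; rw [sq, Finset.sum_mul_sum]
      simp only [h0, Finset.mul_sum]
      rw [Finset.sum_comm]
      refine Finset.sum_congr rfl fun a _ => ?_
      rw [Finset.sum_comm]
      refine Finset.sum_congr rfl fun a' _ => Finset.sum_congr rfl fun θ _ => ?_
      ring
    rw [h1]
    -- Only the diagonal survives, and one of its two factors `q` is at most `τ * pB b`.
    have h2 : ∑ a, ∑ a', q a b * q a' b * ∑ θ, w θ * (ξ θ a d * ξ θ a' d) ≤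
        ∑ a, q a b * (τ * pB b) * (1 / L) := by
      refine Finset.sum_le_sum fun a _ => ?_
      refine (Finset.sum_le_sum fun a' _ => mul_le_mul_of_nonneg_left (c2 a a' d)
        (mul_nonneg (hq0 a b) (hq0 a' b))).trans ?_
      simp only [mul_ite, mul_zero, Finset.sum_ite_eq, Finset.mem_univ, if_true]
      refine mul_le_mul_of_nonneg_right (mul_le_mul_of_nonneg_left ?_ (hq0 a b)) (by positivity)
      simp only [hq]
      split_ifs with h
      · exact h
      · exact mul_nonneg hτ (hpB0 b)
    refine h2.trans ?_
    rw [← Finset.sum_mul, ← Finset.sum_mul]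
    have h3 : ∑ a, q a b ≤ pB b := by
      rw [← hsum]
      exact Finset.sum_le_sum fun a _ => by rw [hpq]; linarith [hn0 a b]
    calc (∑ a, q a b) * (τ * pB b) * (1 / L) ≤ pB b * (τ * pB b) * (1 / L) := by
          refine mul_le_mul_of_nonneg_right (mul_le_mul_of_nonneg_right h3
            (mul_nonneg hτ (hpB0 b))) (by positivity)
      _ = _ := by ring
  -- Cauchy–Schwarz passes from the second moment to the mean absolute deviation.
  have hCS : ∀ b d, ∑ θ, w θ * |∑ a, q a b * ξ θ a d| ≤ pB b * Real.sqrt (τ / L) := by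
    intro b d
    have h1 : (∑ θ, w θ * |∑ a, q a b * ξ θ a d|) ^ 2 ≤
        (∑ θ, w θ) * ∑ θ, w θ * (∑ a, q a b * ξ θ a d) ^ 2 := by
      refine Finset.sum_sq_le_sum_mul_sum_of_sq_le_mul _ (fun θ _ => H.mem.1 θ)
        (fun θ _ => mul_nonneg (H.mem.1 θ) (sq_nonneg _)) fun θ _ => ?_
      rw [mul_pow, sq_abs]; exact le_of_eq (by ring)
    rw [hw1, one_mul] at h1
    refine le_of_sq_le_sq (h1.trans ((hvar b d).trans (le_of_eq ?_)))
      (mul_nonneg (hpB0 b) (Real.sqrt_nonneg _))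
    rw [mul_pow, Real.sq_sqrt (by positivity)]
  -- assembling
  have hfin : ∑ θ, w θ * secDist P (fun ω => h θ (A ω)) B ≤
      ∑ b, ∑ d, (∑ θ, w θ * |∑ a, q a b * ξ θ a d| +
        ∑ a, n a b * (∑ θ, w θ * (if h θ a = d then (1 : ℝ) else 0) + (∑ θ, w θ) * (1 / L))) := by
    simp only [secDist, Finset.mul_sum]
    rw [Finset.sum_comm]
    refine Finset.sum_le_sum fun b _ => ?_
    rw [Finset.sum_comm]
    refine Finset.sum_le_sum fun d _ => ?_
    refine (Finset.sum_le_sum fun θ _ =>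
      mul_le_mul_of_nonneg_left (hdec θ b d) (H.mem.1 θ)).trans (le_of_eq ?_)
    simp only [mul_add, Finset.sum_add_distrib, Finset.mul_sum, Finset.sum_mul]
    congr 1
    congr 1 <;>
    · rw [Finset.sum_comm]
      exact Finset.sum_congr rfl fun a _ => Finset.sum_congr rfl fun θ _ => by ring
  refine hfin.trans ?_
  -- Summed over the `L` bins, the indicators of the bins add up to one and so do the terms `1 / L`:
  -- hence the 2 before the atypical mass. The typical part gives L √(τ/L) = √(Lτ).
  have hstep : ∀ b, ∑ d, (∑ θ, w θ * |∑ a, q a b * ξ θ a d| +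
        ∑ a, n a b * (∑ θ, w θ * (if h θ a = d then (1 : ℝ) else 0) + (∑ θ, w θ) * (1 / L))) ≤
      pB b * Real.sqrt (L * τ) + 2 * ∑ a, n a b := by
    intro b
    simp only [e1, hw1]
    refine (Finset.sum_le_sum fun d _ => add_le_add_left (hCS b d) _).trans (le_of_eq ?_)
    have h5 : L * Real.sqrt (τ / L) = Real.sqrt (L * τ) := by
      rw [show L * τ = L ^ 2 * (τ / L) by field_simp, Real.sqrt_mul (by positivity),
        Real.sqrt_sq hL.le]
    rw [Finset.sum_const, Finset.card_univ, nsmul_eq_mul, ← Finset.sum_mul, ← h5, ← hLdef]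
    field_simp
    ring
  refine (Finset.sum_le_sum fun b _ => hstep b).trans (le_of_eq ?_)
  rw [Finset.sum_add_distrib, ← Finset.sum_mul, ← Finset.mul_sum, hnprob, hpB, sum_distr, hP.2]
  ring

omit [Fintype β] in
open scoped Classical in
/-- Source coding with side information at the decoder, by random binning. -/
theorem exists_binning_decoder {Ω : Type*} [Fintype Ω] {P : Ω → ℝ} (hP : P ∈ stdSimplex ℝ Ω)
    (A : Ω → α) (B : Ω → β) {w : Θ → ℝ} {h : Θ → α → δ} (H : IsHashFamily w h) [Nonempty δ]
    [Nonempty α] {τ : ℝ} (hτ : 0 < τ) :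
    ∃ dec : Θ → β → δ → α,
    ∑ θ, w θ * prob P (fun ω => dec θ (B ω) (h θ (A ω)) ≠ A ω) ≤
      prob P (fun ω => ¬ τ * distr P B (B ω) ≤ distr P (fun ω => (A ω, B ω)) (A ω, B ω)) +
        1 / (τ * Fintype.card δ) := by
  set L : ℝ := (Fintype.card δ : ℝ) with hLdef
  have hL : 0 < L := by rw [hLdef]; exact_mod_cast Fintype.card_pos
  set p : α → β → ℝ := fun a b => distr P (fun ω => (A ω, B ω)) (a, b) with hp
  set pB := distr P B with hpB
  set T : α → β → Prop := fun a b => τ * pB b ≤ p a b with hT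
  have hp0 : ∀ a b, 0 ≤ p a b := fun a b => distr_nonneg hP.1 _ _
  -- The decoder returns any point of the announced bin that is conditionally likely given `b`, and
  -- an arbitrary point if there is none. It errs only if the true point is unlikely or another
  -- likely point shares its bin.
  refine ⟨fun θ b d => if hx : ∃ a, h θ a = d ∧ T a b then hx.choose else Classical.arbitrary α, ?_⟩
  have h1 : ∀ θ, prob P (fun ω => (if hx : ∃ a, h θ a = h θ (A ω) ∧ T a (B ω) then hx.choose else
      Classical.arbitrary α) ≠ A ω) ≤ prob P (fun ω => ¬ T (A ω) (B ω)) +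
        ∑ ω, P ω * ∑ a, if a ≠ A ω ∧ T a (B ω) then (if h θ a = h θ (A ω) then 1 else 0) else 0 := by
    intro θ
    refine (prob_mono hP.1 (F := fun ω => ¬ T (A ω) (B ω) ∨
      ∃ a, (a ≠ A ω ∧ T a (B ω)) ∧ h θ a = h θ (A ω)) fun ω _ hω => ?_).trans
      ((prob_or_le hP.1 _ _).trans (add_le_add le_rfl ?_))
    · by_cases ht : T (A ω) (B ω)
      · right
        have hx : ∃ a, h θ a = h θ (A ω) ∧ T a (B ω) := ⟨A ω, rfl, ht⟩
        rw [dif_pos hx] at hω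
        exact ⟨hx.choose, ⟨hω, hx.choose_spec.2⟩, hx.choose_spec.1⟩
      · exact Or.inl ht
    · rw [prob_eq_sum]
      refine Finset.sum_le_sum fun ω _ => mul_le_mul_of_nonneg_left ?_ (hP.1 ω)
      have hnn : ∀ a ∈ Finset.univ, (0 : ℝ) ≤ if a ≠ A ω ∧ T a (B ω) then
          (if h θ a = h θ (A ω) then 1 else 0) else 0 := by
        intro a _; split_ifs <;> simp
      split_ifs with hx
      · obtain ⟨a, ha1, ha2⟩ := hx
        refine le_trans (le_of_eq ?_) (Finset.single_le_sum hnn (Finset.mem_univ a))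
        rw [if_pos ha1, if_pos ha2]
      · exact Finset.sum_nonneg hnn
  refine (Finset.sum_le_sum fun θ _ => mul_le_mul_of_nonneg_left (h1 θ) (H.mem.1 θ)).trans ?_
  simp only [mul_add, Finset.sum_add_distrib]
  rw [← Finset.sum_mul, H.mem.2, one_mul]
  refine add_le_add le_rfl ?_
  have hcoll : ∀ a a', a ≠ a' → ∑ θ, w θ * (if h θ a = h θ a' then (1 : ℝ) else 0) = 1 / L := by
    intro a a' haa
    have : ∀ θ, w θ * (if h θ a = h θ a' then (1 : ℝ) else 0) =
        ∑ d, w θ * (if (h θ a, h θ a') = (d, d) then (1 : ℝ) else 0) := by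
      intro θ
      rw [← Finset.mul_sum]
      congr 1
      by_cases hh : h θ a = h θ a'
      · simp [hh]
      · rw [if_neg hh]
        symm
        refine Finset.sum_eq_zero fun d _ => if_neg fun hc => hh ?_
        rw [(Prod.mk.inj hc).1, (Prod.mk.inj hc).2]
    simp only [this]
    rw [Finset.sum_comm]
    have h2 : ∀ d, ∑ θ, w θ * (if (h θ a, h θ a') = (d, d) then (1 : ℝ) else 0) = 1 / L ^ 2 := by
      intro d
      rw [← H.pairwise a a' haa d d, distr, prob_eq_sum]
      exact Finset.sum_congr rfl fun θ _ => by split_ifs <;> rfl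
    simp only [h2]
    rw [Finset.sum_const, Finset.card_univ, nsmul_eq_mul, ← hLdef]
    field_simp
  calc ∑ θ, w θ * ∑ ω, P ω * ∑ a, (if a ≠ A ω ∧ T a (B ω) then
        (if h θ a = h θ (A ω) then (1 : ℝ) else 0) else 0)
      = ∑ ω, P ω * ∑ a, (if a ≠ A ω ∧ T a (B ω) then
        ∑ θ, w θ * (if h θ a = h θ (A ω) then (1 : ℝ) else 0) else 0) := by
        simp only [Finset.mul_sum]
        rw [Finset.sum_comm]
        refine Finset.sum_congr rfl fun ω _ => ?_
        rw [Finset.sum_comm]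
        refine Finset.sum_congr rfl fun a _ => ?_
        split_ifs
        · rw [Finset.mul_sum]
          refine Finset.sum_congr rfl fun θ _ => by ring
        · simp
    _ ≤ ∑ ω, P ω * (1 / (τ * L)) := by
        refine Finset.sum_le_sum fun ω _ => ?_
        rcases (hP.1 ω).eq_or_lt with h0 | h0
        · simp [← h0]
        refine mul_le_mul_of_nonneg_left ?_ h0.le
        have hb : 0 < pB (B ω) := h0.trans_le (le_distr hP.1 B ω)
        -- Each competitor has conditional probability at least `τ`, so there are at most `1 / τ` of
        -- them, each colliding with probability `1 / L`. The count is done by weighting each with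
        -- `p a (B ω) / (τ * pB (B ω))`.
        have : ∀ a, (if a ≠ A ω ∧ T a (B ω) then
            ∑ θ, w θ * (if h θ a = h θ (A ω) then (1 : ℝ) else 0) else 0) ≤
            p a (B ω) * (1 / (τ * pB (B ω) * L)) := by
          intro a
          split_ifs with hx
          · rw [hcoll a (A ω) hx.1]
            have := hx.2
            simp only [hT] at this
            calc 1 / L = τ * pB (B ω) * (1 / (τ * pB (B ω) * L)) := by field_simp
              _ ≤ _ := mul_le_mul_of_nonneg_right this (by positivity)
          · exact mul_nonneg (hp0 _ _) (by positivity)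
        refine (Finset.sum_le_sum fun a _ => this a).trans (le_of_eq ?_)
        rw [← Finset.sum_mul]
        have hs : ∑ a, p a (B ω) = pB (B ω) := sum_distr_fst P A B _
        rw [hs]
        field_simp
    _ = 1 / (τ * L) := by rw [← Finset.sum_mul, hP.2, one_mul]

end Hashing

/-! ### Independent copies and asymptotic equipartition -/

section Iid

open Filter Topology

/-- The law of `N` independent copies. -/
noncomputable def iidLaw {Ω : Type*} (P : Ω → ℝ) (N : ℕ) (ω : Fin N → Ω) : ℝ := ∏ i, P (ω i)

/-- The sequence of the values of `U` on a sequence of outcomes. -/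
def seqOf {Ω α : Type*} {N : ℕ} (U : Ω → α) (ω : Fin N → Ω) (i : Fin N) : α := U (ω i)

variable {Ω α β : Type*} [Fintype Ω]

theorem iidLaw_mem {P : Ω → ℝ} (hP : P ∈ stdSimplex ℝ Ω) (N : ℕ) :
    iidLaw P N ∈ stdSimplex ℝ (Fin N → Ω) := by
  refine ⟨fun ω => Finset.prod_nonneg fun i _ => hP.1 _, ?_⟩
  have := Fintype.prod_sum (fun (_ : Fin N) (a : Ω) => P a)
  simp only [iidLaw]
  rw [← this]
  exact Finset.prod_eq_one fun _ _ => hP.2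

open scoped Classical in
theorem distr_seq (P : Ω → ℝ) {N : ℕ} (U : Ω → α) (u : Fin N → α) :
    distr (iidLaw P N) (seqOf U) u = ∏ i, distr P U (u i) := by
  simp only [distr, prob]
  rw [Fintype.prod_sum (fun i a => if U a = u i then P a else 0)]
  refine Finset.sum_congr rfl fun ω _ => ?_
  split_ifs with h
  · refine Finset.prod_congr rfl fun i _ => ?_
    exact (if_pos (congrFun h i)).symm
  · obtain ⟨i, hi⟩ : ∃ i, U (ω i) ≠ u i := by
      by_contra! hn
      exact h (funext hn)
    exact (Finset.prod_eq_zero (Finset.mem_univ i) (if_neg hi)).symm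

theorem distr_seq_pair (P : Ω → ℝ) {N : ℕ} (U : Ω → α) (V : Ω → β) (u : Fin N → α) (v : Fin N → β) :
    distr (iidLaw P N) (fun ω => (seqOf U ω, seqOf V ω)) (u, v) =
      ∏ i, distr P (fun ω => (U ω, V ω)) (u i, v i) := by
  rw [← distr_seq P (fun ω => (U ω, V ω)) (fun i => (u i, v i))]
  refine distr_congr _ fun ω => ?_
  simp only [seqOf, Prod.mk.injEq, funext_iff, forall_and]

theorem iidLaw_cons {Ω : Type*} (P : Ω → ℝ) {N : ℕ} (a : Ω) (ω : Fin N → Ω) :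
    iidLaw P (N + 1) (Fin.cons a ω) = P a * iidLaw P N ω := by
  simp [iidLaw, Fin.prod_univ_succ]

theorem sum_cons {N : ℕ} (f : (Fin (N + 1) → Ω) → ℝ) :
    ∑ ω, f ω = ∑ a, ∑ ω : Fin N → Ω, f (Fin.cons a ω) := by
  rw [← (Fin.consEquiv (fun _ => Ω)).sum_comp, Fintype.sum_prod_type]
  rfl

theorem sum_iidLaw_mul_sum {P : Ω → ℝ} (hP : P ∈ stdSimplex ℝ Ω) (g : Ω → ℝ)
    (hg : ∑ a, P a * g a = 0) (N : ℕ) : ∑ ω, iidLaw P N ω * ∑ i, g (ω i) = 0 := by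
  induction N with
  | zero => simp
  | succ N ih =>
    rw [sum_cons]
    simp only [iidLaw_cons, Fin.sum_univ_succ, Fin.cons_zero, Fin.cons_succ]
    have : ∀ a, ∑ ω : Fin N → Ω, P a * iidLaw P N ω * (g a + ∑ i, g (ω i)) =
        P a * g a * ∑ ω, iidLaw P N ω + P a * ∑ ω, iidLaw P N ω * ∑ i, g (ω i) := by
      intro a
      rw [Finset.mul_sum, Finset.mul_sum, ← Finset.sum_add_distrib]
      exact Finset.sum_congr rfl fun ω _ => by ring
    simp only [this, ih, (iidLaw_mem hP N).2, mul_one, mul_zero, add_zero, hg]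

/-- Variances of independent centred variables add: when the first coordinate is split off, the
cross term vanishes. -/
theorem sum_iidLaw_mul_sum_sq {P : Ω → ℝ} (hP : P ∈ stdSimplex ℝ Ω) (g : Ω → ℝ)
    (hg : ∑ a, P a * g a = 0) (N : ℕ) :
    ∑ ω, iidLaw P N ω * (∑ i, g (ω i)) ^ 2 = N * ∑ a, P a * g a ^ 2 := by
  induction N with
  | zero => simp
  | succ N ih =>
    rw [sum_cons]
    simp only [iidLaw_cons, Fin.sum_univ_succ, Fin.cons_zero, Fin.cons_succ]
    have : ∀ a, ∑ ω : Fin N → Ω, P a * iidLaw P N ω * (g a + ∑ i, g (ω i)) ^ 2 =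
        P a * g a ^ 2 * ∑ ω, iidLaw P N ω + P a * g a * 2 * ∑ ω, iidLaw P N ω * ∑ i, g (ω i) +
          P a * ∑ ω, iidLaw P N ω * (∑ i, g (ω i)) ^ 2 := by
      intro a
      rw [Finset.mul_sum, Finset.mul_sum, Finset.mul_sum, ← Finset.sum_add_distrib,
        ← Finset.sum_add_distrib]
      exact Finset.sum_congr rfl fun ω _ => by ring
    simp only [this, ih, sum_iidLaw_mul_sum hP g hg N, (iidLaw_mem hP N).2, mul_one, mul_zero,
      add_zero, Finset.sum_add_distrib, ← Finset.sum_mul, hP.2]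
    push_cast; ring

/-- The weak law of large numbers, with Chebyshev's bound. -/
theorem prob_le_abs_sum_le {P : Ω → ℝ} (hP : P ∈ stdSimplex ℝ Ω) (g : Ω → ℝ)
    (hg : ∑ a, P a * g a = 0) {N : ℕ} (hN : 0 < N) {ε : ℝ} (hε : 0 < ε) :
    prob (iidLaw P N) (fun ω => N * ε ≤ |∑ i, g (ω i)|) ≤ (∑ a, P a * g a ^ 2) / ε ^ 2 / N := by
  have hN' : (0 : ℝ) < N := by exact_mod_cast hN
  have h1 : prob (iidLaw P N) (fun ω => N * ε ≤ |∑ i, g (ω i)|) ≤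
      ∑ ω, iidLaw P N ω * (∑ i, g (ω i)) ^ 2 * (1 / (N * ε) ^ 2) := by
    rw [prob_eq_sum]
    refine Finset.sum_le_sum fun ω _ => ?_
    rw [mul_assoc]
    refine mul_le_mul_of_nonneg_left ?_ ((iidLaw_mem hP N).1 ω)
    split_ifs with h
    · rw [mul_one_div, one_le_div (by positivity), ← sq_abs (∑ i, g (ω i))]
      exact pow_le_pow_left₀ (by positivity) h 2
    · positivity
  refine h1.trans (le_of_eq ?_)
  rw [← Finset.sum_mul, sum_iidLaw_mul_sum_sq hP g hg]
  field_simp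

variable [Fintype α] [Fintype β]

theorem condEntropy_eq_sum (P : Ω → ℝ) (A : Ω → α) (B : Ω → β) :
    condEntropy P A B = ∑ ω, P ω * (Real.logb 2 (distr P B (B ω)) -
      Real.logb 2 (distr P (fun ω => (A ω, B ω)) (A ω, B ω))) := by
  rw [condEntropy, entropy_eq_sum, entropy_eq_sum, ← Finset.sum_sub_distrib]
  exact Finset.sum_congr rfl fun ω _ => by ring

/-- Asymptotic equipartition: outside of a set of small probability, the conditional probability of
a sequence lies between `2 ^ (-N (H + ε))` and `2 ^ (-N (H - ε))`. -/
theorem exists_aep {P : Ω → ℝ} (hP : P ∈ stdSimplex ℝ Ω) (A : Ω → α) (B : Ω → β) :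
    ∃ C : ℝ, ∀ (N : ℕ) (ε : ℝ), 0 < N → 0 < ε →
      prob (iidLaw P N) (fun ω => ¬ distr (iidLaw P N) (fun ω => (seqOf A ω, seqOf B ω))
        (seqOf A ω, seqOf B ω) ≤ (2 : ℝ) ^ (-(N * (condEntropy P A B - ε))) *
          distr (iidLaw P N) (seqOf B) (seqOf B ω)) ≤ C / ε ^ 2 / N ∧
      prob (iidLaw P N) (fun ω => ¬ (2 : ℝ) ^ (-(N * (condEntropy P A B + ε))) *
          distr (iidLaw P N) (seqOf B) (seqOf B ω) ≤ distr (iidLaw P N) (fun ω => (seqOf A ω, seqOf B ω))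
        (seqOf A ω, seqOf B ω)) ≤ C / ε ^ 2 / N := by
  set H := condEntropy P A B with hH
  set g : Ω → ℝ := fun ω => (Real.logb 2 (distr P B (B ω)) -
      Real.logb 2 (distr P (fun ω => (A ω, B ω)) (A ω, B ω))) - H with hg
  have hg0 : ∑ ω, P ω * g ω = 0 := by
    simp only [hg, mul_sub _ _ H, Finset.sum_sub_distrib, ← Finset.sum_mul, hP.2]
    rw [← condEntropy_eq_sum, hH]; ring
  -- The constant is the variance of the conditional self-information, independent of `N` and `ε`.
  refine ⟨∑ a, P a * g a ^ 2, fun N ε hN hε => ?_⟩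
  have hmain := prob_le_abs_sum_le hP g hg0 hN hε
  have hPN := (iidLaw_mem hP N)
  -- On outcomes of positive mass all the probabilities involved are positive, so the logarithm of
  -- the product law is a genuine sum. The other outcomes do not count.
  have hpos : ∀ ω : Fin N → Ω, iidLaw P N ω ≠ 0 →
      0 < distr (iidLaw P N) (seqOf B) (seqOf B ω) ∧
      0 < distr (iidLaw P N) (fun ω => (seqOf A ω, seqOf B ω)) (seqOf A ω, seqOf B ω) ∧
      ∑ i, g (ω i) = Real.logb 2 (distr (iidLaw P N) (seqOf B) (seqOf B ω)) -
        Real.logb 2 (distr (iidLaw P N) (fun ω => (seqOf A ω, seqOf B ω)) (seqOf A ω, seqOf B ω)) -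
          N * H := by
    intro ω hω
    have h0 : 0 < iidLaw P N ω := lt_of_le_of_ne (hPN.1 ω) hω.symm
    have hi : ∀ i, 0 < P (ω i) := fun i =>
      lt_of_le_of_ne (hP.1 _) (Finset.prod_ne_zero_iff.mp hω i (Finset.mem_univ i)).symm
    refine ⟨h0.trans_le (le_distr hPN.1 (seqOf B) ω),
      h0.trans_le (le_distr hPN.1 (fun ω => (seqOf A ω, seqOf B ω)) ω), ?_⟩
    rw [distr_seq, distr_seq_pair]
    simp only [seqOf]
    rw [Real.logb_prod _ _ fun i _ =>
      ((hi i).trans_le (le_distr hP.1 B (ω i))).ne', Real.logb_prod _ _ fun i _ =>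
      ((hi i).trans_le (le_distr hP.1 (fun ω => (A ω, B ω)) (ω i))).ne']
    simp only [hg, Finset.sum_sub_distrib]
    simp
  constructor
  · refine (prob_mono hPN.1 fun ω hω h => ?_).trans hmain
    obtain ⟨h1, h2, h3⟩ := hpos ω hω
    rw [not_le] at h
    have := Real.logb_lt_logb one_lt_two (by positivity) h
    rw [Real.logb_mul (by positivity) h1.ne', Real.logb_rpow two_pos (by norm_num)] at this
    rw [h3, le_abs]
    right
    linarith
  · refine (prob_mono hPN.1 fun ω hω h => ?_).trans hmain
    obtain ⟨h1, h2, h3⟩ := hpos ω hω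
    rw [not_le] at h
    have := Real.logb_lt_logb one_lt_two h2 h
    rw [Real.logb_mul (by positivity) h1.ne', Real.logb_rpow two_pos (by norm_num)] at this
    rw [h3, le_abs]
    left
    linarith

theorem tendsto_two_rpow_neg_mul {c : ℝ} (hc : 0 < c) :
    Tendsto (fun N : ℕ => (2 : ℝ) ^ (-(N * c))) atTop (𝓝 0) := by
  have h1 : ∀ N : ℕ, (2 : ℝ) ^ (-(N * c)) = ((2 : ℝ) ^ (-c)) ^ N := by
    intro N
    rw [← Real.rpow_natCast, ← Real.rpow_mul two_pos.le]
    congr 1; ring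
  simp only [h1]
  exact tendsto_pow_atTop_nhds_zero_of_lt_one (by positivity)
    (Real.rpow_lt_one_of_one_lt_of_neg one_lt_two (by linarith))

/-- With τ = 2^(-N(H - ε/2)), half of `ε` pays for typicality and the other half makes card δ · τ at
most 2^(-Nε/2). The case of a single bin is listed apart because a negative rate, rounded down to
the exponent 0, violates the size bound. The threshold on `N` depends neither on the hash family nor
on its range. -/
theorem leftover_hash_iid {P : Ω → ℝ} (hP : P ∈ stdSimplex ℝ Ω) (A : Ω → α) (B : Ω → β)
    {ε η : ℝ} (hε : 0 < ε) (hη : 0 < η) :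
    ∀ᶠ N : ℕ in atTop, ∀ {Θ δ : Type*} [Fintype Θ] [Fintype δ] [Nonempty δ] (w : Θ → ℝ)
      (h : Θ → (Fin N → α) → δ), IsHashFamily w h →
      (Fintype.card δ = 1 ∨ (Fintype.card δ : ℝ) ≤ (2 : ℝ) ^ (N * (condEntropy P A B - ε))) →
      ∑ θ, w θ * secDist (iidLaw P N) (fun ω => h θ (seqOf A ω)) (seqOf B) ≤ η := by
  obtain ⟨C, hC⟩ := exists_aep hP A B
  have ht1 : Tendsto (fun N : ℕ => 2 * (C / (ε / 2) ^ 2 / N) +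
      Real.sqrt ((2 : ℝ) ^ (-(N * (ε / 2))))) atTop (𝓝 0) := by
    have h1 := (tendsto_const_div_atTop_nhds_zero_nat (C / (ε / 2) ^ 2)).const_mul 2
    have h2 := (Real.continuous_sqrt.tendsto 0).comp (tendsto_two_rpow_neg_mul (half_pos hε))
    simpa using h1.add h2
  filter_upwards [ht1.eventually (gt_mem_nhds hη), eventually_gt_atTop 0] with N hN hN0
  intro Θ δ _ _ _ w h H hcard
  rcases hcard with hcard | hcard
  · simp only [secDist_of_card_eq_one _ _ _ hcard, mul_zero, Finset.sum_const_zero]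
    exact hη.le
  refine (leftover_hash (iidLaw_mem hP N) (seqOf A) (seqOf B) H
    (τ := (2 : ℝ) ^ (-(N * (condEntropy P A B - ε / 2)))) (by positivity)).trans
    (le_trans (add_le_add (mul_le_mul_of_nonneg_left (hC N (ε / 2) hN0 (by positivity)).1
      two_pos.le) (Real.sqrt_le_sqrt ?_)) hN.le)
  calc (Fintype.card δ : ℝ) * (2 : ℝ) ^ (-(N * (condEntropy P A B - ε / 2)))
      ≤ (2 : ℝ) ^ (N * (condEntropy P A B - ε)) * (2 : ℝ) ^ (-(N * (condEntropy P A B - ε / 2))) :=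
        mul_le_mul_of_nonneg_right hcard (by positivity)
    _ = _ := by
        rw [← Real.rpow_add two_pos]
        congr 1; ring

/-- With τ = 2^(-N(H + ε/2)), half of `ε` pays for typicality and the other half bounds the
collisions by 2^(-Nε/2). -/
theorem exists_binning_decoder_iid {P : Ω → ℝ} (hP : P ∈ stdSimplex ℝ Ω) (A : Ω → α) (B : Ω → β)
    [Nonempty α] {ε η : ℝ} (hε : 0 < ε) (hη : 0 < η) :
    ∀ᶠ N : ℕ in atTop, ∀ {Θ δ : Type*} [Fintype Θ] [Fintype δ] [Nonempty δ] (w : Θ → ℝ)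
      (h : Θ → (Fin N → α) → δ), IsHashFamily w h →
      (2 : ℝ) ^ (N * (condEntropy P A B + ε)) ≤ (Fintype.card δ : ℝ) →
      ∃ dec : Θ → (Fin N → β) → δ → (Fin N → α),
        ∑ θ, w θ * prob (iidLaw P N) (fun ω => dec θ (seqOf B ω) (h θ (seqOf A ω)) ≠ seqOf A ω) ≤ η := by
  obtain ⟨C, hC⟩ := exists_aep hP A B
  have ht1 : Tendsto (fun N : ℕ => C / (ε / 2) ^ 2 / N + (2 : ℝ) ^ (-(N * (ε / 2)))) atTop
      (𝓝 0) := by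
    have h1 := (tendsto_const_div_atTop_nhds_zero_nat (C / (ε / 2) ^ 2))
    simpa using h1.add (tendsto_two_rpow_neg_mul (half_pos hε))
  filter_upwards [ht1.eventually (gt_mem_nhds hη), eventually_gt_atTop 0] with N hN hN0
  intro Θ δ _ _ _ w h H hcard
  obtain ⟨dec, hdec⟩ := exists_binning_decoder (iidLaw_mem hP N) (seqOf A) (seqOf B) H
    (τ := (2 : ℝ) ^ (-(N * (condEntropy P A B + ε / 2)))) (by positivity)
  refine ⟨dec, hdec.trans (le_trans (add_le_add (hC N (ε / 2) hN0 (by positivity)).2 ?_) hN.le)⟩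
  have hcard0 : (0 : ℝ) < Fintype.card δ := by exact_mod_cast Fintype.card_pos
  rw [div_le_iff₀ (by positivity)]
  calc (1 : ℝ) = (2 : ℝ) ^ (-(N * (ε / 2))) * ((2 : ℝ) ^ (-(N * (condEntropy P A B + ε / 2))) *
        (2 : ℝ) ^ (N * (condEntropy P A B + ε))) := by
        rw [← Real.rpow_add two_pos, ← Real.rpow_add two_pos]
        ring_nf
        simp
    _ ≤ _ := by
        refine mul_le_mul_of_nonneg_left (mul_le_mul_of_nonneg_left hcard ?_) ?_ <;> positivity

end Iid

/-! ### Secret key agreement from a correlated source -/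

section SourceCode

open Filter Topology

theorem condEntropy_nonneg {Ω α β : Type*} [Fintype Ω] [Fintype α] [Fintype β] {P : Ω → ℝ}
    (hP : P ∈ stdSimplex ℝ Ω) (A : Ω → α) (B : Ω → β) : 0 ≤ condEntropy P A B := by
  rw [condEntropy_eq_sum]
  refine Finset.sum_nonneg fun ω _ => ?_
  rcases (hP.1 ω).eq_or_lt with h0 | h0
  · simp [← h0]
  refine mul_nonneg h0.le (sub_nonneg.mpr (Real.logb_le_logb_of_le one_lt_two ?_ ?_))
  · exact h0.trans_le (le_distr hP.1 (fun ω => (A ω, B ω)) ω)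
  · exact distr_pair_le_right hP.1 A B _ _

theorem two_pow_floor (x : ℝ) :
    2 ^ ⌊x⌋₊ = 1 ∨ ((2 ^ ⌊x⌋₊ : ℕ) : ℝ) ≤ (2 : ℝ) ^ x := by
  rcases le_or_gt 0 x with h | h
  · right
    push_cast
    rw [← Real.rpow_natCast]
    exact Real.rpow_le_rpow_of_exponent_le one_le_two (Nat.floor_le h)
  · left
    rw [Nat.floor_of_nonpos h.le, pow_zero]

theorem two_rpow_le_pow_ceil (x : ℝ) : (2 : ℝ) ^ x ≤ ((2 ^ ⌈x⌉₊ : ℕ) : ℝ) := by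
  push_cast
  rw [← Real.rpow_natCast]
  exact Real.rpow_le_rpow_of_exponent_le one_le_two (Nat.le_ceil x)

/-- Compare both laws with the uniform law of `F` times the law of `I`. The first comparison only
involves the marginal of `F`, whose deviation is at most that of the pair. This turns near
uniformity into the near independence that `exists_fixed_index` requires. -/
theorem sum_abs_mul_sub_le {Ω α β : Type*} [Fintype Ω] [Fintype α] [Fintype β] {P : Ω → ℝ}
    (hP : P ∈ stdSimplex ℝ Ω) (F : Ω → α) (I : Ω → β) :
    ∑ f, ∑ i, |distr P F f * distr P I i - distr P (fun ω => (F ω, I ω)) (f, i)| ≤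
      2 * secDist P F I := by
  have hI := distr_mem hP I
  have h1 : ∀ f i, |distr P F f * distr P I i - distr P (fun ω => (F ω, I ω)) (f, i)| ≤
      (∑ j, |distr P (fun ω => (F ω, I ω)) (f, j) - distr P I j / Fintype.card α|) * distr P I i +
      |distr P (fun ω => (F ω, I ω)) (f, i) - distr P I i / Fintype.card α| := by
    intro f i
    have h2 : |distr P F f - 1 / Fintype.card α| ≤
        ∑ j, |distr P (fun ω => (F ω, I ω)) (f, j) - distr P I j / Fintype.card α| := by
      refine le_trans (le_of_eq ?_) (Finset.abs_sum_le_sum_abs _ _)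
      rw [Finset.sum_sub_distrib, sum_distr_snd, ← Finset.sum_div, hI.2]
    have h3 : distr P F f * distr P I i - distr P (fun ω => (F ω, I ω)) (f, i) =
      (distr P F f - 1 / Fintype.card α) * distr P I i -
        (distr P (fun ω => (F ω, I ω)) (f, i) - distr P I i / Fintype.card α) := by ring
    rw [h3]
    refine (abs_sub _ _).trans (add_le_add ?_ le_rfl)
    rw [abs_mul, abs_of_nonneg (hI.1 i)]
    exact mul_le_mul_of_nonneg_right h2 (hI.1 i)
  refine (Finset.sum_le_sum fun f _ => Finset.sum_le_sum fun i _ => h1 f i).trans (le_of_eq ?_)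
  simp only [Finset.sum_add_distrib, ← Finset.mul_sum, hI.2, mul_one, secDist]
  rw [two_mul, Finset.sum_comm]

variable {Ω 𝒱 𝒳 𝒴 𝒵 : Type*} [Fintype Ω] [Fintype 𝒱] [Fintype 𝒳] [Fintype 𝒴] [Fintype 𝒵]

/-- The law of the observations of the three parties, and of what the second party computes from his
observation with the stochastic map `κ`. -/
noncomputable def sourceLaw {σ : Type*} (P : Ω → ℝ) (X : Ω → 𝒳) (Y : Ω → 𝒴) (Z : Ω → 𝒵) {N : ℕ}
    (κ : (Fin N → 𝒴) → σ → ℝ) (ω : (Fin N → 𝒳) × (Fin N → 𝒴) × (Fin N → 𝒵) × σ) : ℝ :=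
  (∏ i, distr P (fun ω => (X ω, Y ω, Z ω)) (ω.1 i, ω.2.1 i, ω.2.2.1 i)) * κ ω.2.1 ω.2.2.2

/-- One-way secret key agreement with a rate-limited public message: the observer of `Y` computes a
message and a key, which the observer of `X` recovers from the message; the message and the key are
nearly uniform and independent of `Z`. -/
theorem exists_source_code {P : Ω → ℝ} (hP : P ∈ stdSimplex ℝ Ω) (V : Ω → 𝒱) (X : Ω → 𝒳)
    (Y : Ω → 𝒴) (Z : Ω → 𝒵) (hM : IsMarkov P V Y (fun ω => (X ω, Z ω)))
    (hpos : condEntropy P V X < condEntropy P V Z) {ε η : ℝ} (hε : 0 < ε) (hη : 0 < η) :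
    ∀ᶠ N : ℕ in atTop, ∃ (b c : ℕ) (κ : (Fin N → 𝒴) → Fin (2 ^ b) × Fin (2 ^ c) → ℝ)
      (dec : (Fin N → 𝒳) → Fin (2 ^ b) → Fin (2 ^ c)),
      (∀ y, κ y ∈ stdSimplex ℝ _) ∧
      (b : ℝ) ≤ N * (condMutualInfo P V Y X + ε) ∧
      N * (condEntropy P V Z - condEntropy P V X - ε) ≤ c ∧
      (c : ℝ) ≤ N * condEntropy P V Z ∧
      prob (sourceLaw P X Y Z κ) (fun ω => dec ω.1 ω.2.2.2.1 ≠ ω.2.2.2.2) ≤ η ∧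
      secDist (sourceLaw P X Y Z κ) (fun ω => ω.2.2.2) (fun ω => ω.2.2.1) ≤ η := by
  classical
  have hΩ : Nonempty Ω := by
    by_contra hn
    rw [not_nonempty_iff] at hn
    have := hP.2
    simp at this
  have hV : Nonempty 𝒱 := ⟨V hΩ.some⟩
  -- By the Markov chain this is H(V|Y), but keeping X in the condition makes H(V|X) - H(V|Y,X)
  -- literally I(V;Y|X).
  set hYX := condEntropy P V (fun ω => (Y ω, X ω)) with hYXdef
  set hX := condEntropy P V X with hXdef
  set hZ := condEntropy P V Z with hZdef
  have hle : hYX ≤ hX := condEntropy_pair_le hP V Y X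
  have hX0 : 0 ≤ hX := condEntropy_nonneg hP V X
  obtain ⟨e, he0, he1, he2⟩ : ∃ e : ℝ, 0 < e ∧ 4 * e ≤ ε ∧ 4 * e ≤ hZ - hX := by
    refine ⟨min (ε / 4) ((hZ - hX) / 4), ?_, ?_, ?_⟩
    · exact lt_min (by linarith) (by linarith)
    · linarith [min_le_left (ε / 4) ((hZ - hX) / 4)]
    · linarith [min_le_right (ε / 4) ((hZ - hX) / 4)]
  -- The total of `exists_fixed_index` below is α + β + 3γ with α, β, γ equal to 3, 6, 6 times `η /
  -- 27`.
  have hη' : 0 < η / 27 := by positivity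
  have hbig : ∀ᶠ N : ℕ in atTop, 2 ≤ (N : ℝ) * e := by
    have : Tendsto (fun N : ℕ => (N : ℝ) * e) atTop atTop :=
      tendsto_natCast_atTop_atTop.atTop_mul_const he0
    exact this.eventually_ge_atTop 2
  filter_upwards [leftover_hash_iid hP V (fun ω => (Y ω, X ω)) he0 hη',
    leftover_hash_iid hP V Z he0 hη', exists_binning_decoder_iid hP V X he0 hη', hbig]
    with N h1 h2 h3 hN
  -- Bit lengths of the prefixes of the hash: `a` for the index F, nearly independent of (Y, X); `A`
  -- for (F, G), enough to decode V from X; `C` for (F, G, K), still uniform given Z. As 4e ≤ H(V|Z)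
  -- - H(V|X) and N e ≥ 2, the rounding leaves `A ≤ C`.
  set a := ⌊N * (hYX - e)⌋₊ with ha
  set A := ⌈N * (hX + e)⌉₊ with hA
  set C := ⌊N * (hZ - e)⌋₊ with hC
  have hN0 : (0 : ℝ) ≤ N := Nat.cast_nonneg N
  have haA : a ≤ A := by
    refine (Nat.floor_le_floor ?_).trans (Nat.floor_le_ceil (N * (hX + e)))
    exact mul_le_mul_of_nonneg_left (by linarith) hN0
  have hA1 : (A : ℝ) < N * (hX + e) + 1 := Nat.ceil_lt_add_one (by positivity)
  have hC1 : N * (hZ - e) - 1 < C := Nat.sub_one_lt_floor _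
  have hC2 : (C : ℝ) ≤ N * (hZ - e) :=
    Nat.floor_le (mul_nonneg hN0 (by linarith))
  have ha1 : N * (hYX - e) - 1 < a := Nat.sub_one_lt_floor _
  have hmul : (N : ℝ) * (4 * e) ≤ N * (hZ - hX) := mul_le_mul_of_nonneg_left he2 hN0
  have hmul2 : (N : ℝ) * (4 * e) ≤ N * ε := mul_le_mul_of_nonneg_left he1 hN0
  have hAC : A ≤ C := by
    have : (A : ℝ) < C + 1 := by nlinarith
    exact_mod_cast Nat.lt_succ_iff.mp (by exact_mod_cast this)
  obtain ⟨w, hw⟩ := exists_isHashFamily (Fin N → 𝒱)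
    ((Fin (2 ^ a) × Fin (2 ^ (A - a))) × Fin (2 ^ (C - A)))
  have hwF := hw.fst.fst
  have hwFG := hw.fst
  have k1 := h1 w _ hwF (by
    rw [Fintype.card_fin]; exact two_pow_floor _)
  have k2 := h2 w _ hw (by
    have : Fintype.card ((Fin (2 ^ a) × Fin (2 ^ (A - a))) × Fin (2 ^ (C - A))) = 2 ^ C := by
      simp only [Fintype.card_prod, Fintype.card_fin, ← pow_add]
      congr 1; omega
    rw [this]; exact two_pow_floor _)
  obtain ⟨dec, k3⟩ := h3 w _ hwFG (by
    have : Fintype.card (Fin (2 ^ a) × Fin (2 ^ (A - a))) = 2 ^ A := by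
      simp only [Fintype.card_prod, Fintype.card_fin, ← pow_add]
      congr 1; omega
    rw [this]; exact two_rpow_le_pow_ceil _)
  have k4 := add_le_add (add_le_add k1 k2) k3
  simp only [← Finset.sum_add_distrib, ← mul_add] at k4
  obtain ⟨θ, hθ⟩ := exists_le_of_weighted_sum_le hw.mem k4
  have hPN := iidLaw_mem hP N
  set pN := iidLaw P N with hpN
  have n1 := secDist_nonneg pN (fun ω => (θ (seqOf V ω)).1.1) (seqOf (fun ω => (Y ω, X ω)))
  have n2 := secDist_nonneg pN (fun ω => (θ (seqOf V ω))) (seqOf Z)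
  have n3 := prob_nonneg hPN.1 (fun ω => dec θ (seqOf X ω) (θ (seqOf V ω)).1 ≠ seqOf V ω)
  set p : (Fin N → 𝒴) × (Fin N → 𝒱) × ((Fin N → 𝒳) × (Fin N → 𝒵)) → ℝ :=
    distr pN (fun ω => (seqOf Y ω, seqOf V ω, (seqOf X ω, seqOf Z ω))) with hp
  have hpm : p ∈ stdSimplex ℝ _ := distr_mem hPN _
  have hρ : Nonempty ((Fin N → 𝒳) × (Fin N → 𝒵)) :=
    ⟨(fun _ => X hΩ.some, fun _ => Z hΩ.some)⟩
  obtain ⟨k, hk1, hk2⟩ := exists_condKernel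
    (fun (y : Fin N → 𝒴) (r : (Fin N → 𝒳) × (Fin N → 𝒵)) =>
      distr pN (fun ω => (seqOf Y ω, (seqOf X ω, seqOf Z ω))) (y, r))
    (fun _ _ => distr_nonneg hPN.1 _ _)
  simp only [sum_distr_snd pN (seqOf Y) (fun ω => (seqOf X ω, seqOf Z ω))] at hk2
  set Q : (Fin N → 𝒴) → ℝ := distr pN (seqOf Y) with hQ
  -- The Markov chain passes to sequences coordinate by coordinate, so (X, Z) depends on V only
  -- through Y. This remains usable after V is resampled given Y and the frozen index.
  have hmarkov : ∀ y v r, p (y, v, r) * Q y = distr pN (fun ω => (seqOf Y ω, seqOf V ω)) (y, v) *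
      distr pN (fun ω => (seqOf Y ω, (seqOf X ω, seqOf Z ω))) (y, r) := by
    rintro y v ⟨x, z⟩
    have q1 : p (y, v, (x, z)) = ∏ i, distr P (fun ω => (V ω, Y ω, (X ω, Z ω)))
        (v i, y i, (x i, z i)) := by
      rw [← distr_seq P (fun ω => (V ω, Y ω, (X ω, Z ω))) (fun i => (v i, y i, (x i, z i)))]
      refine distr_congr _ fun ω => ?_
      simp only [seqOf, funext_iff, Prod.mk.injEq, forall_and]; tauto
    have q2 : distr pN (fun ω => (seqOf Y ω, seqOf V ω)) (y, v) =
        ∏ i, distr P (fun ω => (V ω, Y ω)) (v i, y i) := by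
      rw [← distr_seq P (fun ω => (V ω, Y ω)) (fun i => (v i, y i))]
      refine distr_congr _ fun ω => ?_
      simp only [seqOf, funext_iff, Prod.mk.injEq, forall_and]; tauto
    have q3 : distr pN (fun ω => (seqOf Y ω, (seqOf X ω, seqOf Z ω))) (y, (x, z)) =
        ∏ i, distr P (fun ω => (Y ω, (X ω, Z ω))) (y i, (x i, z i)) := by
      rw [← distr_seq P (fun ω => (Y ω, (X ω, Z ω))) (fun i => (y i, (x i, z i)))]
      refine distr_congr _ fun ω => ?_
      simp only [seqOf, funext_iff, Prod.mk.injEq, forall_and]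
    rw [q1, q2, q3, hQ, hpN, distr_seq, ← Finset.prod_mul_distrib, ← Finset.prod_mul_distrib]
    exact Finset.prod_congr rfl fun i _ => hM _ _ _
  have hfst : distr p (fun ω => (ω.1, ω.2.1)) = distr pN (fun ω => (seqOf Y ω, seqOf V ω)) := by
    rw [hp, distr_distr]
  -- Here the variable whose law is kept is the sequence Y, the resampled one is V, and the
  -- remainder (X, Z) is generated from Y by `k`.
  obtain ⟨f, κ, hκ, herr, hsec⟩ := exists_fixed_index p hpm (fun v => (θ v).1.1) Q (distr_mem hPN _)
    (fun y _ r => k y r) (fun y _ => hk1 y)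
    (by
      intro y v r
      rw [hfst]
      have h := hmarkov y v r
      by_cases hy : Q y = 0
      · have z1 : distr pN (fun ω => (seqOf Y ω, seqOf V ω)) (y, v) = 0 :=
          le_antisymm (by rw [← hy]; exact distr_pair_le_left hPN.1 (seqOf Y) (seqOf V) y v)
            (distr_nonneg hPN.1 _ _)
        have z2 : p (y, v, r) = 0 :=
          le_antisymm (by
            rw [← hy]
            exact distr_pair_le_left hPN.1 (seqOf Y)
              (fun ω => (seqOf V ω, (seqOf X ω, seqOf Z ω))) y (v, r))
            (hpm.1 _)
        rw [z1, z2, zero_mul]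
      · rw [← hk2 y r] at h
        have : p (y, v, r) * Q y =
          (distr pN (fun ω => (seqOf Y ω, seqOf V ω)) (y, v) * k y r) * Q y := by
          rw [h]; ring
        exact mul_right_cancel₀ hy this)
    (fun f ω => (θ (dec θ ω.2.2.1 (f, (θ ω.2.1).1.2))).2 ≠ (θ ω.2.1).2)
    (fun ω => ((θ ω.2.1).1.2, (θ ω.2.1).2)) (fun ω => ω.2.2.2)
    (α := 3 * (η / 27)) (β := 2 * (3 * (η / 27))) (γ := 2 * (3 * (η / 27)))
    (by
      have e1 : distr p (fun ω => (θ ω.2.1).1.1) = distr pN (fun ω => (θ (seqOf V ω)).1.1) := by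
        rw [hp, distr_distr]
      have e2 : distr p (fun ω => ((θ ω.2.1).1.1, ω.1)) =
          distr pN (fun ω => ((θ (seqOf V ω)).1.1, seqOf Y ω)) := by
        rw [hp, distr_distr]
      rw [e1, e2]
      refine (sum_abs_mul_sub_le hPN (fun ω => (θ (seqOf V ω)).1.1) (seqOf Y)).trans ?_
      have := secDist_comp_le pN (fun ω => (θ (seqOf V ω)).1.1) (seqOf (fun ω => (Y ω, X ω)))
        (fun s i => (s i).1)
      have e3 : (fun ω : Fin N → Ω => fun i => (seqOf (fun ω => (Y ω, X ω)) ω i).1) = seqOf Y := rfl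
      rw [e3] at this
      linarith)
    (by
      rw [hp, prob_distr pN]
      refine (prob_mono hPN.1 (F := fun ω => dec θ (seqOf X ω) (θ (seqOf V ω)).1 ≠ seqOf V ω)
        fun ω _ hne heq => hne ?_).trans (by linarith)
      exact congrArg (fun v => (θ v).2) heq)
    (by
      rw [hp, secDist_distr]
      -- The frozen index is public: (G, K) must be uniform given Z and F, which follows from (F, G,
      -- K) being uniform given Z.
      refine (secDist_chain pN (fun ω => ((θ (seqOf V ω)).1.2, (θ (seqOf V ω)).2))
        (fun ω => (θ (seqOf V ω)).1.1) (seqOf Z)).trans ?_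
      have := secDist_equiv pN (fun ω => θ (seqOf V ω)) (seqOf Z) (Equiv.prodAssoc _ _ _)
      have e1 : (fun ω : Fin N → Ω => (Equiv.prodAssoc _ _ _) (θ (seqOf V ω))) =
        fun ω => ((θ (seqOf V ω)).1.1, ((θ (seqOf V ω)).1.2, (θ (seqOf V ω)).2)) := rfl
      rw [e1] at this
      rw [this]
      linarith)
  set t : (Fin N → 𝒴) × (Fin N → 𝒱) × ((Fin N → 𝒳) × (Fin N → 𝒵)) → ℝ :=
    fun ω => Q ω.1 * κ ω.1 ω.2.1 * k ω.1 ω.2.2 with ht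
  have hlaw : sourceLaw P X Y Z (fun y => distr (κ y) (fun v => ((θ v).1.2, (θ v).2))) =
      distr t (fun ω => (ω.2.2.1, ω.1, ω.2.2.2, ((θ ω.2.1).1.2, (θ ω.2.1).2))) := by
    classical
    funext ⟨x, y, z, g⟩
    have e1 : ∏ i, distr P (fun ω => (X ω, Y ω, Z ω)) (x i, y i, z i) = Q y * k y (x, z) := by
      rw [hk2]
      rw [← distr_seq P (fun ω => (X ω, Y ω, Z ω)) (fun i => (x i, y i, z i))]
      refine distr_congr _ fun ω => ?_
      simp only [seqOf, funext_iff, Prod.mk.injEq, forall_and]; tauto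
    simp only [sourceLaw, e1]
    simp only [distr, prob, Fintype.sum_prod_type]
    rw [Finset.sum_eq_single y, Finset.mul_sum]
    · refine Finset.sum_congr rfl fun v _ => ?_
      rw [Finset.sum_eq_single x, Finset.sum_eq_single z]
      · simp only [Prod.mk.injEq, true_and, mul_ite, mul_zero, ht]
        split_ifs
        · ring
        · rfl
      · intro z' _ hz; simp [hz]
      · simp
      · intro x' _ hx; simp [hx]
      · simp
    · intro y' _ hy; simp [hy]
    · simp
  refine ⟨A - a, C - A, fun y => distr (κ y) (fun v => ((θ v).1.2, (θ v).2)),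
    fun x g => (θ (dec θ x (f, g))).2, fun y => distr_mem (hκ y) _, ?_, ?_, ?_, ?_, ?_⟩
  · rw [Nat.cast_sub haA, condMutualInfo, ← hYXdef, ← hXdef]
    nlinarith
  · rw [Nat.cast_sub hAC]
    nlinarith
  · rw [Nat.cast_sub hAC]
    have : (0 : ℝ) ≤ A := Nat.cast_nonneg A
    nlinarith
  · rw [hlaw, prob_distr t]
    exact herr.trans (by linarith)
  · rw [hlaw, secDist_distr]
    exact hsec.trans (by linarith)

end SourceCode

/-! ### Wiretap superposition codes obtained by binning -/

section ChannelCode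

open Filter Topology

variable {Ω 𝒰 𝒱 𝒳 𝒴 𝒵 : Type*} [Fintype Ω] [Fintype 𝒰] [Fintype 𝒱] [Fintype 𝒳] [Fintype 𝒴]
  [Fintype 𝒵]

/-- The law of a uniform message, of the codeword and of the channel outputs. -/
noncomputable def channelLaw {μ : Type*} [Fintype μ] (W : 𝒳 → stdSimplex ℝ (𝒴 × 𝒵)) {N : ℕ}
    (enc : μ → (Fin N → 𝒳) → ℝ) (ω : μ × (Fin N → 𝒳) × (Fin N → 𝒴) × (Fin N → 𝒵)) : ℝ :=
  1 / Fintype.card μ * enc ω.1 ω.2.1 * ∏ i, W (ω.2.1 i) (ω.2.2.1 i, ω.2.2.2 i)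

omit [Fintype 𝒳] in
theorem prod_channel_mem (W : 𝒳 → stdSimplex ℝ (𝒴 × 𝒵)) {N : ℕ} (x : Fin N → 𝒳) :
    (fun o : Fin N → 𝒴 × 𝒵 => ∏ i, W (x i) (o i)) ∈ stdSimplex ℝ (Fin N → 𝒴 × 𝒵) := by
  refine ⟨fun o => Finset.prod_nonneg fun i _ => (W _).2.1 _, ?_⟩
  rw [← Fintype.prod_sum (fun i o => W (x i) o)]
  exact Finset.prod_eq_one fun i _ => (W _).2.2

omit [Fintype 𝒳] in
theorem sum_sum_prod_channel (W : 𝒳 → stdSimplex ℝ (𝒴 × 𝒵)) {N : ℕ} (x : Fin N → 𝒳) :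
    ∑ y : Fin N → 𝒴, ∑ z : Fin N → 𝒵, ∏ i, W (x i) (y i, z i) = 1 := by
  rw [← (prod_channel_mem W x).2, ← (Equiv.arrowProdEquivProdArrow (Fin N) (fun _ => 𝒴)
    (fun _ => 𝒵)).symm.sum_comp, Fintype.sum_prod_type]
  rfl

set_option maxHeartbeats 1000000 in
/-- Superposition coding for the wiretap channel: `𝒰` is the alphabet of the cloud centers. The
message consists of a part which is secret, of a part carried by the satellites and of a part carried
by the cloud centers. -/
theorem exists_channel_code {P : Ω → ℝ} (hP : P ∈ stdSimplex ℝ Ω) (U : Ω → 𝒰) (V : Ω → 𝒱)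
    (X : Ω → 𝒳) (Y : Ω → 𝒴) (Z : Ω → 𝒵) (W : 𝒳 → stdSimplex ℝ (𝒴 × 𝒵))
    (hW : ∀ u v x y z, distr P (fun ω => ((U ω, V ω), X ω, (Y ω, Z ω))) ((u, v), x, (y, z)) =
      distr P (fun ω => ((U ω, V ω), X ω)) ((u, v), x) * W x (y, z))
    (hpos : 0 < condMutualInfo P V Y U) {ε η : ℝ} (hε : 0 < ε) (hη : 0 < η) :
    ∀ᶠ N : ℕ in atTop, ∃ (s t₁ t₂ : ℕ)
      (enc : Fin (2 ^ s) × Fin (2 ^ t₁) × Fin (2 ^ t₂) → (Fin N → 𝒳) → ℝ)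
      (dec : (Fin N → 𝒴) → Fin (2 ^ s) × Fin (2 ^ t₁) × Fin (2 ^ t₂)),
      (∀ i, enc i ∈ stdSimplex ℝ _) ∧
      N * (mutualInfo P U Y + condMutualInfo P V Y U - ε) ≤ (s + t₁ + t₂ : ℕ) ∧
      N * (condMutualInfo P V Y U - condMutualInfo P V Z U - ε) ≤ s ∧
      (s : ℝ) ≤ N * condEntropy P V (fun ω => (Z ω, U ω)) ∧
      prob (channelLaw W enc) (fun ω => dec ω.2.2.1 ≠ ω.1) ≤ η ∧
      secDist (channelLaw W enc) (fun ω => ω.1.1) (fun ω => ω.2.2.2) ≤ η := by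
  classical
  have hΩ : Nonempty Ω := by
    by_contra hn
    rw [not_nonempty_iff] at hn
    have := hP.2
    simp at this
  have hU : Nonempty 𝒰 := ⟨U hΩ.some⟩
  have hV : Nonempty 𝒱 := ⟨V hΩ.some⟩
  have hX : Nonempty 𝒳 := ⟨X hΩ.some⟩
  set hY := condEntropy P V (fun ω => (Y ω, U ω)) with hYdef
  set hZ := condEntropy P V (fun ω => (Z ω, U ω)) with hZdef
  set hVU := condEntropy P V U with hVUdef
  set hUY := condEntropy P U Y with hUYdef
  set hUU := condEntropy P U (fun _ => ()) with hUUdef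
  have hgap : hY < hVU := by
    have : condMutualInfo P V Y U = hVU - hY := rfl
    linarith
  have hZV : hZ ≤ hVU := condEntropy_pair_le hP V Z U
  have hY0 : 0 ≤ hY := condEntropy_nonneg hP V _
  have hZ0 : 0 ≤ hZ := condEntropy_nonneg hP V _
  have hUY0 : 0 ≤ hUY := condEntropy_nonneg hP U _
  obtain ⟨e, he0, he1, he2⟩ : ∃ e : ℝ, 0 < e ∧ 8 * e ≤ ε ∧ 8 * e ≤ hVU - hY := by
    refine ⟨min (ε / 8) ((hVU - hY) / 8), ?_, ?_, ?_⟩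
    · exact lt_min (by linarith) (by linarith)
    · linarith [min_le_left (ε / 8) ((hVU - hY) / 8)]
    · linarith [min_le_right (ε / 8) ((hVU - hY) / 8)]
  -- The total of `exists_fixed_index` below is α + β + 3γ with α, β, γ equal to 7, 4, 14 times `η /
  -- 53`.
  have hη' : 0 < η / 53 := by positivity
  have hbig : ∀ᶠ N : ℕ in atTop, 2 ≤ (N : ℝ) * e := by
    have : Tendsto (fun N : ℕ => (N : ℝ) * e) atTop atTop :=
      tendsto_natCast_atTop_atTop.atTop_mul_const he0
    exact this.eventually_ge_atTop 2
  filter_upwards [leftover_hash_iid hP V U he0 hη',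
    leftover_hash_iid hP V (fun ω => (Z ω, U ω)) he0 hη',
    exists_binning_decoder_iid hP V (fun ω => (Y ω, U ω)) he0 hη',
    leftover_hash_iid hP U (fun _ => ()) he0 hη',
    exists_binning_decoder_iid hP U Y he0 hη', hbig] with N h1 h2 h3 h4 h5 hN
  -- Bit lengths. The satellite is hashed to an index of `a₁` bits, enough to decode V from (Y, U),
  -- extended to `S` bits still hidden from (Z, U), and to `T₁` bits still uniform given U. The
  -- cloud center has an index of `a₂` bits, enough to decode U from Y, within `T₂` bits that are
  -- still uniform.
  set a₁ := ⌈N * (hY + e)⌉₊ with ha₁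
  set S := ⌊N * (hZ - e)⌋₊ with hS
  set T₁ := ⌊N * (hVU - e)⌋₊ with hT₁
  set a₂ := ⌈N * (hUY + e)⌉₊ with ha₂
  set T₂ := ⌊N * (hUU - e)⌋₊ with hT₂
  have hN0 : (0 : ℝ) ≤ N := Nat.cast_nonneg N
  have ha₁' : (a₁ : ℝ) < N * (hY + e) + 1 := Nat.ceil_lt_add_one (by positivity)
  have ha₂' : (a₂ : ℝ) < N * (hUY + e) + 1 := Nat.ceil_lt_add_one (by positivity)
  have hS' : N * (hZ - e) - 1 < S := Nat.sub_one_lt_floor _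
  have hT₁' : N * (hVU - e) - 1 < T₁ := Nat.sub_one_lt_floor _
  have hT₂' : N * (hUU - e) - 1 < T₂ := Nat.sub_one_lt_floor _
  have hmul : (N : ℝ) * (8 * e) ≤ N * (hVU - hY) := mul_le_mul_of_nonneg_left he2 hN0
  have hmul2 : (N : ℝ) * (8 * e) ≤ N * ε := mul_le_mul_of_nonneg_left he1 hN0
  have haT : a₁ ≤ T₁ := by
    have : (a₁ : ℝ) < T₁ + 1 := by nlinarith
    exact_mod_cast Nat.lt_succ_iff.mp (by exact_mod_cast this)
  have hST : S ≤ T₁ :=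
    Nat.floor_le_floor (mul_le_mul_of_nonneg_left (by linarith) hN0)
  have hS2 : (S : ℝ) ≤ N * hZ :=
    le_trans (b := ((⌊N * hZ⌋₊ : ℕ) : ℝ))
      (by exact_mod_cast Nat.floor_le_floor (mul_le_mul_of_nonneg_left (by linarith) hN0))
      (Nat.floor_le (mul_nonneg hN0 hZ0))
  -- Truncated subtraction: if Eve's channel is the better one, `s = 0` and the secret part is
  -- empty.
  set s := S - a₁ with hs
  set t₁ := T₁ - a₁ - s with ht₁
  set t₂ := T₂ - a₂ with ht₂
  have hPN := iidLaw_mem hP N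
  set pN := iidLaw P N with hpN
  -- the bins of the satellites
  obtain ⟨w, hw⟩ := exists_isHashFamily (Fin N → 𝒱)
    ((Fin (2 ^ a₁) × Fin (2 ^ s)) × Fin (2 ^ t₁))
  have k1 := h1 w _ hw (by
    have : Fintype.card ((Fin (2 ^ a₁) × Fin (2 ^ s)) × Fin (2 ^ t₁)) = 2 ^ T₁ := by
      simp only [Fintype.card_prod, Fintype.card_fin, ← pow_add]
      congr 1; omega
    rw [this]; exact two_pow_floor _)
  -- For `s = 0` there is nothing to hide. Otherwise `a₁ + s = S` exactly, so index and secret part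
  -- are jointly uniform given (Z, U), and the index is then published.
  have k2 : ∑ θ, w θ * secDist pN (fun ω => (θ (seqOf V ω)).1.2)
      (fun ω => ((θ (seqOf V ω)).1.1, seqOf (fun ω => (Z ω, U ω)) ω)) ≤ 2 * (η / 53) := by
    rcases Nat.eq_zero_or_pos s with h0 | h0
    · have : Fintype.card (Fin (2 ^ s)) = 1 := by rw [Fintype.card_fin, h0, pow_zero]
      simp only [secDist_of_card_eq_one _ _ _ this, mul_zero, Finset.sum_const_zero]
      positivity
    · have := h2 w _ hw.fst (by
        have : Fintype.card (Fin (2 ^ a₁) × Fin (2 ^ s)) = 2 ^ S := by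
          simp only [Fintype.card_prod, Fintype.card_fin, ← pow_add]
          congr 1; omega
        rw [this]; exact two_pow_floor _)
      refine le_trans ?_ (mul_le_mul_of_nonneg_left this two_pos.le)
      rw [Finset.mul_sum]
      refine Finset.sum_le_sum fun θ _ => ?_
      rw [mul_left_comm]
      exact mul_le_mul_of_nonneg_left (secDist_chain _ _ _ _) (hw.mem.1 θ)
  obtain ⟨dec₁, k3⟩ := h3 w _ hw.fst.fst (by
    rw [Fintype.card_fin]; exact two_rpow_le_pow_ceil _)
  have k4 := add_le_add (add_le_add k1 k2) k3
  simp only [← Finset.sum_add_distrib, ← mul_add] at k4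
  obtain ⟨θ, hθ⟩ := exists_le_of_weighted_sum_le hw.mem k4
  have n1 := secDist_nonneg pN (fun ω => θ (seqOf V ω)) (seqOf U)
  have n2 := secDist_nonneg pN (fun ω => (θ (seqOf V ω)).1.2)
      (fun ω => ((θ (seqOf V ω)).1.1, seqOf (fun ω => (Z ω, U ω)) ω))
  have n3 := prob_nonneg hPN.1
    (fun ω => dec₁ θ (seqOf (fun ω => (Y ω, U ω)) ω) (θ (seqOf V ω)).1.1 ≠ seqOf V ω)
  -- the bins of the cloud centers
  obtain ⟨w', hw'⟩ := exists_isHashFamily (Fin N → 𝒰) (Fin (2 ^ a₂) × Fin (2 ^ t₂))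
  have l1 : ∑ θ, w' θ * secDist pN (fun ω => (θ (seqOf U ω)).2)
      (fun ω => (θ (seqOf U ω)).1) ≤ 2 * (η / 53) := by
    rcases Nat.eq_zero_or_pos t₂ with h0 | h0
    · have : Fintype.card (Fin (2 ^ t₂)) = 1 := by rw [Fintype.card_fin, h0, pow_zero]
      simp only [secDist_of_card_eq_one _ _ _ this, mul_zero, Finset.sum_const_zero]
      positivity
    · have := h4 w' _ hw' (by
        have : Fintype.card (Fin (2 ^ a₂) × Fin (2 ^ t₂)) = 2 ^ T₂ := by
          simp only [Fintype.card_prod, Fintype.card_fin, ← pow_add]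
          congr 1; omega
        rw [this]; exact two_pow_floor _)
      refine le_trans ?_ (mul_le_mul_of_nonneg_left this two_pos.le)
      rw [Finset.mul_sum]
      refine Finset.sum_le_sum fun θ _ => ?_
      rw [mul_left_comm]
      refine mul_le_mul_of_nonneg_left (le_trans ?_
        (secDist_chain pN (fun ω => (θ (seqOf U ω)).2) (fun ω => (θ (seqOf U ω)).1)
          (seqOf (fun _ => ())))) (hw'.mem.1 θ)
      exact secDist_comp_le pN (fun ω => (θ (seqOf U ω)).2)
        (fun ω => ((θ (seqOf U ω)).1, seqOf (fun _ => ()) ω)) Prod.fst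
  obtain ⟨dec₂, l2⟩ := h5 w' _ hw'.fst (by
    rw [Fintype.card_fin]; exact two_rpow_le_pow_ceil _)
  have l3 := add_le_add l1 l2
  simp only [← Finset.sum_add_distrib, ← mul_add] at l3
  obtain ⟨θ', hθ'⟩ := exists_le_of_weighted_sum_le hw'.mem l3
  have n4 := secDist_nonneg pN (fun ω => (θ' (seqOf U ω)).2) (fun ω => (θ' (seqOf U ω)).1)
  have n5 := prob_nonneg hPN.1 (fun ω => dec₂ θ' (seqOf Y ω) (θ' (seqOf U ω)).1 ≠ seqOf U ω)
  -- message and index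
  set M : (Fin N → 𝒰) × (Fin N → 𝒱) → Fin (2 ^ s) × Fin (2 ^ t₁) × Fin (2 ^ t₂) :=
    fun v => ((θ v.2).1.2, (θ v.2).2, (θ' v.1).2) with hM
  set F : (Fin N → 𝒰) × (Fin N → 𝒱) → Fin (2 ^ a₁) × Fin (2 ^ a₂) :=
    fun v => ((θ v.2).1.1, (θ' v.1).1) with hF
  set UV : (Fin N → Ω) → (Fin N → 𝒰) × (Fin N → 𝒱) := fun ω => (seqOf U ω, seqOf V ω) with hUV
  set R : (Fin N → Ω) → (Fin N → 𝒳) × (Fin N → 𝒴) × (Fin N → 𝒵) :=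
    fun ω => (seqOf X ω, seqOf Y ω, seqOf Z ω) with hR
  -- The channel prefix, the conditional law of X given (U, V).
  obtain ⟨k, hk1, hk2⟩ := exists_condKernel
    (fun (v : (Fin N → 𝒰) × (Fin N → 𝒱)) (x : Fin N → 𝒳) =>
      distr pN (fun ω => (UV ω, seqOf X ω)) (v, x)) (fun _ _ => distr_nonneg hPN.1 _ _)
  simp only [sum_distr_snd pN UV (seqOf X)] at hk2
  have hchan : ∀ v x y z, distr pN (fun ω => (UV ω, R ω)) (v, (x, y, z)) =
      distr pN UV v * (k v x * ∏ i, W (x i) (y i, z i)) := by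
    rintro ⟨u, v⟩ x y z
    rw [← mul_assoc, hk2]
    have q1 : distr pN (fun ω => (UV ω, R ω)) ((u, v), (x, y, z)) =
        ∏ i, distr P (fun ω => ((U ω, V ω), X ω, (Y ω, Z ω))) ((u i, v i), x i, (y i, z i)) := by
      rw [← distr_seq P (fun ω => ((U ω, V ω), X ω, (Y ω, Z ω)))
        (fun i => ((u i, v i), x i, (y i, z i)))]
      refine distr_congr _ fun ω => ?_
      simp only [hUV, hR, seqOf, funext_iff, Prod.mk.injEq, forall_and]
    have q2 : distr pN (fun ω => (UV ω, seqOf X ω)) ((u, v), x) =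
        ∏ i, distr P (fun ω => ((U ω, V ω), X ω)) ((u i, v i), x i) := by
      rw [← distr_seq P (fun ω => ((U ω, V ω), X ω)) (fun i => ((u i, v i), x i))]
      refine distr_congr _ fun ω => ?_
      simp only [hUV, seqOf, funext_iff, Prod.mk.injEq, forall_and]
    rw [q1, q2, ← Finset.prod_mul_distrib]
    exact Finset.prod_congr rfl fun i _ => hW _ _ _ _ _
  set p := distr pN (fun ω => (M (UV ω), UV ω, R ω)) with hp
  have hpm : p ∈ stdSimplex ℝ _ := distr_mem hPN _
  set Q : Fin (2 ^ s) × Fin (2 ^ t₁) × Fin (2 ^ t₂) → ℝ :=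
    fun _ => 1 / Fintype.card (Fin (2 ^ s) × Fin (2 ^ t₁) × Fin (2 ^ t₂)) with hQ
  have hQm : Q ∈ stdSimplex ℝ _ := by
    refine ⟨fun _ => by positivity, ?_⟩
    simp only [hQ]
    rw [Finset.sum_const, Finset.card_univ, nsmul_eq_mul, mul_one_div, div_self]
    exact_mod_cast Fintype.card_ne_zero
  -- Here the variable whose law is prescribed is the message, uniform under `Q`; resampling (U, V)
  -- given the message and the frozen index is the stochastic encoder.
  obtain ⟨f, κ, hκ, herr, hsec⟩ := exists_fixed_index p hpm F Q hQm
    (fun _ v r => k v r.1 * ∏ i, W (r.1 i) (r.2.1 i, r.2.2 i))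
    (fun _ v => ⟨fun r => mul_nonneg ((hk1 v).1 _)
      (Finset.prod_nonneg fun i _ => (W _).2.1 _), by
        simp only [Fintype.sum_prod_type, ← Finset.mul_sum, sum_sum_prod_channel, mul_one]
        exact (hk1 v).2⟩)
    (by
      rintro i v ⟨x, y, z⟩
      rw [hp, distr_distr]
      -- The message is a function of (U, V), so off its graph both sides vanish.
      by_cases hi : M v = i
      · rw [distr_congr pN (V := fun ω => (UV ω, R ω)) (b := (v, (x, y, z))) (by
            intro ω; simp only [Prod.mk.injEq]
            exact ⟨fun h => h.2, fun h => ⟨by rw [h.1, hi], h⟩⟩),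
          distr_congr pN (U := fun ω => (M (UV ω), UV ω)) (V := UV) (b := v) (by
            intro ω; simp only [Prod.mk.injEq]
            exact ⟨fun h => h.2, fun h => ⟨by rw [h, hi], h⟩⟩), hchan]
      · have z1 : distr pN (fun ω => (M (UV ω), UV ω, R ω)) (i, v, x, y, z) = 0 := by
          simp only [distr, prob]
          refine Finset.sum_eq_zero fun ω _ => if_neg fun h => hi ?_
          simp only [Prod.mk.injEq] at h
          rw [← h.2.1, h.1]
        have z2 : distr pN (fun ω => (M (UV ω), UV ω)) (i, v) = 0 := by
          simp only [distr, prob]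
          refine Finset.sum_eq_zero fun ω _ => if_neg fun h => hi ?_
          simp only [Prod.mk.injEq] at h
          rw [← h.2, h.1]
        rw [z1, z2, zero_mul])
    -- Successive decoding: the cloud center from Y, then the satellite from Y and the decoded cloud
    -- center.
    (fun f ω => M (dec₂ θ' ω.2.2.2.1 f.2,
      dec₁ θ (fun i => (ω.2.2.2.1 i, dec₂ θ' ω.2.2.2.1 f.2 i)) f.1) ≠ ω.1)
    (fun ω => ω.1.1) (fun ω => ω.2.2.2.2)
    (α := 7 * (η / 53)) (β := 4 * (η / 53)) (γ := 14 * (η / 53))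
    (by
      have e1 : distr p (fun ω => F ω.2.1) = distr pN (fun ω => F (UV ω)) := by
        rw [hp, distr_distr]
      have e2 : distr p (fun ω => (F ω.2.1, ω.1)) = distr pN (fun ω => (F (UV ω), M (UV ω))) := by
        rw [hp, distr_distr]
      have e3 : ∑ f, ∑ i, |distr p (fun ω => F ω.2.1) f * Q i -
          distr p (fun ω => (F ω.2.1, ω.1)) (f, i)| =
          secDist pN (fun ω => M (UV ω)) (fun ω => F (UV ω)) := by
        refine Finset.sum_congr rfl fun f _ => Finset.sum_congr rfl fun i _ => ?_
        rw [e1, e2, abs_sub_comm, hQ, mul_one_div]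
        congr 2
        exact distr_congr pN fun ω =>
          ⟨fun h => Prod.ext (congrArg Prod.snd h) (congrArg Prod.fst h),
            fun h => Prod.ext (congrArg Prod.snd h) (congrArg Prod.fst h)⟩
      rw [e3]
      -- Message and index are jointly nearly uniform: the satellite hash is uniform given all of U,
      -- hence given the whole cloud hash. The cloud message is uniform given its index. The
      -- constant is 14 = 2 (4 + 3).
      have e4 := secDist_chain pN (fun ω => M (UV ω)) (fun ω => (θ (seqOf V ω)).1.1)
        (fun ω => (θ' (seqOf U ω)).1)
      have e5 := secDist_pair_le pN (fun ω => θ (seqOf V ω)) (fun ω => (θ' (seqOf U ω)).2)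
        (fun ω => (θ' (seqOf U ω)).1)
      have e6 := secDist_equiv pN (fun ω => (θ (seqOf V ω), (θ' (seqOf U ω)).2))
        (fun ω => (θ' (seqOf U ω)).1)
        ((Equiv.prodAssoc (Fin (2 ^ a₁) × Fin (2 ^ s)) (Fin (2 ^ t₁)) (Fin (2 ^ t₂))).trans
          (Equiv.prodAssoc (Fin (2 ^ a₁)) (Fin (2 ^ s)) (Fin (2 ^ t₁) × Fin (2 ^ t₂))))
      have e7 := secDist_comp_le pN (fun ω => θ (seqOf V ω)) (seqOf U)
        (fun u => ((θ' u).2, (θ' u).1))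
      have e8 : (fun ω : Fin N → Ω => ((θ (seqOf V ω)).1.1, M (UV ω))) = fun ω =>
        ((Equiv.prodAssoc (Fin (2 ^ a₁) × Fin (2 ^ s)) (Fin (2 ^ t₁)) (Fin (2 ^ t₂))).trans
          (Equiv.prodAssoc (Fin (2 ^ a₁)) (Fin (2 ^ s)) (Fin (2 ^ t₁) × Fin (2 ^ t₂))))
          (θ (seqOf V ω), (θ' (seqOf U ω)).2) := rfl
      rw [← e8] at e6
      rw [e6] at e4
      have e9 : (fun ω : Fin N → Ω => F (UV ω)) =
        fun ω => ((θ (seqOf V ω)).1.1, (θ' (seqOf U ω)).1) := rfl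
      rw [e9]
      linarith)
    (by
      rw [hp, prob_distr pN]
      refine (prob_mono hPN.1 (F := fun ω =>
        dec₂ θ' (seqOf Y ω) (θ' (seqOf U ω)).1 ≠ seqOf U ω ∨
        dec₁ θ (seqOf (fun ω => (Y ω, U ω)) ω) (θ (seqOf V ω)).1.1 ≠ seqOf V ω)
        fun ω _ hne => ?_).trans ((prob_or_le hPN.1 _ _).trans (by linarith))
      by_contra! hcon
      obtain ⟨hc1, hc2⟩ := hcon
      refine hne ?_
      simp only [hF, hUV, hR, hc1]
      have : (fun i => (seqOf Y ω i, seqOf U ω i)) = seqOf (fun ω => (Y ω, U ω)) ω := rfl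
      rw [this, hc2])
    (by
      rw [hp, secDist_distr]
      -- Eve is given all of U, of which the cloud index is a function. Secrecy of the satellite
      -- part survives this, since its rate was set by H(V|Z,U).
      refine (secDist_comp_le pN (fun ω => (θ (seqOf V ω)).1.2)
        (fun ω => ((θ (seqOf V ω)).1.1, seqOf (fun ω => (Z ω, U ω)) ω))
        (fun x => ((x.1, (θ' (fun i => (x.2 i).2)).1), fun i => (x.2 i).1))).trans ?_
      linarith)
  set t : (Fin (2 ^ s) × Fin (2 ^ t₁) × Fin (2 ^ t₂)) × ((Fin N → 𝒰) × (Fin N → 𝒱)) ×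
      ((Fin N → 𝒳) × (Fin N → 𝒴) × (Fin N → 𝒵)) → ℝ :=
    fun ω => Q ω.1 * κ ω.1 ω.2.1 *
      (k ω.2.1 ω.2.2.1 * ∏ i, W (ω.2.2.1 i) (ω.2.2.2.1 i, ω.2.2.2.2 i)) with ht
  have hlaw : channelLaw W (fun i x => ∑ v, κ i v * k v x) =
      distr t (fun ω => (ω.1, ω.2.2.1, ω.2.2.2.1, ω.2.2.2.2)) := by
    funext ⟨i, x, y, z⟩
    simp only [channelLaw]
    simp only [distr, prob]
    have hs : ∀ h : (Fin (2 ^ s) × Fin (2 ^ t₁) × Fin (2 ^ t₂)) ×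
        ((Fin N → 𝒰) × (Fin N → 𝒱)) × ((Fin N → 𝒳) × (Fin N → 𝒴) × (Fin N → 𝒵)) → ℝ,
        ∑ ω, h ω = ∑ i, ∑ v, ∑ r, h (i, v, r) := by
      intro h
      rw [Fintype.sum_prod_type]
      exact Finset.sum_congr rfl fun _ _ => Fintype.sum_prod_type _
    rw [hs, Finset.sum_eq_single i, Finset.mul_sum, Finset.sum_mul]
    · refine Finset.sum_congr rfl fun v _ => ?_
      rw [Finset.sum_eq_single (x, y, z)]
      · simp only [ht, hQ, if_true]; ring
      · rintro ⟨x', y', z'⟩ _ hne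
        refine if_neg fun h => hne ?_
        simp only [Prod.mk.injEq, true_and] at h ⊢
        exact h
      · simp
    · rintro i' _ hi
      refine Finset.sum_eq_zero fun v _ => Finset.sum_eq_zero fun r _ => if_neg fun h => hi ?_
      simp only [Prod.mk.injEq] at h
      exact h.1
    · simp
  refine ⟨s, t₁, t₂, fun i x => ∑ v, κ i v * k v x, fun y => M (dec₂ θ' y f.2,
      dec₁ θ (fun i => (y i, dec₂ θ' y f.2 i)) f.1), fun i => ⟨fun x => Finset.sum_nonneg fun v _ =>
        mul_nonneg ((hκ i).1 v) ((hk1 v).1 x), ?_⟩, ?_, ?_, ?_, ?_, ?_⟩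
  · rw [Finset.sum_comm]
    simp only [← Finset.mul_sum, (hk1 _).2, mul_one, (hκ i).2]
  · have hI : mutualInfo P U Y = hUU - hUY := by rw [mutualInfo, hUUdef, condEntropy_const hP]
    have hI' : condMutualInfo P V Y U = hVU - hY := rfl
    have c1 : s + t₁ + t₂ = (T₁ - a₁) + t₂ := by omega
    have c2 : (T₂ : ℝ) - a₂ ≤ (t₂ : ℝ) := by
      have : T₂ ≤ t₂ + a₂ := by omega
      have : (T₂ : ℝ) ≤ t₂ + a₂ := by exact_mod_cast this
      linarith
    rw [c1, hI, hI', Nat.cast_add, Nat.cast_sub haT]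
    nlinarith
  · have hI' : condMutualInfo P V Y U = hVU - hY := rfl
    have hI'' : condMutualInfo P V Z U = hVU - hZ := rfl
    have c2 : (S : ℝ) - a₁ ≤ (s : ℝ) := by
      have : S ≤ s + a₁ := by omega
      have : (S : ℝ) ≤ s + a₁ := by exact_mod_cast this
      linarith
    rw [hI', hI'']
    nlinarith
  · refine le_trans ?_ hS2
    exact_mod_cast Nat.sub_le _ _
  · rw [hlaw, prob_distr t]
    exact herr.trans (by linarith)
  · rw [hlaw, secDist_distr]
    exact hsec.trans (by linarith)

end ChannelCode

/-! ### Two-round protocols and the law they induce -/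

section TwoRounds

theorem Party.other_ne (p : Party) : p.other ≠ p := by cases p <;> decide

theorem Party.other_other (p : Party) : p.other.other = p := by cases p <;> rfl

theorem Party.prod_eq (p : Party) (g : Party → ℝ) : ∏ p', g p' = g p * g p.other := by
  have h : (Finset.univ : Finset Party) = {Party.alice, Party.bob} := rfl
  rw [h, Finset.prod_pair (by decide)]
  cases p
  · rfl
  · exact mul_comm _ _

/-- The values of a function of the parties at `p` and at the other party. -/
def partyEquiv (p : Party) (α : Type*) : (Party → α) ≃ α × α where
  toFun f := (f p, f p.other)
  invFun x p' := if p' = p then x.1 else x.2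
  left_inv f := by
    funext p'
    by_cases h : p' = p
    · simp [h]
    · have : p' = p.other := by cases p <;> cases p' <;> simp_all [Party.other]
      simp [this, p.other_ne]
  right_inv x := by simp [p.other_ne]

variable {X Y Z : Party → Type*} [∀ p, Fintype (X p)] [∀ p, Fintype (Y p)] [∀ p, Fintype (Z p)]

/-- The law of a random function with independent values of laws `κ y`. -/
theorem prod_kernel_mem {α τ : Type*} [Fintype α] [DecidableEq α] [Fintype τ]
    (κ : α → stdSimplex ℝ τ) : (fun φ : α → τ => ∏ y, κ y (φ y)) ∈ stdSimplex ℝ (α → τ) := by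
  refine ⟨fun φ => Finset.prod_nonneg fun y _ => (κ y).2.1 _, ?_⟩
  rw [← Fintype.prod_sum (fun y t => κ y t)]
  exact Finset.prod_eq_one fun y _ => (κ y).2.2

/-- Private randomness is drawn before the channel output is known, so a stochastic map is realised
by a function with independent random values, fixed in advance. Only its value at `y` is used, and
the other values sum out. -/
theorem sum_prod_kernel_mul {α τ : Type*} [Fintype α] [DecidableEq α] [Fintype τ]
    (κ : α → stdSimplex ℝ τ) (y : α) (g : τ → ℝ) :
    ∑ φ : α → τ, (∏ y, κ y (φ y)) * g (φ y) = ∑ t, κ y t * g t := by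
  have h1 : ∀ φ : α → τ, (∏ y, κ y (φ y)) * g (φ y) =
      ∏ y', (κ y' (φ y') * if y' = y then g (φ y') else 1) := by
    intro φ
    rw [Finset.prod_mul_distrib, Finset.prod_ite_eq' Finset.univ y]
    simp
  simp only [h1]
  rw [← Fintype.prod_sum (fun y' t => κ y' t * if y' = y then g t else 1),
    Finset.prod_eq_single y]
  · simp
  · intro y' _ hy
    simp only [hy, if_false, mul_one]
    exact (κ y').2.2
  · simp

open scoped Classical in
/-- The law of the private randomness in a two-round protocol: the block sent in the first round, and
a random function of the block received in the first round. -/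
noncomputable def randLaw {τ : Type*} [Fintype τ] {p : Party} {n : ℕ}
    (q : stdSimplex ℝ (Fin n → X p)) (κ : (Fin n → Y p) → stdSimplex ℝ τ) :
    stdSimplex ℝ ((Fin n → X p) × ((Fin n → Y p) → τ)) :=
  ⟨fun r => q r.1 * ∏ y, κ y (r.2 y), fun r => mul_nonneg (q.2.1 _) ((prod_kernel_mem κ).1 _), by
    rw [Fintype.sum_prod_type]
    simp only [← Finset.mul_sum]
    have := (prod_kernel_mem κ).2
    simp only at this
    simp only [this, mul_one]
    exact q.2.2⟩

open scoped Classical in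
/-- The two-round protocol in which the initiator sends a random block of law `q`, the other party
generates a random variable in `τ` from the received block with the stochastic map `κ`, and
answers with a function of this variable. -/
noncomputable def twoRound {τ : Type*} [Fintype τ] (p : Party) {n m K : ℕ}
    (q : stdSimplex ℝ (Fin n → X p)) (κ : (Fin n → Y p) → stdSimplex ℝ τ)
    (inp : τ → Fin m → X p.other) (keyB : τ → Fin K)
    (keyA : (Fin n → X p) → (Fin m → Y p.other) → Fin K) : Protocol X Y where
  initiator := p
  rounds := 2
  len := ![n, m]
  -- Both parties draw independent copies of the same pair. The initiator uses only the block and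
  -- the other party only the random function, which avoids alphabets depending on the party.
  randSize _ := Fintype.card ((Fin n → X p) × ((Fin n → Y p) → τ))
  rand _ := ⟨fun j => randLaw q κ ((Fintype.equivFin _).symm j), fun _ => (randLaw q κ).2.1 _, by
    rw [(Fintype.equivFin _).symm.sum_comp (fun r => randLaw q κ r)]; exact (randLaw q κ).2.2⟩
  encode r := match r with
    | 0 => fun ρ _ => ((Fintype.equivFin ((Fin n → X p) × ((Fin n → Y p) → τ))).symm ρ).1
    | 1 => fun ρ h => inp (((Fintype.equivFin ((Fin n → X p) × ((Fin n → Y p) → τ))).symm ρ).2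
        (h 0 (by decide) (p.other_ne.symm)))
  keySize := K
  keyParty := p.other
  key p' ρ h := if hp : p' = p then
      keyA ((Fintype.equivFin ((Fin n → X p) × ((Fin n → Y p) → τ))).symm ρ).1
        (h 1 (by rw [hp]; exact p.other_ne))
    else keyB (((Fintype.equivFin ((Fin n → X p) × ((Fin n → Y p) → τ))).symm ρ).2
        (h 0 (fun h => hp h.symm)))

/-- The joint law of the blocks sent and received, and of the random variable generated by the
second party, in a two-round protocol. -/
noncomputable def twoRoundLaw {τ : Type*} [Fintype τ] (W : ∀ p, X p → stdSimplex ℝ (Y p × Z p))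
    (p : Party) {n m : ℕ} (q : stdSimplex ℝ (Fin n → X p)) (κ : (Fin n → Y p) → stdSimplex ℝ τ)
    (inp : τ → Fin m → X p.other)
    (a : (Fin n → X p) × (Fin n → Y p) × (Fin n → Z p) × τ ×
      (Fin m → Y p.other) × (Fin m → Z p.other)) : ℝ :=
  q a.1 * (∏ i, W p (a.1 i) (a.2.1 i, a.2.2.1 i)) * κ a.2.1 a.2.2.2.1 *
    ∏ i, W p.other (inp a.2.2.2.1 i) (a.2.2.2.2.1 i, a.2.2.2.2.2 i)

section

variable {τ : Type*} [Fintype τ] (W : ∀ p, X p → stdSimplex ℝ (Y p × Z p)) (p : Party) {n m K : ℕ}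
    (q : stdSimplex ℝ (Fin n → X p)) (κ : (Fin n → Y p) → stdSimplex ℝ τ)
    (inp : τ → Fin m → X p.other) (keyB : τ → Fin K)
    (keyA : (Fin n → X p) → (Fin m → Y p.other) → Fin K)

theorem twoRound_uses : (twoRound p q κ inp keyB keyA).uses = n + m := by
  change ∑ r : Fin 2, ![n, m] r = n + m
  simp

open scoped Classical in
/-- The blocks and the random variable of the second party, as functions of the outcome. -/
noncomputable def twoRoundVars (ω : (twoRound p q κ inp keyB keyA).Outcome Z) :
    (Fin n → X p) × (Fin n → Y p) × (Fin n → Z p) × τ ×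
      (Fin m → Y p.other) × (Fin m → Z p.other) :=
  let e := (Fintype.equivFin ((Fin n → X p) × ((Fin n → Y p) → τ))).symm
  let o₀ : Fin n → Y p × Z p := ω.2 (0 : Fin 2)
  let o₁ : Fin m → Y p.other × Z p.other := ω.2 (1 : Fin 2)
  ((e (ω.1 p)).1, fun i => (o₀ i).1, fun i => (o₀ i).2, (e (ω.1 p.other)).2 (fun i => (o₀ i).1),
    fun i => (o₁ i).1, fun i => (o₁ i).2)

omit [∀ p, Fintype (Z p)] in
theorem twoRound_S (ω : (twoRound p q κ inp keyB keyA).Outcome Z) :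
    (twoRound p q κ inp keyB keyA).S ω =
      keyB (twoRoundVars p q κ inp keyB keyA ω).2.2.2.1 := by
  exact dif_neg (c := p.other = p) p.other_ne

omit [∀ p, Fintype (Z p)] in
theorem twoRound_Sest (ω : (twoRound p q κ inp keyB keyA).Outcome Z) :
    (twoRound p q κ inp keyB keyA).Sest ω =
      keyA (twoRoundVars p q κ inp keyB keyA ω).1
        (twoRoundVars p q κ inp keyB keyA ω).2.2.2.2.1 := by
  have h : (twoRound p q κ inp keyB keyA).Sest ω =
      (twoRound p q κ inp keyB keyA).value p.other.other ω := rfl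
  rw [h, p.other_other]
  exact dif_pos (c := p = p) rfl

omit [∀ p, Fintype (Z p)] in
theorem twoRound_viewE (ω : (twoRound p q κ inp keyB keyA).Outcome Z) :
    (twoRound p q κ inp keyB keyA).viewE ω =
      (piFinTwoEquiv (fun r : Fin 2 => Fin (![n, m] r) → Z (sender p r))).symm
        ((twoRoundVars p q κ inp keyB keyA ω).2.2.1,
          (twoRoundVars p q κ inp keyB keyA ω).2.2.2.2.2) := by
  exact funext (Fin.forall_fin_two.mpr ⟨rfl, rfl⟩)

open scoped Classical in
theorem twoRound_mass (ω : (twoRound p q κ inp keyB keyA).Outcome Z) :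
    (twoRound p q κ inp keyB keyA).mass W ω =
      (randLaw q κ ((Fintype.equivFin _).symm (ω.1 p)) *
        randLaw q κ ((Fintype.equivFin _).symm (ω.1 p.other))) *
      ((∏ i, W p ((twoRoundVars p q κ inp keyB keyA ω).1 i)
        ((twoRoundVars p q κ inp keyB keyA ω).2.1 i,
          (twoRoundVars p q κ inp keyB keyA ω).2.2.1 i)) *
      ∏ i, W p.other (inp (twoRoundVars p q κ inp keyB keyA ω).2.2.2.1 i)
        ((twoRoundVars p q κ inp keyB keyA ω).2.2.2.2.1 i,
          (twoRoundVars p q κ inp keyB keyA ω).2.2.2.2.2 i)) := by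
  rw [Protocol.mass, Party.prod_eq p]
  congr 1
  change ∏ r : Fin 2, _ = _
  rw [Fin.prod_univ_two]
  rfl

/-- The unused half of each party's randomness has total mass one, and the random function evaluated
at the received block has law `κ`. From here on, only explicit laws are handled instead of outcomes
of the protocol. -/
theorem distr_twoRoundVars :
    distr ((twoRound p q κ inp keyB keyA).law W) (twoRoundVars p q κ inp keyB keyA) =
      twoRoundLaw W p q κ inp := by
  classical
  funext a
  have key : ∀ h : (Fin n → X p) × (Fin n → Y p) × (Fin n → Z p) × τ ×
      (Fin m → Y p.other) × (Fin m → Z p.other) → ℝ,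
      ∑ ω, (twoRound p q κ inp keyB keyA).mass W ω * h (twoRoundVars p q κ inp keyB keyA ω) =
      ∑ a, twoRoundLaw W p q κ inp a * h a := by
    intro h
    let e := (Fintype.equivFin ((Fin n → X p) × ((Fin n → Y p) → τ)))
    let E : (((Fin n → X p) × ((Fin n → Y p) → τ)) × ((Fin n → X p) × ((Fin n → Y p) → τ))) ×
        (((Fin n → Y p) × (Fin n → Z p)) × ((Fin m → Y p.other) × (Fin m → Z p.other))) ≃
        (twoRound p q κ inp keyB keyA).Outcome Z :=
      Equiv.prodCongr ((Equiv.prodCongr e e).trans (partyEquiv p _).symm)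
        ((Equiv.prodCongr (Equiv.arrowProdEquivProdArrow (Fin n) (fun _ => Y p) (fun _ => Z p)).symm
          (Equiv.arrowProdEquivProdArrow (Fin m) (fun _ => Y p.other) (fun _ => Z p.other)).symm).trans
          (piFinTwoEquiv (fun r : Fin 2 => Fin (![n, m] r) →
            Y (sender p r) × Z (sender p r))).symm)
    have hV : ∀ x₁ φ₁ x₂ φ₂ y z y' z', twoRoundVars p q κ inp keyB keyA
        (E (((x₁, φ₁), (x₂, φ₂)), ((y, z), (y', z')))) = (x₁, y, z, φ₂ y, y', z') := by
      intro x₁ φ₁ x₂ φ₂ y z y' z'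
      have h1 : (E (((x₁, φ₁), (x₂, φ₂)), ((y, z), (y', z')))).1 p = e (x₁, φ₁) := if_pos rfl
      have h2 : (E (((x₁, φ₁), (x₂, φ₂)), ((y, z), (y', z')))).1 p.other = e (x₂, φ₂) :=
        if_neg p.other_ne
      have h3 : twoRoundVars p q κ inp keyB keyA
        (E (((x₁, φ₁), (x₂, φ₂)), ((y, z), (y', z')))) =
        ((e.symm ((E (((x₁, φ₁), (x₂, φ₂)), ((y, z), (y', z')))).1 p)).1, y, z,
          (e.symm ((E (((x₁, φ₁), (x₂, φ₂)), ((y, z), (y', z')))).1 p.other)).2 y, y', z') := rfl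
      rw [h3, h1, h2, e.symm_apply_apply, e.symm_apply_apply]
    have hmass : ∀ x₁ φ₁ x₂ φ₂ y z y' z', (twoRound p q κ inp keyB keyA).mass W
        (E (((x₁, φ₁), (x₂, φ₂)), ((y, z), (y', z')))) =
        (randLaw q κ (x₁, φ₁) * randLaw q κ (x₂, φ₂)) *
          ((∏ i, W p (x₁ i) (y i, z i)) * ∏ i, W p.other (inp (φ₂ y) i) (y' i, z' i)) := by
      intro x₁ φ₁ x₂ φ₂ y z y' z'
      have h1 : (E (((x₁, φ₁), (x₂, φ₂)), ((y, z), (y', z')))).1 p = e (x₁, φ₁) := if_pos rfl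
      have h2 : (E (((x₁, φ₁), (x₂, φ₂)), ((y, z), (y', z')))).1 p.other = e (x₂, φ₂) :=
        if_neg p.other_ne
      rw [twoRound_mass, hV, h1, h2]
      simp only [e, Equiv.symm_apply_apply]
    rw [← E.sum_comp]
    simp only [Fintype.sum_prod_type, hV, hmass]
    have hq : ∑ x, q x = 1 := q.2.2
    have hφ : ∑ φ : (Fin n → Y p) → τ, ∏ y, κ y (φ y) = 1 := (prod_kernel_mem κ).2
    refine Finset.sum_congr rfl fun x₁ _ => ?_
    calc ∑ φ₁, ∑ x₂, ∑ φ₂, ∑ y, ∑ z, ∑ y', ∑ z',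
          (randLaw q κ (x₁, φ₁) * randLaw q κ (x₂, φ₂)) *
          ((∏ i, W p (x₁ i) (y i, z i)) * ∏ i, W p.other (inp (φ₂ y) i) (y' i, z' i)) *
          h (x₁, y, z, φ₂ y, y', z')
        = ∑ φ₁ : (Fin n → Y p) → τ, (∏ y, κ y (φ₁ y)) * ∑ x₂, (q x₂ *
          ∑ φ₂ : (Fin n → Y p) → τ, ∑ y, (∏ y, κ y (φ₂ y)) * ∑ z, ∑ y', ∑ z',
          q x₁ * ((∏ i, W p (x₁ i) (y i, z i)) *
            ∏ i, W p.other (inp (φ₂ y) i) (y' i, z' i)) * h (x₁, y, z, φ₂ y, y', z')) := by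
          simp only [Finset.mul_sum]
          refine Finset.sum_congr rfl fun φ₁ _ => Finset.sum_congr rfl fun x₂ _ =>
            Finset.sum_congr rfl fun φ₂ _ => Finset.sum_congr rfl fun y _ =>
            Finset.sum_congr rfl fun z _ => Finset.sum_congr rfl fun y' _ =>
            Finset.sum_congr rfl fun z' _ => ?_
          change q x₁ * (∏ y, κ y (φ₁ y)) * (q x₂ * ∏ y, κ y (φ₂ y)) * _ * _ = _
          ring
      _ = ∑ y, ∑ t, κ y t * ∑ z, ∑ y', ∑ z', q x₁ * ((∏ i, W p (x₁ i) (y i, z i)) *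
            ∏ i, W p.other (inp t i) (y' i, z' i)) * h (x₁, y, z, t, y', z') := by
          rw [← Finset.sum_mul, hφ, ← Finset.sum_mul, hq, one_mul, one_mul, Finset.sum_comm]
          exact Finset.sum_congr rfl fun y _ => sum_prod_kernel_mul κ y (fun t =>
            ∑ z, ∑ y', ∑ z', q x₁ * ((∏ i, W p (x₁ i) (y i, z i)) *
            ∏ i, W p.other (inp t i) (y' i, z' i)) * h (x₁, y, z, t, y', z'))
      _ = _ := by
          refine Finset.sum_congr rfl fun y _ => ?_
          simp only [Finset.mul_sum]
          rw [Finset.sum_comm]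
          refine Finset.sum_congr rfl fun z _ => Finset.sum_congr rfl fun t _ =>
            Finset.sum_congr rfl fun y' _ => Finset.sum_congr rfl fun z' _ => ?_
          simp only [twoRoundLaw]
          ring
  -- Testing the equality of expectations against indicators gives the equality of laws.
  have h1 := key (fun b => if b = a then 1 else 0)
  simp only [mul_ite, mul_one, mul_zero, Finset.sum_ite_eq', Finset.mem_univ, if_true] at h1
  rw [← h1]
  simp only [distr, prob]
  exact Finset.sum_congr rfl fun ω _ => by
    by_cases h : twoRoundVars p q κ inp keyB keyA ω = a
    · simp only [h, if_true]; rfl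
    · simp only [h, if_false]

end

end TwoRounds

/-! ### Feeding the source message into the channel code -/

section Composition

variable {Ω₁ 𝒢 𝒦 ρ μ Ξ ζ ζ' ς : Type*} [Fintype Ω₁] [Fintype 𝒢] [Fintype 𝒦] [Fintype ρ] [Fintype μ]
  [Fintype Ξ] [Fintype ζ] [Fintype ζ'] [Fintype ς]

/-- The law of a source `σ` and of a channel code `ch` whose message is made of the variable `g` of
the source and of an independent uniform variable in `ρ`. -/
noncomputable def composedLaw (σ : Ω₁ → ℝ) (g : Ω₁ → 𝒢) (e : 𝒢 × ρ ≃ μ) (ch : μ × Ξ → ℝ)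
    (ω : Ω₁ × ρ × Ξ) : ℝ :=
  Fintype.card 𝒢 * σ ω.1 * ch (e (g ω.1, ω.2.1), ω.2.2)

variable {σ : Ω₁ → ℝ} (hσ : σ ∈ stdSimplex ℝ Ω₁) (g : Ω₁ → 𝒢) (k : Ω₁ → 𝒦) (z : Ω₁ → ζ)
  (e : 𝒢 × ρ ≃ μ) {ch : μ × Ξ → ℝ} (hch : ∀ c, 0 ≤ ch c)
  (hch1 : ∀ M, ∑ ξ, ch (M, ξ) = 1 / Fintype.card μ)

-- Given a message, `ch` has total mass `1 / card μ`. Replacing its uniform message by the source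
-- message and a uniform complement multiplies by `card μ / card ρ`, the factor `card 𝒢` of
-- `composedLaw`; so the source marginal is `σ`.
include hch1 in
theorem prob_composedLaw_source [Nonempty μ] (E : Ω₁ → Prop) :
    prob (composedLaw σ g e ch) (fun ω => E ω.1) = prob σ E := by
  classical
  have hμ : (Fintype.card 𝒢 : ℝ) * Fintype.card ρ = Fintype.card μ := by
    rw [← Fintype.card_congr e, Fintype.card_prod]; push_cast; rfl
  have h0 : (Fintype.card μ : ℝ) ≠ 0 := by exact_mod_cast Fintype.card_ne_zero
  rw [← hμ] at h0
  simp only [prob, Fintype.sum_prod_type, composedLaw]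
  refine Finset.sum_congr rfl fun ω _ => ?_
  split_ifs
  · simp only [← Finset.mul_sum, hch1, ← hμ, Finset.sum_const, Finset.card_univ, nsmul_eq_mul]
    field_simp [left_ne_zero_of_mul h0, right_ne_zero_of_mul h0]
  · simp

omit [Fintype 𝒦] [Fintype μ] [Fintype ζ] in
theorem distr_composedLaw (z₀ : ζ) (k₀ : 𝒦) (M : μ) (ξ₀ : Ξ) :
    distr (composedLaw σ g e ch)
      (fun ω => (z ω.1, k ω.1, (e (g ω.1, ω.2.1), ω.2.2))) (z₀, k₀, (M, ξ₀)) =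
    Fintype.card 𝒢 * distr σ (fun ω => ((g ω, k ω), z ω)) (((e.symm M).1, k₀), z₀) *
      ch (M, ξ₀) := by
  classical
  obtain ⟨⟨g₀, r₀⟩, rfl⟩ := e.surjective M
  simp only [distr, prob, Finset.mul_sum, Finset.sum_mul, Equiv.symm_apply_apply]
  rw [Fintype.sum_prod_type]
  refine Finset.sum_congr rfl fun ω _ => ?_
  rw [Fintype.sum_prod_type, Finset.sum_eq_single r₀, Finset.sum_eq_single ξ₀]
  · simp only [Prod.mk.injEq, e.injective.eq_iff, and_true, composedLaw]
    by_cases h1 : z ω = z₀ <;> by_cases h2 : k ω = k₀ <;> by_cases h3 : g ω = g₀ <;>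
      simp [h1, h2, h3]
  · intro ξ _ hξ; simp [hξ]
  · simp
  · intro r _ hr
    refine Finset.sum_eq_zero fun ξ _ => if_neg fun h => hr ?_
    simp only [Prod.mk.injEq, e.injective.eq_iff] at h
    exact h.2.2.1.2
  · simp

-- The composed and the ideal laws contain the same channel factor, which sums out. Their distance
-- is therefore exactly that of the source from uniform and independent of Eve.
include hch hch1 in
theorem sum_abs_composedLaw_sub [Nonempty μ] :
    ∑ a, |distr (composedLaw σ g e ch) (fun ω => (z ω.1, k ω.1, (e (g ω.1, ω.2.1), ω.2.2))) a -
      distr σ z a.1 / Fintype.card 𝒦 * ch a.2.2| =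
    secDist σ (fun ω => (g ω, k ω)) z := by
  have hμ : (Fintype.card 𝒢 : ℝ) * Fintype.card ρ = Fintype.card μ := by
    rw [← Fintype.card_congr e, Fintype.card_prod]; push_cast; rfl
  have h0 : (Fintype.card μ : ℝ) ≠ 0 := by exact_mod_cast Fintype.card_ne_zero
  rw [← hμ] at h0
  have hG := left_ne_zero_of_mul h0
  have hR := right_ne_zero_of_mul h0
  have h1 : ∀ z₀ k₀ M ξ₀, |distr (composedLaw σ g e ch)
        (fun ω => (z ω.1, k ω.1, (e (g ω.1, ω.2.1), ω.2.2))) (z₀, k₀, (M, ξ₀)) -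
        distr σ z z₀ / Fintype.card 𝒦 * ch (M, ξ₀)| =
      Fintype.card 𝒢 * |distr σ (fun ω => ((g ω, k ω), z ω)) (((e.symm M).1, k₀), z₀) -
        distr σ z z₀ / Fintype.card (𝒢 × 𝒦)| * ch (M, ξ₀) := by
    intro z₀ k₀ M ξ₀
    rw [distr_composedLaw, Fintype.card_prod]
    have : (Fintype.card 𝒢 : ℝ) * distr σ (fun ω => ((g ω, k ω), z ω)) (((e.symm M).1, k₀), z₀) *
        ch (M, ξ₀) - distr σ z z₀ / Fintype.card 𝒦 * ch (M, ξ₀) =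
        Fintype.card 𝒢 * (distr σ (fun ω => ((g ω, k ω), z ω)) (((e.symm M).1, k₀), z₀) -
        distr σ z z₀ / ((Fintype.card 𝒢 * Fintype.card 𝒦 : ℕ) : ℝ)) * ch (M, ξ₀) := by
      push_cast
      rw [mul_sub, mul_div_assoc', mul_div_mul_left _ _ hG]
      ring
    rw [this, abs_mul, abs_mul, abs_of_nonneg (hch _), Nat.abs_cast]
  simp only [Fintype.sum_prod_type, h1, ← Finset.mul_sum, hch1, secDist]
  refine Finset.sum_congr rfl fun z₀ _ => ?_
  rw [Finset.sum_comm, ← e.sum_comp, Fintype.sum_prod_type]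
  refine Finset.sum_congr rfl fun g₀ _ => ?_
  simp only [Equiv.symm_apply_apply]
  rw [Finset.sum_const, Finset.card_univ, nsmul_eq_mul, Finset.mul_sum]
  refine Finset.sum_congr rfl fun k₀ _ => ?_
  rw [← hμ]
  field_simp

/-- The law of independent variables of laws `distr σ z` on `ζ`, uniform on `𝒦`, and `ch`. -/
noncomputable def idealLaw (𝒦 : Type*) [Fintype 𝒦] (w : ζ → ℝ) (ch : μ × Ξ → ℝ)
    (a : ζ × 𝒦 × (μ × Ξ)) : ℝ :=
  w a.1 / Fintype.card 𝒦 * ch a.2.2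

theorem prob_idealLaw [Nonempty 𝒦] {w : ζ → ℝ} (hw : ∑ a, w a = 1) (ch : μ × Ξ → ℝ)
    (E : μ × Ξ → Prop) : prob (idealLaw 𝒦 w ch) (fun a => E a.2.2) = prob ch E := by
  classical
  have hK : (Fintype.card 𝒦 : ℝ) ≠ 0 := by exact_mod_cast Fintype.card_ne_zero
  simp only [prob, idealLaw]
  rw [Fintype.sum_prod_type]
  have h2 : ∀ z₀, ∑ x : 𝒦 × (μ × Ξ), (if E x.2 then w z₀ / Fintype.card 𝒦 * ch x.2 else 0) =
      w z₀ * ∑ c, if E c then ch c else 0 := by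
    intro z₀
    rw [Fintype.sum_prod_type]
    have h3 : ∀ c : μ × Ξ, (if E c then w z₀ / Fintype.card 𝒦 * ch c else 0) =
        w z₀ / Fintype.card 𝒦 * if E c then ch c else 0 := by
      intro c; split_ifs <;> simp
    simp only [h3]
    rw [Finset.sum_congr rfl fun _ _ => (Finset.mul_sum _ _ _).symm, Finset.sum_const,
      Finset.card_univ, nsmul_eq_mul]
    field_simp
  rw [Finset.sum_congr rfl fun z₀ _ => h2 z₀, ← Finset.sum_mul, hw, one_mul]

theorem distr_idealLaw {α β : Type*} (w : ζ → ℝ) (ch : μ × Ξ → ℝ) (s : μ → α) (z' : Ξ → β)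
    (k₀ : 𝒦) (s₀ : α) (z₀ : ζ) (z₀' : β) :
    distr (idealLaw 𝒦 w ch) (fun a => ((a.2.1, s a.2.2.1), (a.1, z' a.2.2.2)))
      ((k₀, s₀), (z₀, z₀')) =
      w z₀ / Fintype.card 𝒦 * distr ch (fun c => (s c.1, z' c.2)) (s₀, z₀') := by
  classical
  simp only [distr, prob, idealLaw]
  rw [Fintype.sum_prod_type, Finset.sum_eq_single z₀, Fintype.sum_prod_type,
    Finset.sum_eq_single k₀, Finset.mul_sum]
  · refine Finset.sum_congr rfl fun c _ => ?_
    by_cases h1 : s c.1 = s₀ <;> by_cases h2 : z' c.2 = z₀' <;> simp [h1, h2]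
  · intro k' _ hk; simp [hk]
  · simp
  · intro x _ hx; simp [hx]
  · simp

/-- The first-round key is uniform and independent of everything else, and the first-round
observation is independent of the channel code; neither changes the distance. -/
theorem secDist_idealLaw [Nonempty 𝒦] {w : ζ → ℝ} (hw : w ∈ stdSimplex ℝ ζ) (ch : μ × Ξ → ℝ)
    (s : μ → ς) (z' : Ξ → ζ') :
    secDist (idealLaw 𝒦 w ch) (fun a => (a.2.1, s a.2.2.1)) (fun a => (a.1, z' a.2.2.2)) =
      secDist ch (fun c => s c.1) (fun c => z' c.2) := by
  classical
  have hK : (Fintype.card 𝒦 : ℝ) ≠ 0 := by exact_mod_cast Fintype.card_ne_zero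
  have d2 : ∀ z₀ z₀', distr (idealLaw 𝒦 w ch) (fun a => (a.1, z' a.2.2.2)) (z₀, z₀') =
      w z₀ * distr ch (fun c => z' c.2) z₀' := by
    intro z₀ z₀'
    have h1 := sum_distr_fst (idealLaw 𝒦 w ch) (fun a => (a.2.1, ()))
      (fun a => (a.1, z' a.2.2.2)) (z₀, z₀')
    rw [← h1, Fintype.sum_prod_type]
    have h2 : ∀ k₀ : 𝒦, ∀ u : Unit, distr (idealLaw 𝒦 w ch)
        (fun a => ((a.2.1, ()), (a.1, z' a.2.2.2))) ((k₀, u), (z₀, z₀')) =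
        w z₀ / Fintype.card 𝒦 * distr ch (fun c => z' c.2) z₀' := by
      intro k₀ u
      rw [distr_idealLaw w ch (fun _ => ()) z']
      congr 1
      exact distr_congr _ fun ω => by simp
    simp only [h2, Finset.sum_const, Finset.card_univ, nsmul_eq_mul]
    simp only [Fintype.card_unit, Nat.cast_one, one_mul]
    field_simp
  simp only [secDist, Fintype.sum_prod_type, distr_idealLaw, d2]
  have h3 : ∀ z₀ z₀' s₀, |w z₀ / Fintype.card 𝒦 *
        distr ch (fun c => (s c.1, z' c.2)) (s₀, z₀') -
      w z₀ * distr ch (fun c => z' c.2) z₀' / Fintype.card (𝒦 × ς)| =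
      w z₀ * (|distr ch (fun c => (s c.1, z' c.2)) (s₀, z₀') -
        distr ch (fun c => z' c.2) z₀' / Fintype.card ς| / Fintype.card 𝒦) := by
    intro z₀ z₀' s₀
    have : w z₀ / Fintype.card 𝒦 * distr ch (fun c => (s c.1, z' c.2)) (s₀, z₀') -
      w z₀ * distr ch (fun c => z' c.2) z₀' / Fintype.card (𝒦 × ς) =
      w z₀ * ((distr ch (fun c => (s c.1, z' c.2)) (s₀, z₀') -
        distr ch (fun c => z' c.2) z₀' / Fintype.card ς) / Fintype.card 𝒦) := by
      rw [Fintype.card_prod]; push_cast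
      rw [sub_div, div_div, mul_comm (Fintype.card ς : ℝ)]
      ring
    rw [this, abs_mul, abs_of_nonneg (hw.1 _), abs_div, Nat.abs_cast]
  simp only [h3, ← Finset.mul_sum, Finset.sum_const, Finset.card_univ, nsmul_eq_mul]
  rw [← Finset.sum_mul, hw.2, one_mul]
  simp only [← Finset.sum_div]
  field_simp

-- The channel code is reliable for a uniform message; the source message is only nearly uniform,
-- and the L¹ distance bounds the loss.
include hσ hch hch1 in
theorem prob_composedLaw_channel [Nonempty μ] [Nonempty 𝒦] (E : μ × Ξ → Prop) :
    prob (composedLaw σ g e ch) (fun ω => E (e (g ω.1, ω.2.1), ω.2.2)) ≤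
      prob ch E + secDist σ (fun ω => (g ω, k ω)) z := by
  have h0 := prob_distr (composedLaw σ g e ch)
    (fun ω => (z ω.1, k ω.1, (e (g ω.1, ω.2.1), ω.2.2))) (fun a => E a.2.2)
  have h1 := prob_le_add (distr (composedLaw σ g e ch)
    (fun ω => (z ω.1, k ω.1, (e (g ω.1, ω.2.1), ω.2.2)))) (idealLaw 𝒦 (distr σ z) ch)
    (fun a => E a.2.2)
  have h2 := sum_abs_composedLaw_sub (σ := σ) g k z e hch hch1
  rw [prob_idealLaw (distr_mem hσ z).2] at h1
  calc _ = _ := h0.symm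
    _ ≤ _ := h1
    _ = _ := congrArg (prob ch E + ·) h2

-- In the ideal law only the channel code leaks. Passing to the true law costs twice the L¹
-- distance, by `secDist_le_add`.
include hσ hch hch1 in
theorem secDist_composedLaw [Nonempty μ] [Nonempty 𝒦] (s : μ → ς) (z' : Ξ → ζ') :
    secDist (composedLaw σ g e ch) (fun ω => (k ω.1, s (e (g ω.1, ω.2.1))))
      (fun ω => (z ω.1, z' ω.2.2)) ≤
    secDist ch (fun c => s c.1) (fun c => z' c.2) + 2 * secDist σ (fun ω => (g ω, k ω)) z := by
  have h0 := secDist_distr (composedLaw σ g e ch)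
    (fun ω => (z ω.1, k ω.1, (e (g ω.1, ω.2.1), ω.2.2))) (fun a => (a.2.1, s a.2.2.1))
    (fun a => (a.1, z' a.2.2.2))
  have h1 := secDist_le_add (distr (composedLaw σ g e ch)
    (fun ω => (z ω.1, k ω.1, (e (g ω.1, ω.2.1), ω.2.2)))) (idealLaw 𝒦 (distr σ z) ch)
    (fun a => (a.2.1, s a.2.2.1)) (fun a => (a.1, z' a.2.2.2))
  have h2 := sum_abs_composedLaw_sub (σ := σ) g k z e hch hch1
  rw [secDist_idealLaw (distr_mem hσ z)] at h1
  calc _ = _ := h0.symm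
    _ ≤ _ := h1
    _ = _ := congrArg (fun t => secDist ch (fun c => s c.1) (fun c => z' c.2) + 2 * t) h2

end Composition

theorem distr_comp_equiv_self {α β : Type*} [Fintype α] [Fintype β] (P : β → ℝ) (e : α ≃ β) :
    distr (fun a => P (e a)) e = P := by
  classical
  funext b
  simp only [distr, prob]
  rw [Finset.sum_eq_single (e.symm b)]
  · simp
  · intro a _ ha
    refine if_neg fun h => ha ?_
    rw [← h, e.symm_apply_apply]
  · simp

/-! ### From L¹ secrecy to the entropy conditions -/

section Criterion

variable {X Y Z : Party → Type*} [∀ p, Fintype (X p)] [∀ p, Fintype (Y p)] [∀ p, Fintype (Z p)]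

/-- Everything follows from (1 - 2η) log K - 1 ≤ H(S|View) ≤ H(S) ≤ log K, the first inequality
being `le_condEntropy`. The three numerical hypotheses compare its left side with what rate,
uniformity and secrecy demand. -/
theorem twoRound_isSecure {τ : Type*} [Fintype τ] (W : ∀ p, X p → stdSimplex ℝ (Y p × Z p))
    (p : Party) {n m K : ℕ} (q : stdSimplex ℝ (Fin n → X p)) (κ : (Fin n → Y p) → stdSimplex ℝ τ)
    (inp : τ → Fin m → X p.other) (keyB : τ → Fin K)
    (keyA : (Fin n → X p) → (Fin m → Y p.other) → Fin K) {R δ η : ℝ} (hδ : δ ≤ 1) (hnm : 0 < n + m)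
    (hK : 1 ≤ K)
    (hrate : (n + m : ℕ) * (R - δ) < (1 - 2 * η) * Real.logb 2 K - 1)
    (hunif : Real.logb 2 K - (n + m : ℕ) * δ < (1 - 2 * η) * Real.logb 2 K - 1)
    (hsecret : (1 - δ) * Real.logb 2 K < (1 - 2 * η) * Real.logb 2 K - 1)
    (herr : prob (twoRoundLaw W p q κ inp) (fun a => keyA a.1 a.2.2.2.2.1 ≠ keyB a.2.2.2.1) < δ)
    (hsec : secDist (twoRoundLaw W p q κ inp) (fun a => keyB a.2.2.2.1)
      (fun a => (a.2.2.1, a.2.2.2.2.2)) ≤ η) :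
    (twoRound p q κ inp keyB keyA).IsSecure W R δ := by
  set 𝔭 := twoRound p q κ inp keyB keyA with h𝔭
  have hlaw := distr_twoRoundVars W p q κ inp keyB keyA
  have hS : 𝔭.S (Z := Z) = fun ω => keyB (twoRoundVars p q κ inp keyB keyA ω).2.2.2.1 :=
    funext (twoRound_S p q κ inp keyB keyA)
  have hSest : 𝔭.Sest (Z := Z) = fun ω => keyA (twoRoundVars p q κ inp keyB keyA ω).1
        (twoRoundVars p q κ inp keyB keyA ω).2.2.2.2.1 :=
    funext (twoRound_Sest p q κ inp keyB keyA)
  have hview : secDist (𝔭.law W) 𝔭.S 𝔭.viewE ≤ η := by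
    have h1 := secDist_comp_le (𝔭.law W : 𝔭.Outcome Z → ℝ) (𝔭.S (Z := Z))
      (fun ω => ((twoRoundVars p q κ inp keyB keyA ω).2.2.1,
        (twoRoundVars p q κ inp keyB keyA ω).2.2.2.2.2))
      (piFinTwoEquiv (fun r : Fin 2 => Fin (![n, m] r) → Z (sender p r))).symm
    have h2 : 𝔭.viewE (Z := Z) = fun ω =>
        (piFinTwoEquiv (fun r : Fin 2 => Fin (![n, m] r) → Z (sender p r))).symm
        ((twoRoundVars p q κ inp keyB keyA ω).2.2.1,
          (twoRoundVars p q κ inp keyB keyA ω).2.2.2.2.2) :=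
      funext (twoRound_viewE p q κ inp keyB keyA)
    rw [← hlaw, secDist_distr] at hsec
    rw [h2]
    refine h1.trans ?_
    rw [hS]
    exact hsec
  have hmem : ⇑(𝔭.law W) ∈ stdSimplex ℝ (𝔭.Outcome Z) := (𝔭.law W).2
  have hL : 0 ≤ Real.logb 2 K := Real.logb_nonneg one_lt_two (by exact_mod_cast hK)
  have hcond : (1 - 2 * η) * Real.logb 2 K - 1 ≤ condEntropy (𝔭.law W) 𝔭.S 𝔭.viewE := by
    refine le_trans ?_ (le_condEntropy hmem 𝔭.S 𝔭.viewE)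
    have : (Fintype.card (Fin 𝔭.keySize) : ℝ) = K := by
      rw [Fintype.card_fin]; rfl
    rw [this]
    have := mul_le_mul_of_nonneg_right hview hL
    linarith
  have hH : condEntropy (𝔭.law W) 𝔭.S 𝔭.viewE ≤ entropy (𝔭.law W) 𝔭.S :=
    condEntropy_le_entropy hmem _ _
  have hHL : entropy (𝔭.law W) 𝔭.S ≤ Real.logb 2 K := by
    have := entropy_le_logb_card hmem 𝔭.S
    rw [Fintype.card_fin] at this
    exact this
  have huses : 𝔭.uses = n + m := twoRound_uses p q κ inp keyB keyA
  have hu : (0 : ℝ) < (n + m : ℕ) := by exact_mod_cast hnm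
  -- The secrecy condition divides by H(S), so positivity is essential; it comes out of `hsecret`.
  have hHpos : 0 < entropy (𝔭.law W) 𝔭.S := by
    have : 0 ≤ (1 - δ) * Real.logb 2 K := mul_nonneg (by linarith) hL
    linarith
  refine ⟨by rw [huses]; exact hnm, ?_, ?_, ?_, ?_⟩
  · rw [huses, lt_div_iff₀ hu]
    linarith
  · rw [huses]
    have : (𝔭.keySize : ℝ) = K := rfl
    rw [this, lt_div_iff₀ hu, sub_mul, div_mul_cancel₀ _ hu.ne']
    linarith
  · rw [hS, hSest]
    rw [← hlaw, prob_distr] at herr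
    exact herr
  · rw [lt_div_iff₀ hHpos]
    have : (1 - δ) * entropy (𝔭.law W) 𝔭.S ≤ (1 - δ) * Real.logb 2 K :=
      mul_le_mul_of_nonneg_left hHL (by linarith)
    linarith

end Criterion

/-! ### The protocol built from a source code and a channel code -/

section SourceChannel

variable {X Y Z : Party → Type*} [∀ p, Fintype (X p)] [∀ p, Fintype (Y p)] [∀ p, Fintype (Z p)]

/-- The law of a random block `x` sent over the channel, of the two received blocks, and of the random
variable generated from the legitimate one. -/
noncomputable def blockLaw {𝒳 𝒴 𝒵 τ : Type*} [Fintype 𝒴] [Fintype 𝒵]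
    (W : 𝒳 → stdSimplex ℝ (𝒴 × 𝒵)) {n : ℕ} (q : (Fin n → 𝒳) → ℝ) (κ : (Fin n → 𝒴) → τ → ℝ)
    (ω : (Fin n → 𝒳) × (Fin n → 𝒴) × (Fin n → 𝒵) × τ) : ℝ :=
  q ω.1 * (∏ i, W (ω.1 i) (ω.2.1 i, ω.2.2.1 i)) * κ ω.2.1 ω.2.2.2

theorem blockLaw_mem {𝒳 𝒴 𝒵 τ : Type*} [Fintype 𝒳] [Fintype 𝒴] [Fintype 𝒵] [Fintype τ]
    (W : 𝒳 → stdSimplex ℝ (𝒴 × 𝒵)) {n : ℕ} {q : (Fin n → 𝒳) → ℝ} {κ : (Fin n → 𝒴) → τ → ℝ}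
    (hq : q ∈ stdSimplex ℝ (Fin n → 𝒳)) (hκ : ∀ y, κ y ∈ stdSimplex ℝ τ) :
    blockLaw W q κ ∈ stdSimplex ℝ ((Fin n → 𝒳) × (Fin n → 𝒴) × (Fin n → 𝒵) × τ) := by
  refine ⟨fun ω => mul_nonneg (mul_nonneg (hq.1 _)
    (Finset.prod_nonneg fun i _ => (W _).2.1 _)) ((hκ _).1 _), ?_⟩
  simp only [blockLaw, Fintype.sum_prod_type, ← Finset.mul_sum, (hκ _).2, mul_one,
    sum_sum_prod_channel]
  exact hq.2

theorem sum_channelLaw {𝒳 𝒴 𝒵 μ : Type*} [Fintype 𝒳] [Fintype 𝒴] [Fintype 𝒵] [Fintype μ]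
    (W : 𝒳 → stdSimplex ℝ (𝒴 × 𝒵)) {n : ℕ} {enc : μ → (Fin n → 𝒳) → ℝ}
    (h : ∀ M, enc M ∈ stdSimplex ℝ (Fin n → 𝒳)) (M : μ) :
    ∑ ξ : (Fin n → 𝒳) × (Fin n → 𝒴) × (Fin n → 𝒵), channelLaw W enc (M, ξ) =
      1 / Fintype.card μ := by
  simp only [channelLaw, Fintype.sum_prod_type, ← Finset.mul_sum, sum_sum_prod_channel, mul_one,
    (h M).2]

theorem channelLaw_nonneg {𝒳 𝒴 𝒵 μ : Type*} [Fintype 𝒳] [Fintype 𝒴] [Fintype 𝒵] [Fintype μ]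
    (W : 𝒳 → stdSimplex ℝ (𝒴 × 𝒵)) {n : ℕ} {enc : μ → (Fin n → 𝒳) → ℝ}
    (h : ∀ M, enc M ∈ stdSimplex ℝ (Fin n → 𝒳))
    (ω : μ × (Fin n → 𝒳) × (Fin n → 𝒴) × (Fin n → 𝒵)) : 0 ≤ channelLaw W enc ω :=
  mul_nonneg (mul_nonneg (by positivity) ((h _).1 _)) (Finset.prod_nonneg fun i _ => (W _).2.1 _)

/-- The random variable generated by the second party: the values of the source code, a uniform
complement of the message, and the codeword. -/
theorem prod_code_kernel_mem {𝒢 𝒦 ρ μ ξ : Type*} [Fintype 𝒢] [Fintype 𝒦] [Fintype ρ] [Nonempty ρ]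
    [Fintype ξ] (e : 𝒢 × ρ ≃ μ) {κ : 𝒢 × 𝒦 → ℝ} (hκ : κ ∈ stdSimplex ℝ (𝒢 × 𝒦)) {enc : μ → ξ → ℝ}
    (henc : ∀ M, enc M ∈ stdSimplex ℝ ξ) :
    (fun t : (𝒢 × 𝒦) × ρ × ξ => κ t.1 * (1 / Fintype.card ρ) * enc (e (t.1.1, t.2.1)) t.2.2) ∈
      stdSimplex ℝ ((𝒢 × 𝒦) × ρ × ξ) := by
  have hρ : (Fintype.card ρ : ℝ) ≠ 0 := by exact_mod_cast Fintype.card_ne_zero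
  refine ⟨fun t => mul_nonneg (mul_nonneg (hκ.1 _) (by positivity)) ((henc _).1 _), ?_⟩
  rw [Fintype.sum_prod_type]
  refine Eq.trans (Finset.sum_congr rfl fun gk _ => ?_) hκ.2
  rw [Fintype.sum_prod_type]
  simp only [← Finset.mul_sum, (henc _).2, mul_one, Finset.sum_const, Finset.card_univ,
    nsmul_eq_mul]
  field_simp

/-- Reassociation of the variables of a two-round protocol. -/
def reassoc (x y z gk ρ x' y' z' : Type*) :
    x × y × z × (gk × ρ × x') × y' × z' ≃ (x × y × z × gk) × ρ × (x' × y' × z') where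
  toFun a := ((a.1, a.2.1, a.2.2.1, a.2.2.2.1.1), a.2.2.2.1.2.1,
    (a.2.2.2.1.2.2, a.2.2.2.2.1, a.2.2.2.2.2))
  invFun a := (a.1.1, a.1.2.1, a.1.2.2.1, (a.1.2.2.2, a.2.1, a.2.2.1), a.2.2.2.1, a.2.2.2.2)
  left_inv _ := rfl
  right_inv _ := rfl

/-- The source message, padded with uniform bits, is identified with the channel message by an
arbitrary bijection; the key joins the source key and the secret part of the channel message. That
part may contain bits of the source message: this is harmless, as these are nearly uniform and
independent of the source key and of Eve's first block. The error 3η is η for the source decoder, η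
for the channel decoder and η for the non-uniform message. The secrecy distance 3η is η + 2η, and
`le_condEntropy` doubles it. -/
theorem exists_twoRound_of_codes (W : ∀ p, X p → stdSimplex ℝ (Y p × Z p)) (p : Party)
    {n m b c s t₁ t₂ : ℕ} {q : (Fin n → X p) → ℝ} (hq : q ∈ stdSimplex ℝ (Fin n → X p))
    {κ : (Fin n → Y p) → Fin (2 ^ b) × Fin (2 ^ c) → ℝ}
    (hκ : ∀ y, κ y ∈ stdSimplex ℝ (Fin (2 ^ b) × Fin (2 ^ c)))
    (dec₁ : (Fin n → X p) → Fin (2 ^ b) → Fin (2 ^ c))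
    {enc : Fin (2 ^ s) × Fin (2 ^ t₁) × Fin (2 ^ t₂) → (Fin m → X p.other) → ℝ}
    (henc : ∀ M, enc M ∈ stdSimplex ℝ (Fin m → X p.other))
    (dec₂ : (Fin m → Y p.other) → Fin (2 ^ s) × Fin (2 ^ t₁) × Fin (2 ^ t₂))
    (hb : b ≤ s + t₁ + t₂) {η : ℝ}
    (herr₁ : prob (blockLaw (W p) q κ) (fun ω => dec₁ ω.1 ω.2.2.2.1 ≠ ω.2.2.2.2) ≤ η)
    (hsec₁ : secDist (blockLaw (W p) q κ) (fun ω => ω.2.2.2) (fun ω => ω.2.2.1) ≤ η)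
    (herr₂ : prob (channelLaw (W p.other) enc) (fun ω => dec₂ ω.2.2.1 ≠ ω.1) ≤ η)
    (hsec₂ : secDist (channelLaw (W p.other) enc) (fun ω => ω.1.1) (fun ω => ω.2.2.2) ≤ η)
    {R δ : ℝ} (hδ : δ ≤ 1) (hnm : 0 < n + m) (hη : 3 * η < δ)
    (hrate : (n + m : ℕ) * (R - δ) < (1 - 6 * η) * (c + s : ℕ) - 1)
    (hunif : (c + s : ℕ) - (n + m : ℕ) * δ < (1 - 6 * η) * (c + s : ℕ) - 1)
    (hsecret : (1 - δ) * (c + s : ℕ) < (1 - 6 * η) * (c + s : ℕ) - 1) :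
    ∃ 𝔭 : Protocol X Y, 𝔭.rounds = 2 ∧ 𝔭.initiator = p ∧ 𝔭.IsSecure W R δ := by
  let μ := Fin (2 ^ s) × Fin (2 ^ t₁) × Fin (2 ^ t₂)
  let ρ := Fin (2 ^ (s + t₁ + t₂ - b))
  have hcard : Fintype.card (Fin (2 ^ b) × ρ) = Fintype.card μ := by
    simp only [μ, ρ, Fintype.card_prod, Fintype.card_fin, ← pow_add]
    congr 1; omega
  let e : Fin (2 ^ b) × ρ ≃ μ := Fintype.equivOfCardEq hcard
  have hcard' : Fintype.card (Fin (2 ^ c) × Fin (2 ^ s)) = Fintype.card (Fin (2 ^ (c + s))) := by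
    simp only [Fintype.card_prod, Fintype.card_fin, ← pow_add]
  let eK : Fin (2 ^ c) × Fin (2 ^ s) ≃ Fin (2 ^ (c + s)) := Fintype.equivOfCardEq hcard'
  let τ := (Fin (2 ^ b) × Fin (2 ^ c)) × ρ × (Fin m → X p.other)
  let κ' : (Fin n → Y p) → stdSimplex ℝ τ := fun y => ⟨_, prod_code_kernel_mem e (hκ y) henc⟩
  let inp : τ → Fin m → X p.other := fun t => t.2.2
  let keyB : τ → Fin (2 ^ (c + s)) := fun t => eK (t.1.2, (e (t.1.1, t.2.1)).1)
  let keyA : (Fin n → X p) → (Fin m → Y p.other) → Fin (2 ^ (c + s)) := fun x y' =>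
    eK (dec₁ x (e.symm (dec₂ y')).1, (dec₂ y').1)
  let σ := blockLaw (W p) q κ
  let ch := channelLaw (W p.other) enc
  have hσ := blockLaw_mem (W p) hq hκ
  have hch := channelLaw_nonneg (W p.other) henc
  have hch1 := sum_channelLaw (W p.other) henc
  let C := composedLaw σ (fun ω => ω.2.2.2.1) e ch
  let Φ := reassoc (Fin n → X p) (Fin n → Y p) (Fin n → Z p) (Fin (2 ^ b) × Fin (2 ^ c)) ρ
    (Fin m → X p.other) (Fin m → Y p.other) (Fin m → Z p.other)
  have hlaw : twoRoundLaw W p ⟨q, hq⟩ κ' inp = fun a => C (Φ a) := by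
    funext a
    have hμ : (Fintype.card μ : ℝ) = Fintype.card (Fin (2 ^ b)) * Fintype.card ρ := by
      rw [← hcard, Fintype.card_prod]; push_cast; rfl
    have h1 : (Fintype.card (Fin (2 ^ b)) : ℝ) ≠ 0 := by exact_mod_cast Fintype.card_ne_zero
    have h2 : (Fintype.card ρ : ℝ) ≠ 0 := by exact_mod_cast Fintype.card_ne_zero
    -- With `card μ = card (Fin (2 ^ b)) * card ρ`, the density `1 / card ρ` of the padding equals
    -- the normalisation of `composedLaw`.
    change q a.1 * (∏ i, W p (a.1 i) (a.2.1 i, a.2.2.1 i)) * (κ a.2.1 a.2.2.2.1.1 *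
      (1 / Fintype.card ρ) * enc (e (a.2.2.2.1.1.1, a.2.2.2.1.2.1)) a.2.2.2.1.2.2) * _ =
      Fintype.card (Fin (2 ^ b)) * (q a.1 * (∏ i, W p (a.1 i) (a.2.1 i, a.2.2.1 i)) *
        κ a.2.1 a.2.2.2.1.1) * (1 / Fintype.card μ *
        enc (e (a.2.2.2.1.1.1, a.2.2.2.1.2.1)) a.2.2.2.1.2.2 * _)
    rw [hμ]
    field_simp
    rfl
  have hC : distr (twoRoundLaw W p ⟨q, hq⟩ κ' inp) Φ = C := by
    rw [hlaw]; exact distr_comp_equiv_self C Φ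
  have hlog : Real.logb 2 ((2 ^ (c + s) : ℕ) : ℝ) = (c + s : ℕ) := by
    rw [Nat.cast_pow, Nat.cast_ofNat, Real.logb_pow, Real.logb_self_eq_one one_lt_two, mul_one]
  have hC0 : ∀ a, 0 ≤ C a := fun a => mul_nonneg (mul_nonneg (by positivity) (hσ.1 _)) (hch _)
  refine ⟨twoRound p ⟨q, hq⟩ κ' inp keyB keyA, rfl, rfl,
    twoRound_isSecure W p ⟨q, hq⟩ κ' inp keyB keyA (η := 3 * η) hδ hnm Nat.one_le_two_pow
      ?_ ?_ ?_ ?_ ?_⟩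
  · rw [hlog]; linarith
  · rw [hlog]; linarith
  · rw [hlog]; linarith
  · have h1 := prob_distr (twoRoundLaw W p ⟨q, hq⟩ κ' inp) Φ (fun a =>
      keyA a.1.1 a.2.2.2.1 ≠ keyB (a.1.2.2.2, a.2.1, a.2.2.1))
    rw [hC] at h1
    have h2 : prob C (fun a => dec₁ a.1.1 a.1.2.2.2.1 ≠ a.1.2.2.2.2) ≤ η :=
      (prob_composedLaw_source (σ := σ) (fun ω => ω.2.2.2.1) e hch1
        (fun a => dec₁ a.1 a.2.2.2.1 ≠ a.2.2.2.2)).trans_le herr₁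
    have h3 : prob C (fun a => dec₂ a.2.2.2.1 ≠ e (a.1.2.2.2.1, a.2.1)) ≤ η + η :=
      (prob_composedLaw_channel hσ (fun ω => ω.2.2.2.1) (fun ω => ω.2.2.2.2) (fun ω => ω.2.2.1) e
        hch hch1 (fun c => dec₂ c.2.2.1 ≠ c.1)).trans (add_le_add herr₂ hsec₁)
    refine lt_of_le_of_lt ?_ hη
    calc _ = _ := h1.symm
      _ ≤ prob C (fun a => dec₁ a.1.1 a.1.2.2.2.1 ≠ a.1.2.2.2.2 ∨
          dec₂ a.2.2.2.1 ≠ e (a.1.2.2.2.1, a.2.1)) := by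
          refine prob_mono hC0 fun a _ h => ?_
          by_contra hno
          push Not at hno
          refine h ?_
          simp only [keyA, keyB, hno.2, Equiv.symm_apply_apply, hno.1]
      _ ≤ _ := prob_or_le hC0 _ _
      _ ≤ η + (η + η) := add_le_add h2 h3
      _ = 3 * η := by ring
  · have h1 := secDist_distr (twoRoundLaw W p ⟨q, hq⟩ κ' inp) Φ
      (fun a => keyB (a.1.2.2.2, a.2.1, a.2.2.1)) (fun a => (a.1.2.2.1, a.2.2.2.2))
    rw [hC] at h1
    have h2 : secDist C (fun a => (a.1.2.2.2.2, (e (a.1.2.2.2.1, a.2.1)).1))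
        (fun a => (a.1.2.2.1, a.2.2.2.2)) ≤ η + 2 * η :=
      (secDist_composedLaw hσ (fun ω => ω.2.2.2.1) (fun ω => ω.2.2.2.2) (fun ω => ω.2.2.1) e
        hch hch1 (fun M => M.1) (fun ξ => ξ.2.2)).trans
        (add_le_add hsec₂ (mul_le_mul_of_nonneg_left hsec₁ zero_le_two))
    have h3 := secDist_equiv C (fun a => (a.1.2.2.2.2, (e (a.1.2.2.2.1, a.2.1)).1))
      (fun a => (a.1.2.2.1, a.2.2.2.2)) eK
    calc _ = _ := h1.symm
      _ = _ := h3
      _ ≤ _ := h2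
      _ = _ := by ring

end SourceChannel

/-! ### Rates of the two codes for the given auxiliary variables -/

section Achievability

open Filter

variable {𝒳 𝒴 𝒵 : Type*} [Fintype 𝒳] [Fintype 𝒴] [Fintype 𝒵]

/-- With `n` channel uses per unit of time, one can create a key of rate `r₁` with a message of
rate `r₀`, both nearly uniform and independent of the observation of Eve. -/
def SourceAchievable (W : 𝒳 → stdSimplex ℝ (𝒴 × 𝒵)) (n : ℕ) (r₀ r₁ C : ℝ) : Prop :=
  ∀ ε η : ℝ, 0 < ε → 0 < η → ∀ᶠ N : ℕ in atTop, ∃ (b c : ℕ) (q : (Fin (n * N) → 𝒳) → ℝ)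
    (κ : (Fin (n * N) → 𝒴) → Fin (2 ^ b) × Fin (2 ^ c) → ℝ)
    (dec : (Fin (n * N) → 𝒳) → Fin (2 ^ b) → Fin (2 ^ c)),
    q ∈ stdSimplex ℝ (Fin (n * N) → 𝒳) ∧
    (∀ y, κ y ∈ stdSimplex ℝ (Fin (2 ^ b) × Fin (2 ^ c))) ∧
    (b : ℝ) ≤ N * (r₀ + ε) ∧ N * (r₁ - ε) ≤ c ∧ (c : ℝ) ≤ N * C ∧
    prob (blockLaw W q κ) (fun ω => dec ω.1 ω.2.2.2.1 ≠ ω.2.2.2.2) ≤ η ∧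
    secDist (blockLaw W q κ) (fun ω => ω.2.2.2) (fun ω => ω.2.2.1) ≤ η

/-- With `m` channel uses per unit of time, one can send messages of rate `r₂`, of which a part of
rate `r₃` is secret. -/
def ChannelAchievable (W : 𝒳 → stdSimplex ℝ (𝒴 × 𝒵)) (m : ℕ) (r₂ r₃ C : ℝ) : Prop :=
  ∀ ε η : ℝ, 0 < ε → 0 < η → ∀ᶠ N : ℕ in atTop, ∃ (s t₁ t₂ : ℕ)
    (enc : Fin (2 ^ s) × Fin (2 ^ t₁) × Fin (2 ^ t₂) → (Fin (m * N) → 𝒳) → ℝ)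
    (dec : (Fin (m * N) → 𝒴) → Fin (2 ^ s) × Fin (2 ^ t₁) × Fin (2 ^ t₂)),
    (∀ M, enc M ∈ stdSimplex ℝ (Fin (m * N) → 𝒳)) ∧
    N * (r₂ - ε) ≤ (s + t₁ + t₂ : ℕ) ∧ N * (r₃ - ε) ≤ s ∧ (s : ℝ) ≤ N * C ∧
    prob (channelLaw W enc) (fun ω => dec ω.2.2.1 ≠ ω.1) ≤ η ∧
    secDist (channelLaw W enc) (fun ω => ω.1.1) (fun ω => ω.2.2.2) ≤ η

theorem eventually_mul_left {n : ℕ} (hn : 0 < n) {Q : ℕ → Prop} (h : ∀ᶠ N : ℕ in atTop, Q N) :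
    ∀ᶠ N : ℕ in atTop, Q (n * N) :=
  (tendsto_id.const_mul_atTop' hn).eventually h

/-- An empty first block, with message and key alphabets of one element. It keeps the number of
rounds equal to two when the source is not worth using. -/
theorem sourceAchievable_zero (W : 𝒳 → stdSimplex ℝ (𝒴 × 𝒵)) : SourceAchievable W 0 0 0 0 := by
  intro ε η hε hη
  refine Eventually.of_forall fun N => ?_
  have hN : IsEmpty (Fin (0 * N)) := by rw [zero_mul]; infer_instance
  have hN0 : (0 : ℝ) ≤ N := N.cast_nonneg
  have hq : (fun _ => 1) ∈ stdSimplex ℝ (Fin (0 * N) → 𝒳) := ⟨fun _ => zero_le_one, by simp⟩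
  have hκ : ∀ _ : Fin (0 * N) → 𝒴, (fun _ => 1) ∈ stdSimplex ℝ (Fin (2 ^ 0) × Fin (2 ^ 0)) :=
    fun _ => ⟨fun _ => zero_le_one, by simp⟩
  refine ⟨0, 0, fun _ => 1, fun _ _ => 1, fun _ _ => 0, hq, hκ, ?_, ?_, by simp, ?_, ?_⟩
  · push_cast; rw [zero_add]; positivity
  · push_cast; rw [zero_sub]; nlinarith
  · refine le_of_eq_of_le ?_ hη.le
    simp only [prob]
    refine Finset.sum_eq_zero fun ω _ => if_neg fun h => h ?_
    exact (inferInstance : Subsingleton (Fin 1)).elim _ _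
  · exact (secDist_of_card_eq_one _ _ _ (by simp)).trans_le hη.le

theorem OutputVars.mem {W : 𝒳 → stdSimplex ℝ (𝒴 × 𝒵)} (A : OutputVars W) :
    ⇑A.P ∈ stdSimplex ℝ (Fin A.sizeV × 𝒳 × 𝒴 × 𝒵) := A.P.2

theorem InputVars.mem {W : 𝒳 → stdSimplex ℝ (𝒴 × 𝒵)} (B : InputVars W) :
    ⇑B.P ∈ stdSimplex ℝ (Fin B.sizeW₂ × Fin B.sizeW₁ × 𝒳 × 𝒴 × 𝒵) := B.P.2

theorem OutputVars.cost_nonneg {W : 𝒳 → stdSimplex ℝ (𝒴 × 𝒵)} (A : OutputVars W) : 0 ≤ A.cost :=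
  sub_nonneg.mpr (condEntropy_pair_le A.mem _ _ _)

theorem OutputVars.sourceAchievable {W : 𝒳 → stdSimplex ℝ (𝒴 × 𝒵)} (A : OutputVars W) {n : ℕ}
    (hn : 0 < n) (h : 0 < A.Rs1) :
    SourceAchievable W n (n * A.cost) (n * A.Rs1)
      (n * condEntropy A.P (fun ω => ω.1) (fun ω => ω.2.2.2)) := by
  intro ε η hε hη
  have hn' : (0 : ℝ) < n := by exact_mod_cast hn
  have hR : A.Rs1 = condEntropy A.P (fun ω => ω.1) (fun ω => ω.2.2.2) -
      condEntropy A.P (fun ω => ω.1) (fun ω => ω.2.1) := by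
    simp only [OutputVars.Rs1, mutualInfo]; ring
  -- A slack of `ε / n` per channel use is a slack of `ε` per unit of time, there being `n * N`
  -- uses.
  have h1 := exists_source_code A.mem (fun ω => ω.1) (fun ω => ω.2.1) (fun ω => ω.2.2.1)
    (fun ω => ω.2.2.2) A.markov (by have h' := h; rw [hR] at h'; exact sub_pos.mp h') (ε := ε / n)
    (η := η) (by positivity) hη
  filter_upwards [eventually_mul_left hn h1] with N hN
  obtain ⟨b, c, κ, dec, hκ, hb, hc, hC, herr, hsec⟩ := hN
  have hlaw : blockLaw W (fun x => ∏ i, distr A.P (fun ω => ω.2.1) (x i)) κ =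
      sourceLaw A.P (fun ω => ω.2.1) (fun ω => ω.2.2.1) (fun ω => ω.2.2.2) κ := by
    funext ω
    simp only [blockLaw, sourceLaw, A.consistent _ _ _, Finset.prod_mul_distrib]
  have hX := distr_mem A.mem (fun ω => ω.2.1)
  push_cast at hb hc hC
  refine ⟨b, c, fun x => ∏ i, distr A.P (fun ω => ω.2.1) (x i), κ, dec, ⟨fun x =>
    Finset.prod_nonneg fun i _ => hX.1 _, ?_⟩, hκ, ?_, ?_, ?_, ?_, ?_⟩
  · rw [← Fintype.prod_sum (fun _ x => distr A.P (fun ω => ω.2.1) x)]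
    exact Finset.prod_eq_one fun i _ => hX.2
  · refine hb.trans (le_of_eq ?_)
    change _ * (A.cost + _) = _
    field_simp
  · refine le_trans (le_of_eq ?_) hc
    rw [← hR]
    field_simp
  · exact hC.trans (le_of_eq (by ring))
  · rw [hlaw]; exact herr
  · rw [hlaw]; exact hsec

variable {Ω 𝒰 𝒱 : Type*} [Fintype Ω] [Fintype 𝒰] [Fintype 𝒱]

/-- The right side is I(U,V;Y) by the chain rule, and the difference is I(U;Y|V) ≥ 0. Thus the
superposition code has at least the total rate I(W₁;Y) of the constraint. -/
theorem mutualInfo_le_add_condMutualInfo {P : Ω → ℝ} (hP : P ∈ stdSimplex ℝ Ω) (U : Ω → 𝒰)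
    (V : Ω → 𝒱) (Y : Ω → 𝒴) :
    mutualInfo P V Y ≤ mutualInfo P U Y + condMutualInfo P V Y U := by
  have h1 := condEntropy_pair_le hP U Y V
  have e1 := entropy_comp_equiv P (fun ω => (U ω, Y ω)) (Equiv.prodComm 𝒰 𝒴)
  have e2 := entropy_comp_equiv P (fun ω => (Y ω, V ω)) (Equiv.prodComm 𝒴 𝒱)
  have e3 := entropy_comp_equiv P (fun ω => (U ω, V ω)) (Equiv.prodComm 𝒰 𝒱)
  have e4 := entropy_comp_equiv P (fun ω => (U ω, (Y ω, V ω)))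
    ((Equiv.prodAssoc 𝒰 𝒴 𝒱).symm.trans ((Equiv.prodComm (𝒰 × 𝒴) 𝒱).trans
      (Equiv.prodCongr (Equiv.refl 𝒱) (Equiv.prodComm 𝒰 𝒴))))
  simp only [Equiv.prodComm_apply, Prod.swap_prod_mk, Equiv.trans_apply, Equiv.prodAssoc_symm_apply,
    Equiv.prodCongr_apply, Prod.map_apply, Equiv.coe_refl, id] at e1 e2 e3 e4
  simp only [mutualInfo, condMutualInfo, condEntropy] at h1 ⊢
  linarith

theorem condMutualInfo_unit {P : Ω → ℝ} (hP : P ∈ stdSimplex ℝ Ω) (V : Ω → 𝒱) (Y : Ω → 𝒴) :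
    condMutualInfo P V Y (fun _ => ()) = mutualInfo P V Y := by
  simp only [condMutualInfo, mutualInfo, condEntropy_const hP, condEntropy_pair_const]

theorem channelAchievable_of_code {P : Ω → ℝ} (hP : P ∈ stdSimplex ℝ Ω) (U : Ω → 𝒰)
    (V : Ω → 𝒱) (X : Ω → 𝒳) (Y : Ω → 𝒴) (Z : Ω → 𝒵) (W : 𝒳 → stdSimplex ℝ (𝒴 × 𝒵))
    (hW : ∀ u v x y z, distr P (fun ω => ((U ω, V ω), X ω, (Y ω, Z ω))) ((u, v), x, (y, z)) =
      distr P (fun ω => ((U ω, V ω), X ω)) ((u, v), x) * W x (y, z))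
    (hpos : 0 < condMutualInfo P V Y U) {m : ℕ} (hm : 0 < m) {r : ℝ}
    (hr : r ≤ max 0 (condMutualInfo P V Y U - condMutualInfo P V Z U)) :
    ChannelAchievable W m (m * mutualInfo P V Y) (m * r) (m * condEntropy P V (fun ω => (Z ω, U ω))) := by
  intro ε η hε hη
  have hm' : (0 : ℝ) < m := by exact_mod_cast hm
  have h1 := exists_channel_code hP U V X Y Z W hW hpos (ε := ε / m) (η := η) (by positivity) hη
  filter_upwards [eventually_mul_left hm h1] with N hN
  obtain ⟨s, t₁, t₂, enc, dec, henc, ht, hs, hC, herr, hsec⟩ := hN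
  push_cast at ht hs hC
  have hI := mutualInfo_le_add_condMutualInfo hP U V Y
  have hN0 : (0 : ℝ) ≤ N := N.cast_nonneg
  refine ⟨s, t₁, t₂, enc, dec, henc, ?_, ?_, hC.trans (le_of_eq (by ring)), herr, hsec⟩
  · push_cast
    refine le_trans ?_ ht
    have : (N : ℝ) * (m * mutualInfo P V Y - ε) = m * N * (mutualInfo P V Y - ε / m) := by
      field_simp
    rw [this]
    gcongr
  · have : (N : ℝ) * (m * r - ε) = m * N * (r - ε / m) := by field_simp
    rw [this]
    rcases le_max_iff.mp hr with h | h
    · refine le_trans ?_ s.cast_nonneg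
      exact mul_nonpos_of_nonneg_of_nonpos (by positivity)
        (sub_nonpos.mpr (h.trans (by positivity)))
    · refine le_trans ?_ hs
      gcongr

/-- The Markov chain and the consistency with `W` give this after multiplication by P(x); where P(x)
= 0, both sides vanish. -/
theorem InputVars.distr_eq {W : 𝒳 → stdSimplex ℝ (𝒴 × 𝒵)} (B : InputVars W) (u : Fin B.sizeW₂)
    (v : Fin B.sizeW₁) (x : 𝒳) (y : 𝒴) (z : 𝒵) :
    distr B.P (fun ω => ((ω.1, ω.2.1), ω.2.2.1, (ω.2.2.2.1, ω.2.2.2.2))) ((u, v), x, (y, z)) =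
      distr B.P (fun ω => ((ω.1, ω.2.1), ω.2.2.1)) ((u, v), x) * W x (y, z) := by
  have h1 := B.markov₂ (u, v) x (y, z)
  have h2 := B.consistent x y z
  by_cases h0 : distr B.P (fun ω => ω.2.2.1) x = 0
  · have h3 := distr_pair_le_right B.mem.1 (fun ω => (ω.1, ω.2.1)) (fun ω => ω.2.2.1) (u, v) x
    have h4 := distr_pair_le_left B.mem.1 (fun ω => ω.2.2.1) (fun ω => ω.2.2.2) x (y, z)
    have h5 := distr_pair_le_right B.mem.1 (fun ω => (ω.1, ω.2.1))
      (fun ω => (ω.2.2.1, ω.2.2.2)) (u, v) (x, (y, z))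
    rw [h0] at h3 h4
    have h6 := le_antisymm h3 (distr_nonneg B.mem.1 _ _)
    have h7 := le_antisymm (h5.trans h4) (distr_nonneg B.mem.1 _ _)
    rw [h6, zero_mul]
    exact h7
  · apply mul_right_cancel₀ h0
    refine h1.trans ?_
    rw [mul_assoc, mul_comm (W x (y, z) : ℝ), ← h2]

/-- If R_{s2} > 0, then I(W₁;Y|W₂) > 0 and W₂ can be the cloud center. Otherwise no secret part is
needed and I(W₁;Y|W₂) may vanish, so the cloud center is taken constant: the code then only needs
I(W₁;Y) > 0. -/
theorem InputVars.channelAchievable {W : 𝒳 → stdSimplex ℝ (𝒴 × 𝒵)} (B : InputVars W) {m : ℕ}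
    (hm : 0 < m) (h : 0 < B.info) :
    ∃ C, ChannelAchievable W m (m * B.info) (m * max 0 B.Rs2) C := by
  rcases lt_or_ge 0 B.Rs2 with hR | hR
  · refine ⟨_, channelAchievable_of_code B.mem (fun ω => ω.1) (fun ω => ω.2.1) (fun ω => ω.2.2.1)
      (fun ω => ω.2.2.2.1) (fun ω => ω.2.2.2.2) W B.distr_eq ?_ hm le_rfl⟩
    have h1 : 0 ≤ condMutualInfo B.P (fun ω => ω.2.1) (fun ω => ω.2.2.2.2) (fun ω => ω.1) :=
      sub_nonneg.mpr (condEntropy_pair_le B.mem _ _ _)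
    exact h1.trans_lt (sub_pos.mp hR)
  · rw [max_eq_left hR]
    refine ⟨_, channelAchievable_of_code B.mem (fun _ => ()) (fun ω => ω.2.1) (fun ω => ω.2.2.1)
      (fun ω => ω.2.2.2.1) (fun ω => ω.2.2.2.2) W ?_ ?_ hm (le_max_left _ _)⟩
    · intro u v x y z
      have h1 : distr B.P (fun ω => (((), ω.2.1), ω.2.2.1, (ω.2.2.2.1, ω.2.2.2.2)))
          ((u, v), x, (y, z)) = distr B.P (fun ω => (ω.2.1, ω.2.2.1, (ω.2.2.2.1, ω.2.2.2.2)))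
          (v, x, (y, z)) := distr_congr _ fun ω => by simp only [Prod.mk.injEq, true_and]
      have h2 : distr B.P (fun ω => (((), ω.2.1), ω.2.2.1)) ((u, v), x) =
          distr B.P (fun ω => (ω.2.1, ω.2.2.1)) (v, x) :=
        distr_congr _ fun ω => by simp only [Prod.mk.injEq, true_and]
      rw [h1, h2, ← sum_distr_fst B.P (fun ω => ω.1), ← sum_distr_fst B.P (fun ω => ω.1),
        Finset.sum_mul]
      refine Finset.sum_congr rfl fun u _ => ?_
      refine Eq.trans (distr_congr _ fun ω => ?_) ((B.distr_eq u v x y z).trans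
        (congrArg (· * (W x (y, z) : ℝ)) (distr_congr _ fun ω => ?_)))
      · simp only [Prod.mk.injEq, and_assoc]
      · simp only [Prod.mk.injEq, and_assoc]
    · rw [condMutualInfo_unit B.mem]; exact h

end Achievability

/-! ### Choice of parameters, and positive rates -/

section Combination

open Filter

variable {X Y Z : Party → Type*} [∀ p, Fintype (X p)] [∀ p, Fintype (Y p)] [∀ p, Fintype (Z p)]

/-- The entropy lost through imperfect secrecy is proportional to η times the key length. This is
why achievability includes linear upper bounds on the key lengths: they allow η to be fixed before
`N`. -/
theorem exists_secure_of_achievable (W : ∀ p, X p → stdSimplex ℝ (Y p × Z p)) (p : Party)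
    {n m : ℕ} {r₀ r₁ r₂ r₃ C C' : ℝ} (hS : SourceAchievable (W p) n r₀ r₁ C)
    (hC : ChannelAchievable (W p.other) m r₂ r₃ C') (hr : r₀ < r₂) (hpos : 0 < r₁ + r₃)
    (hnm : 0 < n + m) {δ : ℝ} (hδ : 0 < δ) (hδ1 : δ ≤ 1) :
    ∃ 𝔭 : Protocol X Y, 𝔭.rounds = 2 ∧ 𝔭.initiator = p ∧
      𝔭.IsSecure W ((r₁ + r₃) / (n + m : ℕ)) δ := by
  set r := r₁ + r₃ with hr_def
  have hu : (1 : ℝ) ≤ (n + m : ℕ) := by exact_mod_cast hnm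
  -- The first bound makes the source message fit into the channel message, the second keeps the
  -- rate loss 2ε below δ/4, and the third keeps the key length above N r / 2.
  obtain ⟨ε, hε, hε1⟩ : ∃ ε : ℝ, 0 < ε ∧ ε ≤ (r₂ - r₀) / 2 ∧ ε ≤ δ / 8 ∧ ε ≤ r / 4 :=
    ⟨min ((r₂ - r₀) / 2) (min (δ / 8) (r / 4)),
      lt_min (by linarith) (lt_min (by linarith) (by linarith)), min_le_left _ _,
      (min_le_right _ _).trans (min_le_left _ _), (min_le_right _ _).trans (min_le_right _ _)⟩
  obtain ⟨hε1, hε2, hε3⟩ := hε1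
  set D := |C + C'| + 1 with hD
  have hD1 : 1 ≤ D := by rw [hD]; linarith [abs_nonneg (C + C')]
  obtain ⟨η, hη, hηD⟩ : ∃ η : ℝ, 0 < η ∧ 24 * (η * D) = δ :=
    ⟨δ / (24 * D), by positivity, by field_simp⟩
  have hηδ : 24 * η ≤ δ := by nlinarith
  have hNlarge : ∀ᶠ N : ℕ in atTop, 2 < δ * (N : ℝ) ∧ 4 < δ * r * N := by
    refine (Eventually.and ?_ ?_)
    · exact (tendsto_natCast_atTop_atTop.const_mul_atTop hδ).eventually_gt_atTop 2
    · exact (tendsto_natCast_atTop_atTop.const_mul_atTop (by positivity)).eventually_gt_atTop 4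
  obtain ⟨N, ⟨b, c, q, κ, dec₁, hq, hκ, hb, hc, hcC, herr₁, hsec₁⟩,
    ⟨s, t₁, t₂, enc, dec₂, henc, ht, hs, hsC, herr₂, hsec₂⟩, hN1, hN2⟩ :=
    ((hS ε η hε hη).and ((hC ε η hε hη).and hNlarge)).exists
  have hN0 : (0 : ℝ) < N := by
    by_contra h
    have : (N : ℝ) = 0 := le_antisymm (not_lt.mp h) N.cast_nonneg
    rw [this] at hN1; norm_num at hN1
  have hL1 : N * (r - 2 * ε) ≤ ((c + s : ℕ) : ℝ) := by push_cast; rw [hr_def]; linarith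
  have hL2 : ((c + s : ℕ) : ℝ) ≤ N * D := by
    push_cast
    have : N * (C + C') ≤ N * D := by gcongr; rw [hD]; linarith [le_abs_self (C + C')]
    linarith
  have hL0 : (0 : ℝ) ≤ ((c + s : ℕ) : ℝ) := Nat.cast_nonneg _
  have hηL : 6 * η * ((c + s : ℕ) : ℝ) ≤ N * δ / 4 := by
    have := mul_le_mul_of_nonneg_left hL2 hη.le
    have h2 : η * (N * D) = N * (η * D) := by ring
    rw [h2] at this
    have h3 : η * D = δ / 24 := by linarith
    rw [h3] at this
    linarith
  have hlen : n * N + m * N = (n + m) * N := by ring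
  refine exists_twoRound_of_codes W p hq hκ dec₁ henc dec₂ ?_ herr₁ hsec₁ herr₂ hsec₂ hδ1 ?_
    (by linarith) ?_ ?_ ?_
  · have : (N : ℝ) * (r₀ + ε) ≤ N * (r₂ - ε) := by gcongr; linarith
    exact_mod_cast hb.trans (this.trans ht)
  · rw [hlen]; exact Nat.mul_pos hnm (by exact_mod_cast hN0)
  · rw [hlen, Nat.cast_mul]
    have h1 : ((n + m : ℕ) : ℝ) * N * (r / (n + m : ℕ) - δ) = N * r - (n + m : ℕ) * (N * δ) := by
      field_simp
    rw [h1]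
    have h2 : N * δ ≤ (n + m : ℕ) * (N * δ) := le_mul_of_one_le_left (by positivity) hu
    have h3 : N * ε ≤ N * (δ / 8) := by gcongr
    linarith
  · rw [hlen, Nat.cast_mul]
    have h2 : N * δ ≤ (n + m : ℕ) * (N * δ) := le_mul_of_one_le_left (by positivity) hu
    linarith
  · have h3 : N * ε ≤ N * (r / 4) := by gcongr
    have h4 : N * r / 2 ≤ ((c + s : ℕ) : ℝ) := by linarith
    have h5 := mul_le_mul_of_nonneg_left h4 hδ.le
    have h6 := mul_le_mul_of_nonneg_right hηδ hL0
    linarith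

omit [∀ p, Fintype (X p)] in
theorem Protocol.IsSecure.mono {W : ∀ p, X p → stdSimplex ℝ (Y p × Z p)} {𝔭 : Protocol X Y}
    {R δ R' δ' : ℝ} (h : 𝔭.IsSecure W R δ) (hR : R' - δ' ≤ R - δ) (hδ : δ ≤ δ') :
    𝔭.IsSecure W R' δ' where
  uses_pos := h.uses_pos
  rate := hR.trans_lt h.rate
  uniform := (sub_le_sub_left hδ _).trans_lt h.uniform
  reliable := h.reliable.trans_le hδ
  secret := (sub_le_sub_left hδ _).trans_lt h.secret

/-- If the first-round code has no positive contribution, dropping its `n` channel uses can only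
increase the rate, so the channel code is used alone. -/
theorem exists_secure_of_pos (W : ∀ p, X p → stdSimplex ℝ (Y p × Z p)) (p : Party) {n m : ℕ}
    (A : OutputVars (W p)) (B : InputVars (W p.other)) (h : n * A.cost < m * B.info)
    (hpos : 0 < (n * A.Rs1 + m * max 0 B.Rs2) / ((n : ℝ) + m)) {δ : ℝ} (hδ : 0 < δ) (hδ1 : δ ≤ 1) :
    ∃ 𝔭 : Protocol X Y, 𝔭.rounds = 2 ∧ 𝔭.initiator = p ∧
      𝔭.IsSecure W ((n * A.Rs1 + m * max 0 B.Rs2) / ((n : ℝ) + m)) δ := by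
  -- The strict constraint forces both `m` and I(W₁;Y) to be positive, since the cost is
  -- nonnegative.
  have h0 : 0 < m * B.info := lt_of_le_of_lt (mul_nonneg n.cast_nonneg A.cost_nonneg) h
  have hm : 0 < m := Nat.pos_of_ne_zero fun hm => by simp [hm] at h0
  have hm' : (0 : ℝ) < m := by exact_mod_cast hm
  obtain ⟨C, hC⟩ := B.channelAchievable hm (pos_of_mul_pos_right h0 hm'.le)
  have hn0 : (0 : ℝ) ≤ n := n.cast_nonneg
  have hnm : (0 : ℝ) < n + m := by linarith
  rw [div_pos_iff_of_pos_right hnm] at hpos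
  by_cases hA : 0 < n ∧ 0 < A.Rs1
  · obtain ⟨𝔭, h1, h2, h3⟩ := exists_secure_of_achievable W p (A.sourceAchievable hA.1 hA.2) hC h
      hpos (by omega) hδ hδ1
    exact ⟨𝔭, h1, h2, by simpa using h3⟩
  · have hR : n * A.Rs1 ≤ 0 := by
      by_cases hn : 0 < n
      · exact mul_nonpos_of_nonneg_of_nonpos hn0 (not_lt.mp fun h => hA ⟨hn, h⟩)
      · have : n = 0 := by omega
        simp [this]
    have hB : 0 ≤ m * max 0 B.Rs2 := mul_nonneg hm'.le (le_max_left _ _)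
    obtain ⟨𝔭, h1, h2, h3⟩ := exists_secure_of_achievable W p (sourceAchievable_zero (W p)) hC h0
      (by linarith) (by omega) hδ hδ1
    refine ⟨𝔭, h1, h2, h3.mono (sub_le_sub_right ?_ _) le_rfl⟩
    rw [zero_add, zero_add]
    refine div_le_div₀ hB (by linarith) hm' (by linarith)

end Combination

/-! ### Rate zero -/

section ZeroRate

theorem entropy_distr {Ω Λ α : Type*} [Fintype Ω] [Fintype Λ] [Fintype α] (P : Ω → ℝ) (T : Ω → Λ)
    (U : Λ → α) : entropy (distr P T) U = entropy P (fun ω => U (T ω)) := by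
  simp only [entropy, distr_distr]

theorem condEntropy_distr {Ω Λ α β : Type*} [Fintype Ω] [Fintype Λ] [Fintype α] [Fintype β]
    (P : Ω → ℝ) (T : Ω → Λ) (U : Λ → α) (V : Λ → β) :
    condEntropy (distr P T) U V = condEntropy P (fun ω => U (T ω)) (fun ω => V (T ω)) := by
  simp only [condEntropy, entropy_distr]

theorem condEntropy_eq_entropy_of_indep {Ω α β : Type*} [Fintype Ω] [Fintype α] [Fintype β]
    {P : Ω → ℝ} (hP : P ∈ stdSimplex ℝ Ω) (U : Ω → α) (V : Ω → β)
    (h : ∀ u v, distr P (fun ω => (U ω, V ω)) (u, v) = distr P U u * distr P V v) :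
    condEntropy P U V = entropy P U := by
  have hU := (distr_mem hP U).2
  have hV := (distr_mem hP V).2
  have h1 : entropy P (fun ω => (U ω, V ω)) = entropy P U + entropy P V := by
    simp only [entropy, ← Finset.sum_div, Fintype.sum_prod_type, h, Real.negMulLog_mul,
      Finset.sum_add_distrib, ← Finset.mul_sum, ← Finset.sum_mul, hU, hV, one_mul]
    rw [add_div]
  rw [condEntropy, h1, add_sub_cancel_right]

theorem indep_of_mul {Ω α β : Type*} [Fintype Ω] [Fintype α] [Fintype β] {P : Ω → ℝ}
    (hP : P ∈ stdSimplex ℝ Ω) (U : Ω → α) (V : Ω → β) {f : α → ℝ} {g : β → ℝ}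
    (hf : ∑ u, f u = 1) (h : ∀ u v, distr P (fun ω => (U ω, V ω)) (u, v) = f u * g v) :
    distr P U = f ∧ distr P V = g := by
  have hV : distr P V = g := by
    funext v
    rw [← sum_distr_fst P U V v]
    simp only [h, ← Finset.sum_mul, hf, one_mul]
  have hg : ∑ v, g v = 1 := hV ▸ (distr_mem hP V).2
  refine ⟨?_, hV⟩
  funext u
  rw [← sum_distr_snd P U V u]
  simp only [h, ← Finset.mul_sum, hg, mul_one]

variable {X Y Z : Party → Type*} [∀ p, Fintype (X p)] [∀ p, Fintype (Y p)] [∀ p, Fintype (Z p)]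

/-- The law on `{0, 1}` giving probability `t` to `1`. -/
noncomputable def coinLaw (t : ℝ) (h0 : 0 ≤ t) (h1 : t ≤ 1) : stdSimplex ℝ (Fin 2) :=
  ⟨![1 - t, t], Fin.forall_fin_two.mpr ⟨sub_nonneg.mpr h1, h0⟩, by
    rw [Fin.sum_univ_two]; simp⟩

theorem sum_mul_ite_prod {τ α β : Type*} [Fintype τ] [Fintype α]
    (A : α → ℝ) (b : τ → ℝ) (V : α → β) (t : τ) (v : β) [DecidableEq τ] [DecidableEq β] :
    (∑ a, ∑ t', if (t', V a) = (t, v) then A a * b t' else 0) =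
      b t * ∑ a, if V a = v then A a else 0 := by
  rw [Finset.mul_sum]
  refine Finset.sum_congr rfl fun a _ => ?_
  rw [Finset.sum_eq_single t]
  · by_cases h : V a = v <;> simp [h, mul_comm]
  · intro t' _ ht; simp [ht]
  · simp

/-- Constant blocks carry no information, so a coin flipped by the second party is perfectly secret.
Its bias δ/2 makes its entropy positive, as the secrecy ratio requires, while the constant estimate
0 is wrong with probability δ/2 only. -/
theorem exists_secure_zero (W : ∀ p, X p → stdSimplex ℝ (Y p × Z p)) (p : Party) (x₀ : X p)
    (x₁ : X p.other) {δ : ℝ} (hδ : 0 < δ) (hδ1 : δ ≤ 1) :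
    ∃ 𝔭 : Protocol X Y, 𝔭.rounds = 2 ∧ 𝔭.initiator = p ∧ 𝔭.IsSecure W 0 δ := by
  classical
  -- The key alphabet costs one bit, spread over 2k uses; with k > 1/δ the uniformity condition
  -- holds despite the bias.
  obtain ⟨k, hk⟩ := exists_nat_gt (1 / δ)
  have hk0 : (0 : ℝ) < k := lt_trans (by positivity) hk
  have hkδ : 1 < k * δ := by rwa [div_lt_iff₀ hδ] at hk
  let q : stdSimplex ℝ (Fin k → X p) := ⟨Pi.single (fun _ => x₀) 1, single_mem_stdSimplex ℝ _⟩
  let β : stdSimplex ℝ (Fin 2) := coinLaw (δ / 2) (by linarith) (by linarith)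
  let 𝔭 : Protocol X Y := twoRound p q (fun _ : Fin k → Y p => β)
    (fun (_ : Fin 2) (_ : Fin k) => x₁) id (fun _ _ => (0 : Fin 2))
  let T := twoRoundVars (Z := Z) p q (fun _ : Fin k → Y p => β)
    (fun (_ : Fin 2) (_ : Fin k) => x₁) id (fun _ _ => (0 : Fin 2))
  set L := twoRoundLaw W p q (fun _ : Fin k → Y p => β) (fun (_ : Fin 2) (_ : Fin k) => x₁) with hL
  have hT : distr (𝔭.law W) T = L := distr_twoRoundVars W p q _ _ id _
  have hmem : ⇑(𝔭.law W) ∈ stdSimplex ℝ (𝔭.Outcome Z) := (𝔭.law W).2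
  have hLmem : L ∈ stdSimplex ℝ _ := hT ▸ distr_mem hmem T
  -- The second block does not depend on the coin, so the law of the coin splits off as a factor.
  obtain ⟨g, hg⟩ : ∃ g : (Fin k → Z p) × (Fin k → Z p.other) → ℝ, ∀ t v,
      distr L (fun a => (a.2.2.2.1, (a.2.2.1, a.2.2.2.2.2))) (t, v) = β t * g v := by
    let Φ : ((Fin k → X p) × (Fin k → Y p) × (Fin k → Z p) × (Fin k → Y p.other) ×
        (Fin k → Z p.other)) × Fin 2 ≃ (Fin k → X p) × (Fin k → Y p) × (Fin k → Z p) × Fin 2 ×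
        (Fin k → Y p.other) × (Fin k → Z p.other) :=
      { toFun := fun a => (a.1.1, a.1.2.1, a.1.2.2.1, a.2, a.1.2.2.2)
        invFun := fun a => ((a.1, a.2.1, a.2.2.1, a.2.2.2.2), a.2.2.2.1)
        left_inv := fun _ => rfl
        right_inv := fun _ => rfl }
    let w : (Fin k → X p) × (Fin k → Y p) × (Fin k → Z p) × (Fin k → Y p.other) ×
        (Fin k → Z p.other) → ℝ := fun a => q a.1 * (∏ i, W p (a.1 i) (a.2.1 i, a.2.2.1 i)) *
      ∏ i, W p.other x₁ (a.2.2.2.1 i, a.2.2.2.2 i)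
    refine ⟨fun v => ∑ a, if (a.2.2.1, a.2.2.2.2) = v then w a else 0, fun t v => ?_⟩
    unfold distr prob
    rw [← Φ.sum_comp, Fintype.sum_prod_type]
    refine Eq.trans ?_ (sum_mul_ite_prod w β (fun a => (a.2.2.1, a.2.2.2.2)) t v)
    refine Finset.sum_congr rfl fun a _ => Finset.sum_congr rfl fun t' _ => ?_
    have h1 : L (Φ (a, t')) = w a * β t' := mul_right_comm _ _ _
    rw [h1]
    congr
  obtain ⟨hU, hV⟩ := indep_of_mul hLmem _ _ β.2.2 hg
  have hcond : condEntropy L (fun a => a.2.2.2.1) (fun a => (a.2.2.1, a.2.2.2.2.2)) =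
      entropy L (fun a => a.2.2.2.1) :=
    condEntropy_eq_entropy_of_indep hLmem _ _ fun u v => by rw [hg, hU, hV]; rfl
  have hS : 𝔭.S (Z := Z) = fun ω => (T ω).2.2.2.1 := funext (twoRound_S p q _ _ id _)
  have hSest : 𝔭.Sest (Z := Z) = fun _ => (0 : Fin 2) := funext (twoRound_Sest p q _ _ id _)
  have hview : 𝔭.viewE (Z := Z) = fun ω =>
      (piFinTwoEquiv (fun r : Fin 2 => Fin (![k, k] r) → Z (sender p r))).symm
        ((T ω).2.2.1, (T ω).2.2.2.2.2) := funext (twoRound_viewE p q _ _ id _)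
  have hent : entropy (𝔭.law W) 𝔭.S = entropy L (fun a => a.2.2.2.1) := by
    rw [hS, ← hT, entropy_distr]; rfl
  have hcond' : condEntropy (𝔭.law W) 𝔭.S 𝔭.viewE = entropy (𝔭.law W) 𝔭.S := by
    rw [hent, ← hcond, ← hT, condEntropy_distr, hview, hS]
    exact condEntropy_comp_equiv _ _ _ _
  have hpos : 0 < entropy (𝔭.law W) 𝔭.S := by
    rw [hent]
    simp only [entropy, hU]
    rw [Fin.sum_univ_two]
    have hlog := Real.log_pos one_lt_two
    have h1 : 0 < Real.negMulLog (β 1) := by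
      change 0 < -(δ / 2) * Real.log (δ / 2)
      exact mul_pos_of_neg_of_neg (by linarith) (Real.log_neg (by linarith) (by linarith))
    have h0 : 0 ≤ Real.negMulLog (β 0) :=
      Real.negMulLog_nonneg (sub_nonneg.mpr (by linarith)) (sub_le_self _ (by linarith))
    positivity
  have huses : 𝔭.uses = k + k := twoRound_uses p q _ _ id _
  have hu : (0 : ℝ) < (k + k : ℕ) := by push_cast; linarith
  refine ⟨𝔭, rfl, rfl, ?_, ?_, ?_, ?_, ?_⟩
  · rw [huses]; exact_mod_cast hu
  · rw [huses]
    have := div_pos hpos hu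
    linarith
  · rw [huses]
    have h1 := div_pos hpos hu
    have h2 : Real.logb 2 (𝔭.keySize : ℝ) = 1 := Real.logb_self_eq_one one_lt_two
    rw [h2]
    refine lt_of_le_of_lt ?_ h1
    rw [sub_nonpos, div_le_iff₀ hu]
    push_cast; nlinarith
  · rw [hS, hSest]
    have h1 := prob_distr (𝔭.law W) T (fun a => (0 : Fin 2) ≠ a.2.2.2.1)
    have h2 : prob L (fun a => (0 : Fin 2) ≠ a.2.2.2.1) = β 1 := by
      refine Eq.trans ?_ (congrFun hU 1)
      unfold distr
      congr 1
      funext a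
      apply propext
      have h3 : ∀ t : Fin 2, 0 ≠ t ↔ t = 1 := by decide
      exact h3 _
    rw [hT, h2] at h1
    refine lt_of_eq_of_lt h1.symm ?_
    change δ / 2 < δ
    linarith
  · rw [hcond', div_self hpos.ne']
    linarith

end ZeroRate

/-! ### The lower bound on the capacity -/

theorem theorem1 {X Y Z : Party → Type*}
    [∀ p, Fintype (X p)] [∀ p, Fintype (Y p)] [∀ p, Fintype (Z p)]
    (W : ∀ p, X p → stdSimplex ℝ (Y p × Z p)) :
    max (initiatorBound W Party.alice) (initiatorBound W Party.bob) ≤ secretKeyCapacity W ∧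
    ∀ (p : Party) (R : ℝ), 0 ≤ R → (R : EReal) ≤ initiatorBound W p →
      ∀ δ : ℝ, 0 < δ → δ ≤ 1 →
        ∃ 𝔭 : Protocol X Y, 𝔭.rounds = 2 ∧ 𝔭.initiator = p ∧ 𝔭.IsSecure W R δ := by
  have zero : ∀ (p : Party) (_ : OutputVars (W p)) (_ : InputVars (W p.other)) (δ : ℝ), 0 < δ →
      δ ≤ 1 → ∃ 𝔭 : Protocol X Y, 𝔭.rounds = 2 ∧ 𝔭.initiator = p ∧ 𝔭.IsSecure W 0 δ := by
    intro p A B δ hδ hδ1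
    -- Auxiliary variables have laws of total mass one, so their existence makes the input alphabets
    -- nonempty and provides letters to send.
    have hA : Nonempty (Fin A.sizeV × X p × Y p × Z p) := by
      by_contra h
      rw [not_nonempty_iff] at h
      have := A.mem.2
      rw [Fintype.sum_empty] at this
      exact zero_ne_one this
    have hB : Nonempty (Fin B.sizeW₂ × Fin B.sizeW₁ × X p.other × Y p.other × Z p.other) := by
      by_contra h
      rw [not_nonempty_iff] at h
      have := B.mem.2
      rw [Fintype.sum_empty] at this
      exact zero_ne_one this
    exact exists_secure_zero W p hA.some.2.1 hB.some.2.2.1 hδ hδ1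
  have key : ∀ (p : Party) (R : ℝ), 0 ≤ R → (R : EReal) ≤ initiatorBound W p →
      ∀ δ : ℝ, 0 < δ → δ ≤ 1 →
        ∃ 𝔭 : Protocol X Y, 𝔭.rounds = 2 ∧ 𝔭.initiator = p ∧ 𝔭.IsSecure W R δ := by
    intro p R hR hle δ hδ hδ1
    -- For R = 0 the bound is not the empty supremum, so auxiliary variables exist and the coin
    -- protocol applies.
    rcases hR.eq_or_lt with rfl | hR
    · obtain ⟨c, ⟨n, m, A, B, -, -⟩, -⟩ := lt_sSup_iff.mp
        (lt_of_lt_of_le (EReal.bot_lt_coe 0) hle)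
      exact zero p A B δ hδ hδ1
    -- The supremum need not be attained: a value above R - δ/2 is realised with tolerance δ/2. The
    -- maximum with 0 makes that value positive.
    · have hlt : ((max (R - δ / 2) 0 : ℝ) : EReal) < initiatorBound W p :=
        lt_of_lt_of_le (EReal.coe_lt_coe_iff.mpr (max_lt (by linarith) hR)) hle
      obtain ⟨c, ⟨n, m, A, B, h, rfl⟩, hc⟩ := lt_sSup_iff.mp hlt
      rw [EReal.coe_lt_coe_iff, max_lt_iff] at hc
      obtain ⟨𝔭, h1, h2, h3⟩ := exists_secure_of_pos W p A B h hc.2 (half_pos hδ) (by linarith)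
      exact ⟨𝔭, h1, h2, h3.mono (by linarith) (by linarith)⟩
  have hle : ∀ p, initiatorBound W p ≤ secretKeyCapacity W := by
    intro p
    refine sSup_le fun c hc => ?_
    obtain ⟨n, m, A, B, h, rfl⟩ := hc
    -- Values of the objective may be negative while only nonnegative rates count for the capacity;
    -- these values are dominated by rate zero.
    rcases le_or_gt ((n * A.Rs1 + m * max 0 B.Rs2) / ((n : ℝ) + m)) 0 with hv | hv
    · refine (EReal.coe_le_coe_iff.mpr hv).trans (le_sSup ⟨0, rfl, le_rfl, fun δ hδ hδ1 => ?_⟩)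
      obtain ⟨𝔭, -, -, h𝔭⟩ := zero p A B δ hδ hδ1
      exact ⟨𝔭, h𝔭⟩
    · refine le_sSup ⟨_, rfl, hv.le, fun δ hδ hδ1 => ?_⟩
      obtain ⟨𝔭, -, -, h𝔭⟩ := exists_secure_of_pos W p A B h hv hδ hδ1
      exact ⟨𝔭, h𝔭⟩
  exact ⟨max_le (hle _) (hle _), key⟩
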